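/- **Theorem (canonical strong stable manifold).** Let $r\ge 1$ be an integer, $\lambda,\rho,\epsilon\in(0,1)$, $L\ge 1$, $\delta>0$ and $A,B,A'$ real numbers. Let $\Omega\subset\mathbb R^2$ be open and let $F:\Omega\to F(\Omega)\Subset\Omega$ be a $C^{r+1}$-diffeomorphism with $\|DF\|\le A$, $\|DF\|_{C^r}\le B$ and $\|DF^{-1}\|\le A'$. Let $p_0\in\Omega$ and write $q_n:=F^n(q_0)$ for $q_0\in\Omega$. Suppose that $p_0$ is infinitely forward $(L,\epsilon,\lambda,\rho)_v$-regular along a line $E^v_{p_0}$, that is, for all $n\ge 1$, $$L^{-1}\lambda^{(1+\epsilon)n}\le\|DF^n|_{E^v_{p_0}}\|\le L\lambda^{(1-\epsilon)n},\qquad L^{-1}\rho^{(1+\epsilon)n}\le\frac{\|DF^n|_{E^v_{p_0}}\|^2}{|\det D_{p_0}F^n|}\le L\rho^{(1-\epsilon)n},$$ and that each $p_n$ $(n\ge0)$ has distance at least $\delta$ from the complement of $\Omega$ (some such $\delta$ always exists). Put $E^v_{p_n}:=DF^n(E^v_{p_0})$. Assume $$\frac{\rho^{(r+1)-\epsilon(r+3)}}{\lambda^{(1+\epsilon)r}}<1,\qquad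 \frac{\lambda^{(1-\epsilon)(r+1)}}{\rho^{r+\epsilon(2-r)}}<1,\qquad \lambda^{1-\epsilon}<\rho^{8\epsilon}\lambda^{4\epsilon},\qquad \lambda^{1-\epsilon}<\frac{\lambda^{1+\epsilon}}{\rho^{1-\epsilon}}.$$ Define the strong stable set (with $\log 0=-\infty$) $$W^{ss}(p_0):=\Big\{q_0\in\Omega \;\Big|\; \limsup_{n\to\infty}\tfrac1n\log\|q_n-p_n\|\le(1-\epsilon)\log\lambda\Big\}.$$ Let $\omega:=\frac{\rho^{1-\epsilon}}{1-\rho^{1-\epsilon}}A'A$, $\check\lambda:=\lambda^{1+\epsilon}(1-\lambda^\epsilon)$, $\mathcal K_n:=L^3\rho^{-2\epsilon}\lambda^{1-\epsilon}A'(1+\omega)^5\rho^{-4\epsilon n}\lambda^{-2\epsilon n}$ and, for $C\ge1$, $l_n:=\check\lambda(C\mathcal K_n)^{-1}$. A *system of regular charts with constant $C$* consists, for each $n\ge0$, of an open set $\mathcal U_n\subset\Omega$ containing $p_n$, a $C^r$-diffeomorphism $\Phi_n:\mathcal U_n\to(-l_n,l_n)^2$ with $\Phi_n(p_n)=0$,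 sending $E^v_{p_n}$ to the vertical direction, with $\|D^k\Phi_n^{-1}\|\le C(1+\omega)$ and $\|D^k\Phi_n\|\le C\mathcal K_n^k$ for $1\le k\le r$, and a $C^r$-diffeomorphism $F_n$ of $\mathbb R^2$ fixing $0$ that extends $\Phi_{n+1}\circ F\circ\Phi_n^{-1}$, such that $\|DF_n\|_{C^{r-1}}\le CB$, $D_0F_n=\operatorname{diag}\big(\lambda^{1-\epsilon}\rho^{-1-3\epsilon},\lambda^{1-\epsilon}\rho^{-2\epsilon}\big)$, $\|D_zF_n-D_0F_n\|<\check\lambda$ for all $z$, and $F_n$ maps the vertical axis to itself (as is the case when $F_n(x,y)=(f_n(x),e_n(x,y))$ with $f_n(0)=0$). Put $W^v_{\rm loc}(p_n):=\Phi_n^{-1}(\{(0,y): |y|<l_n\})$. 1. There is a constant $C\ge1$, depending only on $r,L,\epsilon,\lambda,\rho,A,B,A',\delta$, such that a system of regular charts with constant $C$ exists. 2. For every system of regular charts, with any constant $C\ge1$, $$W^{ss}(p_0)=\bigcup_{n=0}^\infty F^{-n}\big(W^v_{\rm loc}(p_n)\big).$$ Moreover $W^{ss}(p_0)$ is a (not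 necessarily connected, injectively immersed) one-dimensional $C^{r+1}$-submanifold, in which every $F^{-n}(W^v_{\rm loc}(p_n))$ is open and which is tangent to $E^v_{p_0}$ at $p_0$; and the local piece $W^v_{\rm loc}(p_0)$ has an arc-length parametrization of class $C^{r+1}$ whose derivatives of orders $1,\dots,r$ are bounded by a constant that depends only on $C,r,L,\epsilon,\lambda,\rho,A,B,A',\delta$. -/

import Mathlib

open Set Filter Topology

noncomputable section

namespace QPesin

/-- The Euclidean plane. -/
abbrev Plane : Type := EuclideanSpace ℝ (Fin 2)

/-- `F` is a `C^{r+1}`-diffeomorphism of the open set `Ω` onto its image, which is relatively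
compact in `Ω`; `A`, `B`, `A'` are upper bounds for `‖DF‖`, `‖DF‖_{C^r}` and `‖DF⁻¹‖`. -/
structure IsDissipativeDiffeo (r : ℕ) (A B A' : ℝ) (Ω : Set Plane) (F : Plane → Plane) :
    Prop where
  isOpen : IsOpen Ω
  contDiffOn : ContDiffOn ℝ ((r + 1 : ℕ) : WithTop ℕ∞) F Ω
  injOn : InjOn F Ω
  isCompact_closure : IsCompact (closure (F '' Ω))
  closure_subset : closure (F '' Ω) ⊆ Ω
  norm_fderiv_le : ∀ q ∈ Ω, ‖fderiv ℝ F q‖ ≤ A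
  norm_deriv_le : ∀ q ∈ Ω, ∀ k : ℕ, 1 ≤ k → k ≤ r + 1 → ‖iteratedFDeriv ℝ k F q‖ ≤ B
  norm_inv_le : ∀ q ∈ Ω, ∀ v : Plane, ‖v‖ ≤ A' * ‖fderiv ℝ F q v‖

/-- The absolute value of the Jacobian determinant of `F^n` at `p`. -/
def jac (F : Plane → Plane) (n : ℕ) (p : Plane) : ℝ := |(fderiv ℝ (F^[n]) p).det|

/-- `p` is `N`-times forward `(L, ε, lam, ρ)_v`-regular along the line spanned by the unit
vector `e`. -/
def IsForwardRegular (L ε lam ρ : ℝ) (N : ℕ∞) (F : Plane → Plane) (p e : Plane) : Prop :=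
  ∀ n : ℕ, 1 ≤ n → (n : ℕ∞) ≤ N →
    (L⁻¹ * lam ^ ((1 + ε) * n) ≤ ‖fderiv ℝ (F^[n]) p e‖ ∧
      ‖fderiv ℝ (F^[n]) p e‖ ≤ L * lam ^ ((1 - ε) * n)) ∧
    (L⁻¹ * ρ ^ ((1 + ε) * n) ≤ ‖fderiv ℝ (F^[n]) p e‖ ^ 2 / jac F n p ∧
      ‖fderiv ℝ (F^[n]) p e‖ ^ 2 / jac F n p ≤ L * ρ ^ ((1 - ε) * n))

/-- The strong stable set of `p`: the points `q` of `Ω` with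
`limsup (1/n) log ‖q_n - p_n‖ ≤ (1 - ε) log lam`, where `log 0 = -∞`. -/
def strongStable (ε lam : ℝ) (Ω : Set Plane) (F : Plane → Plane) (p : Plane) : Set Plane :=
  {q | q ∈ Ω ∧
    limsup (fun n : ℕ => ENNReal.log (edist (F^[n] q) (F^[n] p)) / ((n : ℝ) : EReal)) atTop ≤
      (((1 - ε) * Real.log lam : ℝ) : EReal)}

/-- The open square `(-l, l) × (-l, l)`. -/
def box (l : ℝ) : Set Plane := {z | |z 0| < l ∧ |z 1| < l}

/-- The cone opening `ω = ρ^{1-ε} / (1 - ρ^{1-ε}) ‖DF⁻¹‖ ‖DF‖`. -/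
def coneOpening (ε ρ A A' : ℝ) : ℝ := ρ ^ (1 - ε) / (1 - ρ ^ (1 - ε)) * A' * A

/-- The distortion factor `𝒦_n` of the chart at `p_n`. -/
def distortion (L ε lam ρ A A' : ℝ) (n : ℕ) : ℝ :=
  L ^ 3 * ρ ^ (-(2 * ε)) * lam ^ (1 - ε) * A' * (1 + coneOpening ε ρ A A') ^ 5 /
    (ρ ^ (4 * ε * n) * lam ^ (2 * ε * n))

/-- `lam^{1+ε} (1 - lam^ε)`. -/
def lamCheck (ε lam : ℝ) : ℝ := lam ^ (1 + ε) * (1 - lam ^ ε)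

/-- The regular radius `l_n`. -/
def regularRadius (L ε lam ρ A A' C : ℝ) (n : ℕ) : ℝ :=
  lamCheck ε lam / (C * distortion L ε lam ρ A A' n)

/-- Regular charts `Φ n` at `p_n = F^n p` and chart representations `G n` of `F`, for `n ≥ 0`,
with constant `C`.

Of the skew-product form `(x, y) ↦ (f_n(x), e_n(x, y))`, `f_n(0) = 0`, of the maps of a
Q-linearization only the invariance of the vertical axis is required, which is what the local
vertical manifolds depend on: every Q-linearization is a system in this sense. -/
structure IsRegularChartSystem (r : ℕ) (L ε lam ρ A B A' C : ℝ) (Ω : Set Plane)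
    (F : Plane → Plane) (p e : Plane) (Φ : ℕ → OpenPartialHomeomorph Plane Plane)
    (G : ℕ → Plane → Plane) : Prop where
  source_subset : ∀ n, (Φ n).source ⊆ Ω
  target_eq : ∀ n, (Φ n).target = box (regularRadius L ε lam ρ A A' C n)
  mem_source : ∀ n, F^[n] p ∈ (Φ n).source
  map_base : ∀ n, Φ n (F^[n] p) = 0
  contDiffOn : ∀ n, ContDiffOn ℝ (r : WithTop ℕ∞) (Φ n) (Φ n).source
  contDiffOn_symm : ∀ n, ContDiffOn ℝ (r : WithTop ℕ∞) (Φ n).symm (Φ n).target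
  /-- `DΦ_n` sends the direction `E^v` at `p_n` to the vertical direction. -/
  vertical : ∀ n, ∃ c : ℝ,
    fderiv ℝ (Φ n) (F^[n] p) (fderiv ℝ (F^[n]) p e) = c • (!₂[0, 1] : Plane)
  norm_symm_le : ∀ n, ∀ z ∈ (Φ n).target, ∀ k : ℕ, 1 ≤ k → k ≤ r →
    ‖iteratedFDeriv ℝ k (Φ n).symm z‖ ≤ C * (1 + coneOpening ε ρ A A')
  norm_le : ∀ n, ∀ q ∈ (Φ n).source, ∀ k : ℕ, 1 ≤ k → k ≤ r →
    ‖iteratedFDeriv ℝ k (Φ n) q‖ ≤ C * distortion L ε lam ρ A A' n ^ k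
  /-- `G n` is a `C^r`-diffeomorphism of the plane. -/
  diffeo : ∀ n, ContDiff ℝ (r : WithTop ℕ∞) (G n) ∧ ∃ H : Plane → Plane,
    ContDiff ℝ (r : WithTop ℕ∞) H ∧ Function.LeftInverse H (G n) ∧ Function.RightInverse H (G n)
  /-- `G n` extends `Φ_{n+1} ∘ F ∘ Φ_n⁻¹`. -/
  conj : ∀ n, ∀ q ∈ (Φ n).source, F q ∈ (Φ (n + 1)).source → Φ (n + 1) (F q) = G n (Φ n q)
  map_zero : ∀ n, G n 0 = 0
  norm_map_le : ∀ n, ∀ z : Plane, ∀ k : ℕ, 1 ≤ k → k ≤ r → ‖iteratedFDeriv ℝ k (G n) z‖ ≤ C * B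
  fderiv_zero : ∀ n, ∀ v : Plane, fderiv ℝ (G n) 0 v =
    !₂[lam ^ (1 - ε) / ρ ^ (1 + 3 * ε) * v 0, lam ^ (1 - ε) / ρ ^ (2 * ε) * v 1]
  almost_linear : ∀ n, ∀ z : Plane, ‖fderiv ℝ (G n) z - fderiv ℝ (G n) 0‖ < lamCheck ε lam
  vertical_axis : ∀ n, ∀ y : ℝ, G n !₂[0, y] 0 = 0

/-- The local vertical manifold of a chart: the preimage of the vertical axis. -/
def localVertical (Φ : OpenPartialHomeomorph Plane Plane) : Set Plane :=
  {q | q ∈ Φ.source ∧ Φ q 0 = 0}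

/-- `F^{-n}(W^v_loc(p_n))`, the preimage under `F^n : Ω → Ω`. -/
def stablePiece (Ω : Set Plane) (F : Plane → Plane)
    (Φ : ℕ → OpenPartialHomeomorph Plane Plane) (n : ℕ) : Set Plane :=
  {q | q ∈ Ω ∧ F^[n] q ∈ localVertical (Φ n)}

/-- The set `S` is an (injectively immersed) one-dimensional `C^k`-submanifold of the plane, with
the countable atlas `γ`: each `γ i` is a regular, embedded open `C^k`-arc, the arcs cover `S`, and
any two of them meet in a relatively open subset of each. -/
structure IsCurveAtlas (k : ℕ) (S : Set Plane) (γ : ℕ → ℝ → Plane) : Prop where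
  contDiffOn : ∀ i, ContDiffOn ℝ (k : WithTop ℕ∞) (γ i) (Ioo (-1) 1)
  regular : ∀ i, ∀ t ∈ Ioo (-1 : ℝ) 1, deriv (γ i) t ≠ 0
  embedding : ∀ i, IsEmbedding (fun t : Ioo (-1 : ℝ) 1 => γ i t)
  cover : ⋃ i, γ i '' Ioo (-1) 1 = S
  overlap : ∀ i j, IsOpen {t : ℝ | t ∈ Ioo (-1) 1 ∧ γ i t ∈ γ j '' Ioo (-1) 1}

/-- `S` has a bijective arc-length parametrization of class `C^{r+1}` through `p` at time `0`,
tangent to `e` there, whose derivatives of orders `1, …, r` are bounded by `K`. -/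
def HasBoundedArcLength (r : ℕ) (K : ℝ) (S : Set Plane) (p e : Plane) : Prop :=
  ∃ (a b : ℝ) (γ : ℝ → Plane), a < 0 ∧ 0 < b ∧ γ 0 = p ∧
    InjOn γ (Ioo a b) ∧ γ '' Ioo a b = S ∧
    ContDiffOn ℝ ((r + 1 : ℕ) : WithTop ℕ∞) γ (Ioo a b) ∧
    (∀ t ∈ Ioo a b, ‖deriv γ t‖ = 1) ∧
    deriv γ 0 ∈ Submodule.span ℝ {e} ∧
    ∀ t ∈ Ioo a b, ∀ k : ℕ, 1 ≤ k → k ≤ r → ‖iteratedDeriv k γ t‖ ≤ K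

/-- The standing situation: `F` is a dissipative `C^{r+1}`-diffeomorphism, `p ∈ Ω` is infinitely
forward regular along the direction of the unit vector `e`, and the forward orbit of `p` keeps
distance at least `δ` from the complement of `Ω`. -/
structure IsRegularOrbit (r : ℕ) (L ε lam ρ A B A' δ : ℝ) (Ω : Set Plane)
    (F : Plane → Plane) (p e : Plane) : Prop where
  diffeo : IsDissipativeDiffeo r A B A' Ω F
  mem : p ∈ Ω
  norm_direction : ‖e‖ = 1
  regular : IsForwardRegular L ε lam ρ ⊤ F p e
  ball_subset : ∀ n : ℕ, Metric.ball (F^[n] p) δ ⊆ Ω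

end QPesin

end

/-! Linear coordinates. Along the orbit of `p` use the frame formed by the images of `e` and of its
normal, divided by `rateY ^ n` and `rateX ^ n`. In these coordinates `T n` the derivative of `F` is
the constant matrix diag(`rateX`, `rateY`). Regularity bounds the inverses of `T n` uniformly. `T n`
itself may grow like `slow ^ (-n)`, but ‖T (n+1)‖ ‖(T n)⁻¹‖² stays bounded. Hence `F`, read in these
coordinates, has uniformly bounded derivatives of orders 2, …, r + 1 on a disc of fixed radius. A
cutoff turns it into globally defined maps that are C¹-close to one diagonal map
(`exists_isAdapted`).

Invariant graphs. Since `rateY` is less than `rateX` and 1, fix a rate μ in between. The points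
whose forward orbits are O(μ^m) form graphs over the vertical axis, tangent to it at the origin
(`exists_invariant_graphs`). They come from a fixed point equation on bounded sequences
(Lyapunov–Perron). The solution is C^{r+1}, top order included, because the derivatives of order at
least 2 of the rescaled nonlinearity decay along the orbit. Shearing the graphs onto the vertical
axis gives the charts of the first assertion (`exists_isRegularChartSystem`).

Arbitrary charts. A given chart system is only C^r, and in it `F` is only known to be almost linear,
so the graphs above ("leaves") serve as a reference. Three inclusions close a cycle
(`strongStable_eq`). A point of the strong stable set converges so fast that it eventually lies in
the shrinking charts, where a nonzero horizontal coordinate would expand faster than the convergence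
permits; so it reaches a local vertical manifold. A local vertical manifold contracts at the cruder
rate `rateY + lamCheck`, which still forces its iterates onto the leaves after a time uniform over
the piece. On a leaf the nonlinearity is quadratic, so contraction holds at exactly the rate `rateY`
up to a constant; together with the size of (T n)⁻¹ this is the rate λ^{1-ε} that defines the strong
stable set.

Regularity. The leaves are C^{r+1}, and so are their preimages under iterates of `F`; these
preimages form the atlas, and overlaps are examined after pushing both arcs into a common leaf
(`isOpen_trace`). For the local piece the two descriptions are combined: the chart bounds the
derivatives up to order r (`exists_arcLength_bound`), while the leaf shows that the same unit-speed
curve is of class C^{r+1} (`contDiffOn_unit_speed`). -/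

open Set Filter Topology

noncomputable section

namespace QPesin

set_option maxSynthPendingDepth 3

/-! ### Derivative bounds under composition and bilinear pairing. -/

section DerivativeBounds

variable {E G H : Type*} [NormedAddCommGroup E] [NormedSpace ℝ E] [NormedAddCommGroup G]
  [NormedSpace ℝ G] [NormedAddCommGroup H] [NormedSpace ℝ H]

/-- The derivatives of `f` of orders `1, …, n` are bounded by `M` on `s`. -/
def DerivBound (n : ℕ) (M : ℝ) (f : E → G) (s : Set E) : Prop :=
  ∀ k, 1 ≤ k → k ≤ n → ∀ x ∈ s, ‖iteratedFDeriv ℝ k f x‖ ≤ M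

/-- The derivatives of `f` of orders `0, …, n` are bounded by `M` on `s`. -/
def JetBound (n : ℕ) (M : ℝ) (f : E → G) (s : Set E) : Prop :=
  ∀ k, k ≤ n → ∀ x ∈ s, ‖iteratedFDeriv ℝ k f x‖ ≤ M

theorem JetBound.derivBound {n : ℕ} {M : ℝ} {f : E → G} {s : Set E} (h : JetBound n M f s) :
    DerivBound n M f s := fun k _ hk => h k hk

theorem DerivBound.mono {n m : ℕ} {M N : ℝ} {f : E → G} {s t : Set E} (h : DerivBound n M f s)
    (hm : m ≤ n) (hM : M ≤ N) (hs : t ⊆ s) : DerivBound m N f t :=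
  fun k h1 hk x hx => (h k h1 (hk.trans hm) x (hs hx)).trans hM

theorem JetBound.mono {n m : ℕ} {M N : ℝ} {f : E → G} {s t : Set E} (h : JetBound n M f s)
    (hm : m ≤ n) (hM : M ≤ N) (hs : t ⊆ s) : JetBound m N f t :=
  fun k hk x hx => (h k (hk.trans hm) x (hs hx)).trans hM

theorem iteratedFDeriv_congr_of_eqOn {f g : E → G} {s : Set E} (hs : IsOpen s) (h : EqOn f g s)
    (k : ℕ) {x : E} (hx : x ∈ s) : iteratedFDeriv ℝ k f x = iteratedFDeriv ℝ k g x := by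
  have : f =ᶠ[𝓝 x] g := by filter_upwards [hs.mem_nhds hx] with y hy using h hy
  exact (this.iteratedFDeriv ℝ k).eq_of_nhds

theorem norm_iteratedFDeriv_sub_const {f : E → G} {k : ℕ} (hk : 1 ≤ k) (c : G) (x : E) :
    iteratedFDeriv ℝ k (fun y => f y - c) x = iteratedFDeriv ℝ k f x := by
  obtain ⟨k, rfl⟩ := Nat.exists_eq_add_of_le' hk
  have : fderiv ℝ (fun y => f y - c) = fderiv ℝ f := by
    ext1 y; rw [fderiv_sub_const]
  rw [iteratedFDeriv_succ_eq_comp_right, iteratedFDeriv_succ_eq_comp_right, this]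

/-- The Faà di Bruno estimate asks for a bound on the outer function itself. Subtracting the
constant `g (f x)` makes that term vanish at the point considered and changes no derivative of
positive order. Using `max 1 N` makes one number serve as the base of a power bound in every order.
-/
theorem DerivBound.comp {n : ℕ} {M N : ℝ} {g : G → H} {f : E → G} {s : Set E} {t : Set G}
    (hs : IsOpen s) (ht : IsOpen t) (hg : ContDiffOn ℝ n g t) (hf : ContDiffOn ℝ n f s)
    (hst : MapsTo f s t) (hgM : DerivBound n M g t) (hfN : DerivBound n N f s) (hM : 0 ≤ M) :
    DerivBound n (n.factorial * M * max 1 N ^ n) (g ∘ f) s := by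
  intro k h1 hk x hx
  have hkn : ((k : ℕ) : WithTop ℕ∞) ≤ n := by exact_mod_cast hk
  have e1 : iteratedFDeriv ℝ k (g ∘ f) x
      = iteratedFDerivWithin ℝ k ((fun y => g y - g (f x)) ∘ f) s x := by
    rw [iteratedFDerivWithin_of_isOpen k hs hx]
    exact (norm_iteratedFDeriv_sub_const h1 (g (f x)) x).symm
  rw [e1]
  have hmax : (1 : ℝ) ≤ max 1 N := le_max_left _ _
  refine (norm_iteratedFDerivWithin_comp_le (C := M) (D := max 1 N) (N := n) (t := t)
    (hg.sub contDiffOn_const) hf hkn ht.uniqueDiffOn hs.uniqueDiffOn hst hx ?_ ?_).trans ?_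
  · intro i hi
    rw [iteratedFDerivWithin_of_isOpen i ht (hst hx)]
    rcases Nat.eq_zero_or_pos i with rfl | hi0
    · simpa using hM
    · rw [norm_iteratedFDeriv_sub_const hi0]
      exact hgM i hi0 (hi.trans hk) _ (hst hx)
  · intro i hi1 hi
    rw [iteratedFDerivWithin_of_isOpen i hs hx]
    calc _ ≤ N := hfN i hi1 (hi.trans hk) x hx
      _ ≤ max 1 N := le_max_right _ _
      _ ≤ max 1 N ^ i := le_self_pow₀ hmax (by omega)
  · gcongr

theorem JetBound.comp {n : ℕ} {M N : ℝ} {g : G → H} {f : E → G} {s : Set E} {t : Set G}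
    (hs : IsOpen s) (ht : IsOpen t) (hg : ContDiffOn ℝ n g t) (hf : ContDiffOn ℝ n f s)
    (hst : MapsTo f s t) (hgM : JetBound n M g t) (hfN : DerivBound n N f s) (hM : 0 ≤ M) :
    JetBound n (n.factorial * M * max 1 N ^ n) (g ∘ f) s := by
  intro k hk x hx
  rcases Nat.eq_zero_or_pos k with rfl | hk0
  · have h := hgM 0 (Nat.zero_le _) (f x) (hst hx)
    simp only [norm_iteratedFDeriv_zero, Function.comp_apply] at h ⊢
    have h1 : (1 : ℝ) ≤ n.factorial := by exact_mod_cast Nat.one_le_iff_ne_zero.2 n.factorial_ne_zero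
    have h2 : (1 : ℝ) ≤ max 1 N ^ n := one_le_pow₀ (le_max_left _ _)
    calc _ ≤ M := h
      _ = 1 * M * 1 := by ring
      _ ≤ _ := by gcongr
  · exact DerivBound.comp hs ht hg hf hst hgM.derivBound hfN hM k hk0 hk x hx

theorem JetBound.bilinear {n : ℕ} {M N : ℝ} {E₁ E₂ : Type*} [NormedAddCommGroup E₁]
    [NormedSpace ℝ E₁] [NormedAddCommGroup E₂] [NormedSpace ℝ E₂] (B : E₁ →L[ℝ] E₂ →L[ℝ] H)
    {f : E → E₁} {g : E → E₂} {s : Set E} (hs : IsOpen s) (hf : ContDiffOn ℝ n f s)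
    (hg : ContDiffOn ℝ n g s) (hfM : JetBound n M f s) (hgN : JetBound n N g s)
    (hM : 0 ≤ M) :
    JetBound n (‖B‖ * (2 ^ n * M * N)) (fun y => B (f y) (g y)) s := by
  intro k hk x hx
  have hN : 0 ≤ N := (norm_nonneg _).trans (hgN 0 (Nat.zero_le _) x hx)
  have hkn : ((k : ℕ) : WithTop ℕ∞) ≤ n := by exact_mod_cast hk
  rw [← iteratedFDerivWithin_of_isOpen k hs hx]
  refine (B.norm_iteratedFDerivWithin_le_of_bilinear hf hg hs.uniqueDiffOn hx hkn).trans ?_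
  gcongr
  calc _ ≤ ∑ i ∈ Finset.range (k + 1), (k.choose i : ℝ) * M * N := by
        refine Finset.sum_le_sum fun i hi => ?_
        rw [Finset.mem_range] at hi
        rw [iteratedFDerivWithin_of_isOpen i hs hx, iteratedFDerivWithin_of_isOpen (k - i) hs hx]
        have h1 := hfM i (by omega) x hx
        have h2 := hgN (k - i) (by omega) x hx
        gcongr
    _ = 2 ^ k * M * N := by
        rw [← Finset.sum_mul, ← Finset.sum_mul, ← Nat.cast_sum, Nat.sum_range_choose]
        push_cast; ring
    _ ≤ 2 ^ n * M * N := by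
        gcongr
        norm_num

theorem JetBound.clm_comp {n : ℕ} {M : ℝ} (T : G →L[ℝ] H) {f : E → G} {s : Set E}
    (hs : IsOpen s) (hf : ContDiffOn ℝ n f s) (h : JetBound n M f s) :
    JetBound n (‖T‖ * M) (T ∘ f) s := by
  intro k hk x hx
  have hkn : ((k : ℕ) : WithTop ℕ∞) ≤ n := by exact_mod_cast hk
  refine (T.norm_iteratedFDeriv_comp_left (hf.contDiffAt (hs.mem_nhds hx)) hkn).trans ?_
  gcongr
  exact h k hk x hx

theorem DerivBound.clm_comp {n : ℕ} {M : ℝ} (T : G →L[ℝ] H) {f : E → G} {s : Set E}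
    (hs : IsOpen s) (hf : ContDiffOn ℝ n f s) (h : DerivBound n M f s) :
    DerivBound n (‖T‖ * M) (T ∘ f) s := by
  intro k h1 hk x hx
  have hkn : ((k : ℕ) : WithTop ℕ∞) ≤ n := by exact_mod_cast hk
  refine (T.norm_iteratedFDeriv_comp_left (hf.contDiffAt (hs.mem_nhds hx)) hkn).trans ?_
  gcongr
  exact h k h1 hk x hx

theorem DerivBound.add {n : ℕ} {M N : ℝ} {f g : E → G} {s : Set E}
    (hs : IsOpen s) (hf : ContDiffOn ℝ n f s) (hg : ContDiffOn ℝ n g s)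
    (hfM : DerivBound n M f s) (hgN : DerivBound n N g s) :
    DerivBound n (M + N) (fun y => f y + g y) s := by
  intro k h1 hk x hx
  have hkn : ((k : ℕ) : WithTop ℕ∞) ≤ n := by exact_mod_cast hk
  have hf' := (hf.contDiffAt (hs.mem_nhds hx)).of_le hkn
  have hg' := (hg.contDiffAt (hs.mem_nhds hx)).of_le hkn
  have : (fun y => f y + g y) = f + g := rfl
  rw [this, iteratedFDeriv_add_apply hf' hg']
  exact (norm_add_le _ _).trans (add_le_add (hfM k h1 hk x hx) (hgN k h1 hk x hx))

theorem iteratedFDeriv_two_clm (T : E →L[ℝ] G) (k : ℕ) (x : E) :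
    iteratedFDeriv ℝ (k + 2) (T : E → G) x = 0 := by
  have h1 : fderiv ℝ (T : E → G) = fun _ => T := by ext1 y; exact T.fderiv
  have h2 : iteratedFDeriv ℝ (k + 1) (fderiv ℝ (T : E → G)) x = 0 := by
    rw [h1, iteratedFDeriv_const_of_ne (by omega)]; rfl
  have := norm_iteratedFDeriv_fderiv (𝕜 := ℝ) (f := (T : E → G)) (x := x) (n := k + 1)
  rw [h2, norm_zero] at this
  exact norm_eq_zero.1 this.symm

theorem norm_iteratedFDeriv_one' (f : E → G) (x : E) :
    ‖iteratedFDeriv ℝ 1 f x‖ = ‖fderiv ℝ f x‖ := by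
  rw [← zero_add 1, ← norm_iteratedFDeriv_fderiv, norm_iteratedFDeriv_zero]

theorem DerivBound.clm (n : ℕ) (T : E →L[ℝ] G) (s : Set E) : DerivBound n ‖T‖ T s := by
  intro k h1 _ x _
  rcases Nat.lt_or_ge 1 k with hk | hk
  · obtain ⟨j, rfl⟩ := Nat.exists_eq_add_of_le' hk
    rw [iteratedFDeriv_two_clm]; simp
  · obtain rfl : k = 1 := le_antisymm hk h1
    rw [norm_iteratedFDeriv_one', T.fderiv]

end DerivativeBounds

/-! ### Autonomous equations and inversion in a normed algebra. -/

section Bootstrap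

variable {X : Type*} [NormedAddCommGroup X] [NormedSpace ℝ X]

/-- If `u` is C^k then so is `u' = V ∘ u`, so `u` gains one order at a time until the regularity of
`V` is exhausted. -/
theorem contDiffOn_of_hasDerivAt_comp {n : ℕ} {u : ℝ → X} {V : X → X} {s : Set ℝ} {t : Set X}
    (hs : IsOpen s) (hst : MapsTo u s t) (hu : ∀ x ∈ s, HasDerivAt u (V (u x)) x)
    (hV : ContDiffOn ℝ n V t) : ContDiffOn ℝ (n + 1 : ℕ) u s := by
  have key : ∀ k ≤ n + 1, ContDiffOn ℝ (k : ℕ) u s := by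
    intro k
    induction k with
    | zero =>
      intro _
      exact contDiffOn_zero.2 fun x hx => (hu x hx).continuousAt.continuousWithinAt
    | succ k ih =>
      intro hk
      rw [Nat.cast_succ, contDiffOn_succ_iff_deriv_of_isOpen hs]
      refine ⟨fun x hx => (hu x hx).differentiableAt.differentiableWithinAt, by simp, ?_⟩
      refine ContDiffOn.congr (f := V ∘ u) ?_ fun x hx => (hu x hx).deriv
      exact (hV.of_le (by exact_mod_cast Nat.le_of_succ_le_succ hk)).comp (ih (by omega)) hst
  exact key _ le_rfl

/-- A bound for the derivatives of orders `1, …, n + 1` of a solution of `u' = V ∘ u` when the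
derivatives of `V` of orders `0, …, n` are bounded by `M`. -/
def flowBound (M : ℝ) : ℕ → ℝ
  | 0 => M
  | n + 1 => max (flowBound M n) ((n + 1).factorial * M * max 1 (flowBound M n) ^ (n + 1))

/-- The derivative of `u` of order k + 1 is that of `V ∘ u` of order k, which involves `u` only up
to order k. The bounds are therefore recursive and do not depend on the particular solution. -/
theorem derivBound_of_hasDerivAt_comp {M : ℝ} (hM : 0 ≤ M) {n : ℕ} {u : ℝ → X} {V : X → X}
    {s : Set ℝ} {t : Set X} (hs : IsOpen s) (ht : IsOpen t) (hst : MapsTo u s t)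
    (hu : ∀ x ∈ s, HasDerivAt u (V (u x)) x) (hV : ContDiffOn ℝ n V t) (hVM : JetBound n M V t) :
    DerivBound (n + 1) (flowBound M n) u s := by
  have step : ∀ k, ∀ x ∈ s,
      ‖iteratedFDeriv ℝ (k + 1) u x‖ = ‖iteratedFDeriv ℝ k (V ∘ u) x‖ := by
    intro k x hx
    have hd : EqOn (deriv u) (V ∘ u) s := fun y hy => (hu y hy).deriv
    rw [← iteratedFDeriv_congr_of_eqOn hs hd k hx, norm_iteratedFDeriv_eq_norm_iteratedDeriv,
      norm_iteratedFDeriv_eq_norm_iteratedDeriv, iteratedDeriv_succ']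
  induction n with
  | zero =>
    intro k h1 hk x hx
    obtain rfl : k = 0 + 1 := by omega
    rw [step 0 x hx, norm_iteratedFDeriv_zero]
    simpa [flowBound] using hVM 0 le_rfl (u x) (hst hx)
  | succ n ih =>
    have ih' := ih (hV.of_le (by exact_mod_cast Nat.le_succ n))
      (hVM.mono (Nat.le_succ n) le_rfl Subset.rfl)
    intro k h1 hk x hx
    rcases Nat.lt_or_ge k (n + 2) with hlt | hge
    · exact (ih' k h1 (by omega) x hx).trans (le_max_left _ _)
    · obtain rfl : k = n + 1 + 1 := by omega
      rw [step (n + 1) x hx]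
      have hc : ContDiffOn ℝ (n + 1 : ℕ) u s := contDiffOn_of_hasDerivAt_comp hs hst hu
        (hV.of_le (by exact_mod_cast Nat.le_succ n))
      exact (JetBound.comp hs ht hV hc hst hVM ih' hM (n + 1) le_rfl x hx).trans
        (le_max_right _ _)

/-- A bound for the derivatives of orders `0, …, n` of the inversion of a normed algebra at the
elements whose inverse has norm less than `c`. -/
def inverseBound (c : ℝ) : ℕ → ℝ
  | 0 => c
  | n + 1 => max (inverseBound c n) (2 ^ n * inverseBound c n * inverseBound c n)

theorem inverseBound_nonneg {c : ℝ} (hc : 0 ≤ c) (n : ℕ) : 0 ≤ inverseBound c n := by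
  induction n with
  | zero => exact hc
  | succ n ih => exact ih.trans (le_max_left _ _)

variable {A : Type*} [NormedRing A] [HasSummableGeomSeries A]

theorem isOpen_setOf_norm_inverse_lt (c : ℝ) :
    IsOpen {a : A | IsUnit a ∧ ‖Ring.inverse a‖ < c} := by
  rw [isOpen_iff_mem_nhds]
  rintro a ⟨⟨a, rfl⟩, hc⟩
  have h1 : ∀ᶠ b in 𝓝 (a : A), IsUnit b := Units.isOpen.mem_nhds a.isUnit
  have h2 : ∀ᶠ b in 𝓝 (a : A), ‖Ring.inverse b‖ < c :=
    ((NormedRing.inverse_continuousAt a).norm).eventually_lt continuousAt_const hc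
  exact h1.and h2

variable [NormedAlgebra ℝ A]

theorem contDiffOn_ringInverse (n : ℕ) (c : ℝ) :
    ContDiffOn ℝ n (Ring.inverse : A → A) {a : A | IsUnit a ∧ ‖Ring.inverse a‖ < c} := by
  rintro a ⟨⟨a, rfl⟩, -⟩
  exact (contDiffAt_ringInverse ℝ a).contDiffWithinAt

/-- The derivative of inversion is h ↦ -a⁻¹ h a⁻¹, a bilinear expression in inversion itself, so
order n + 1 reduces to order n. -/
theorem jetBound_ringInverse {c : ℝ} (hc : 0 ≤ c) (n : ℕ) :
    JetBound n (inverseBound c n) (Ring.inverse : A → A)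
      {a : A | IsUnit a ∧ ‖Ring.inverse a‖ < c} := by
  have ho := isOpen_setOf_norm_inverse_lt (A := A) c
  induction n with
  | zero =>
    intro k hk x hx
    obtain rfl : k = 0 := by omega
    simpa [inverseBound] using hx.2.le
  | succ n ih =>
    intro k hk x hx
    rcases Nat.lt_or_ge k (n + 1) with hlt | hge
    · exact (ih k (by omega) x hx).trans (le_max_left _ _)
    · obtain rfl : k = n + 1 := by omega
      rw [← norm_iteratedFDeriv_fderiv]
      have hd : EqOn (fderiv ℝ (Ring.inverse : A → A))
          (fun a => (-ContinuousLinearMap.mulLeftRight ℝ A) (Ring.inverse a) (Ring.inverse a))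
          {a : A | IsUnit a ∧ ‖Ring.inverse a‖ < c} := by
        rintro a ⟨⟨a, rfl⟩, -⟩
        rw [(hasFDerivAt_ringInverse (𝕜 := ℝ) a).fderiv]
        simp
      rw [iteratedFDeriv_congr_of_eqOn ho hd n hx]
      have h1 := JetBound.bilinear (-ContinuousLinearMap.mulLeftRight ℝ A) ho
        (contDiffOn_ringInverse n c) (contDiffOn_ringInverse n c) ih ih
        (inverseBound_nonneg hc n) n le_rfl x hx
      refine h1.trans (le_trans ?_ (le_max_right _ _))
      rw [norm_neg]
      have h0 := inverseBound_nonneg hc n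
      calc _ ≤ 1 * (2 ^ n * inverseBound c n * inverseBound c n) := by
            gcongr; exact ContinuousLinearMap.opNorm_mulLeftRight_le ℝ A
        _ = _ := one_mul _

end Bootstrap

/-! ### Injective local diffeomorphisms. -/

section Inverse

variable {E : Type*} [NormedAddCommGroup E] [NormedSpace ℝ E] [CompleteSpace E]

/-- An injective map on an open set whose derivative is everywhere invertible, as an open partial
homeomorphism. -/
theorem exists_openPartialHomeomorph [Nonempty E] {f : E → E} {U : Set E} (hU : IsOpen U)
    (hf : ContDiffOn ℝ 1 f U)
    (hinj : InjOn f U) (hd : ∀ x ∈ U, ∃ T : E ≃L[ℝ] E, (T : E →L[ℝ] E) = fderiv ℝ f x) :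
    ∃ φ : OpenPartialHomeomorph E E, φ.source = U ∧ φ.target = f '' U ∧ (φ : E → E) = f := by
  have hcont : ContinuousOn f U := hf.continuousOn
  refine ⟨OpenPartialHomeomorph.ofContinuousOpenRestrict (hinj.toPartialEquiv f U) hcont ?_ hU,
    rfl, rfl, rfl⟩
  rw [isOpenMap_iff_nhds_le]
  rintro ⟨x, hx'⟩
  have hx : x ∈ U := hx'
  obtain ⟨T, hT⟩ := hd x hx
  have hs : HasStrictFDerivAt f (T : E →L[ℝ] E) x := by
    rw [hT]
    exact ((hf.contDiffAt (hU.mem_nhds hx)).hasStrictFDerivAt (by norm_num))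
  have h1 := hs.map_nhds_eq_of_equiv
  change 𝓝 (f x) ≤ map (f ∘ Subtype.val) (𝓝 (⟨x, hx⟩ : U))
  rw [← Filter.map_map, map_nhds_subtype_coe_eq_nhds hx (hU.mem_nhds hx), h1]

end Inverse

/-! ### Smoothness of superposition operators on bounded sequences. -/

section Superposition

open BoundedContinuousFunction

variable {E G : Type} [NormedAddCommGroup E] [NormedAddCommGroup G]

/-- The superposition operator `(w_m) ↦ (f_m(w_m))` on bounded sequences. -/
def superpose (f : ℕ → E → G) (C : ℝ) (hf : ∀ m x, ‖f m x‖ ≤ C * (1 + ‖x‖)) (w : ℕ →ᵇ E) :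
    ℕ →ᵇ G :=
  BoundedContinuousFunction.ofNormedAddCommGroupDiscrete (fun m => f m (w m)) (C * (1 + ‖w‖))
    fun m => (hf m (w m)).trans (by
      have hC : 0 ≤ C := by simpa using (norm_nonneg _).trans (hf 0 0)
      gcongr
      exact w.norm_coe_le_norm m)

@[simp] theorem superpose_apply (f : ℕ → E → G) (C : ℝ) (hf : ∀ m x, ‖f m x‖ ≤ C * (1 + ‖x‖))
    (w : ℕ →ᵇ E) (m : ℕ) : superpose f C hf w m = f m (w m) := rfl

variable [NormedSpace ℝ E]

/-- Finitely many components depend continuously on `w`, and the remaining ones are uniformly small: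
decay in `m` replaces equicontinuity. -/
theorem continuous_superpose {f : ℕ → E → G} {C : ℝ} (hf : ∀ m x, ‖f m x‖ ≤ C * (1 + ‖x‖))
    (hc : ∀ m, Continuous (f m)) (htail : ∀ ε > 0, ∃ m₀, ∀ m ≥ m₀, ∀ x, ‖f m x‖ ≤ ε) :
    Continuous (superpose f C hf) := by
  rw [continuous_iff_continuousAt]
  intro w
  rw [Metric.continuousAt_iff']
  intro ε hε
  obtain ⟨m₀, hm₀⟩ := htail (ε / 4) (by positivity)
  have h1 : ∀ m ∈ Finset.range m₀, ∀ᶠ v in 𝓝 w, dist (f m (v m)) (f m (w m)) < ε / 2 := by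
    intro m _
    have : ContinuousAt (fun v : ℕ →ᵇ E => f m (v m)) w :=
      ((hc m).comp (BoundedContinuousFunction.evalCLM ℝ m).continuous).continuousAt
    exact Metric.continuousAt_iff'.1 this _ (by positivity)
  filter_upwards [(Filter.eventually_all_finset _).2 h1] with v hv
  refine lt_of_le_of_lt ((dist_le (by positivity : (0 : ℝ) ≤ ε / 2)).2 fun m => ?_) (half_lt_self hε)
  rcases Nat.lt_or_ge m m₀ with h | h
  · exact (hv m (Finset.mem_range.2 h)).le
  · rw [superpose_apply, superpose_apply, dist_eq_norm]
    have := norm_sub_le (f m (v m)) (f m (w m))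
    linarith [hm₀ m h (v m), hm₀ m h (w m)]

variable [NormedSpace ℝ G]

/-- A bounded sequence of operators acts diagonally on bounded sequences. -/
def diagonal (E G : Type) [NormedAddCommGroup E] [NormedSpace ℝ E] [NormedAddCommGroup G]
    [NormedSpace ℝ G] : (ℕ →ᵇ (E →L[ℝ] G)) →L[ℝ] (ℕ →ᵇ E) →L[ℝ] (ℕ →ᵇ G) :=
  LinearMap.mkContinuous₂
    (LinearMap.mk₂ ℝ
      (fun (a : ℕ →ᵇ (E →L[ℝ] G)) (w : ℕ →ᵇ E) =>
        BoundedContinuousFunction.ofNormedAddCommGroupDiscrete (fun m => a m (w m)) (‖a‖ * ‖w‖)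
          fun m => ((a m).le_opNorm _).trans (by
            gcongr
            · exact a.norm_coe_le_norm m
            · exact w.norm_coe_le_norm m))
      (fun a b w => by ext m; simp) (fun c a w => by ext m; simp)
      (fun a w v => by ext m; simp) (fun c a w => by ext m; simp))
    1 (fun a w => by
      rw [one_mul]
      refine (norm_le (by positivity)).2 fun m => ((a m).le_opNorm _).trans ?_
      gcongr
      · exact a.norm_coe_le_norm m
      · exact w.norm_coe_le_norm m)

theorem norm_diagonal_le : ‖diagonal E G‖ ≤ 1 :=
  LinearMap.mkContinuous₂_norm_le _ zero_le_one _

/-- In the sup norm the linearization errors must be small uniformly in `m`. Continuity of the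
superposed derivatives at `w` supplies this uniformity, and the mean value inequality concludes. -/
theorem hasFDerivAt_superpose {f : ℕ → E → G} {f' : ℕ → E → E →L[ℝ] G} {C C' : ℝ}
    (hf : ∀ m x, ‖f m x‖ ≤ C * (1 + ‖x‖)) (hf' : ∀ m x, ‖f' m x‖ ≤ C' * (1 + ‖x‖))
    (hd : ∀ m x, HasFDerivAt (f m) (f' m x) x) {w : ℕ →ᵇ E}
    (hc : ContinuousAt (superpose f' C' hf') w) :
    HasFDerivAt (superpose f C hf) (diagonal E G (superpose f' C' hf' w)) w := by
  refine HasFDerivAt.of_isLittleO ?_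
  rw [Asymptotics.isLittleO_iff]
  intro c hcpos
  obtain ⟨δ, hδ, hδc⟩ := Metric.continuousAt_iff.1 hc c hcpos
  filter_upwards [Metric.ball_mem_nhds w hδ] with v hv
  refine (norm_le (by positivity)).2 fun m => ?_
  have hvw : ‖v m - w m‖ ≤ ‖v - w‖ := (v - w).norm_coe_le_norm m
  have hvw' : ‖v - w‖ < δ := by rwa [Metric.mem_ball, dist_eq_norm] at hv
  have hseg : ∀ x ∈ segment ℝ (w m) (v m), ‖f' m x - f' m (w m)‖ ≤ c := by
    intro x hx
    have hx' : ‖x - w m‖ ≤ ‖v m - w m‖ := by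
      obtain ⟨t, ⟨h0, h1⟩, rfl⟩ := (segment_eq_image' ℝ (w m) (v m)) ▸ hx
      rw [add_sub_cancel_left, norm_smul, Real.norm_of_nonneg h0]
      exact mul_le_of_le_one_left (norm_nonneg _) h1
    -- Perturbing `w` at the single index `m` turns continuity on the sequence space into an
    -- estimate for `f' m` at the point `x`.
    let h : ℕ →ᵇ E := BoundedContinuousFunction.ofNormedAddCommGroupDiscrete
      (fun k => if k = m then x - w m else 0) ‖v m - w m‖ (fun k => by
        split_ifs
        · exact hx'
        · simp)
    have hh : ‖h‖ < δ := lt_of_le_of_lt ((norm_le (norm_nonneg _)).2 fun k => by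
        change ‖if k = m then x - w m else 0‖ ≤ ‖v m - w m‖
        split_ifs
        · exact hx'
        · simp) (hvw.trans_lt hvw')
    have h1 := hδc (x := w + h) (by rwa [dist_eq_norm, add_sub_cancel_left])
    have h2 := (dist_coe_le_dist (f := superpose f' C' hf' (w + h))
      (g := superpose f' C' hf' w) m).trans h1.le
    have h3 : (w + h) m = x := by
      change w m + (if m = m then x - w m else 0) = x
      simp
    rwa [superpose_apply, superpose_apply, h3, dist_eq_norm] at h2
  have := (convex_segment (w m) (v m)).norm_image_sub_le_of_norm_hasFDerivWithin_le'
    (fun x _ => (hd m x).hasFDerivWithinAt) hseg (left_mem_segment ℝ _ _) (right_mem_segment ℝ _ _)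
  exact this.trans (by gcongr)

/-- The derivative of a superposition operator is the superposition of the derivatives followed by
the fixed operator `diagonal`, of norm at most 1. The induction changes the target space to one of
operators, hence the inner quantifier over `G`. Decay is needed only in the top order, where mere
continuity has to be proved. -/
theorem contDiff_superpose (n : ℕ) :
    ∀ {G : Type} [NormedAddCommGroup G] [NormedSpace ℝ G] {f : ℕ → E → G} {C M : ℝ}
      (hf : ∀ m x, ‖f m x‖ ≤ C * (1 + ‖x‖)), (∀ m, ContDiff ℝ n (f m)) →
      (∀ m, DerivBound n M (f m) univ) →
      (∀ ε > 0, ∃ m₀, ∀ m ≥ m₀, ∀ x, ‖iteratedFDeriv ℝ n (f m) x‖ ≤ ε) →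
      ContDiff ℝ n (superpose f C hf) ∧ DerivBound n M (superpose f C hf) univ := by
  induction n with
  | zero =>
    intro G _ _ f C M hf hc _ htail
    refine ⟨contDiff_zero.2 (continuous_superpose hf (fun m => contDiff_zero.1 (hc m)) ?_),
      fun k h1 hk => by omega⟩
    simpa using htail
  | succ n ih =>
    intro G _ _ f C M hf hc hM htail
    have hM0 : 0 ≤ M := (norm_nonneg _).trans (hM 0 1 le_rfl (by omega) 0 (mem_univ _))
    have hf' : ∀ m x, ‖fderiv ℝ (f m) x‖ ≤ M * (1 + ‖x‖) := fun m x => by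
      rw [← norm_iteratedFDeriv_one']
      exact (hM m 1 le_rfl (by omega) x (mem_univ _)).trans
        (le_mul_of_one_le_right hM0 (by linarith [norm_nonneg x]))
    obtain ⟨h1, h2⟩ := ih (f := fun m => fderiv ℝ (f m)) (M := M) hf'
      (fun m => (hc m).fderiv_right (by norm_cast))
      (fun m k h1 hk x _ => by
        rw [norm_iteratedFDeriv_fderiv]
        exact hM m (k + 1) (by omega) (by omega) x (mem_univ _))
      (by simpa only [norm_iteratedFDeriv_fderiv] using htail)
    have hd : ∀ w, HasFDerivAt (superpose f C hf)
        (diagonal E G (superpose (fun m => fderiv ℝ (f m)) M hf' w)) w := fun w =>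
      hasFDerivAt_superpose hf hf'
        (fun m x => ((hc m).differentiable (by simp)).differentiableAt.hasFDerivAt)
        h1.continuous.continuousAt
    have hfd : fderiv ℝ (superpose f C hf) =
        (diagonal E G) ∘ (superpose (fun m => fderiv ℝ (f m)) M hf') := by
      ext1 w; exact (hd w).fderiv
    have h1' : ContDiff ℝ n ((diagonal E G) ∘ (superpose (fun m => fderiv ℝ (f m)) M hf')) :=
      (diagonal E G).contDiff.comp h1
    refine ⟨?_, fun k hk1 hk x _ => ?_⟩
    · rw [Nat.cast_succ, contDiff_succ_iff_hasFDerivAt]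
      exact ⟨_, h1', hd⟩
    · obtain ⟨k, rfl⟩ := Nat.exists_eq_add_of_le' hk1
      rw [← norm_iteratedFDeriv_fderiv, hfd]
      rcases Nat.eq_zero_or_pos k with rfl | hk0
      · rw [norm_iteratedFDeriv_zero, Function.comp_apply]
        calc _ ≤ ‖diagonal E G‖ * ‖superpose (fun m => fderiv ℝ (f m)) M hf' x‖ :=
              (diagonal E G).le_opNorm _
          _ ≤ 1 * M := by
              gcongr
              · exact norm_diagonal_le
              · refine (norm_le hM0).2 fun m => ?_
                rw [superpose_apply, ← norm_iteratedFDeriv_one']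
                exact hM m 1 le_rfl (by omega) _ (mem_univ _)
          _ = M := one_mul M
      · have hkn : ((k : ℕ) : WithTop ℕ∞) ≤ n := by exact_mod_cast Nat.le_of_succ_le_succ hk
        calc _ ≤ ‖diagonal E G‖ *
              ‖iteratedFDeriv ℝ k (superpose (fun m => fderiv ℝ (f m)) M hf') x‖ :=
              (diagonal E G).norm_iteratedFDeriv_comp_left h1.contDiffAt hkn
          _ ≤ 1 * M := by
              gcongr
              · exact norm_diagonal_le
              · exact h2 k hk0 (by omega) x (mem_univ _)
          _ = M := one_mul M

end Superposition

/-! ### Smooth solutions of w - Q w = y • v for a contraction Q. -/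

section FixedPoint

variable {X : Type*} [NormedAddCommGroup X] [NormedSpace ℝ X] [CompleteSpace X]

theorem norm_inverse_one_sub_le {T : X →L[ℝ] X} {θ : ℝ} (hT : ‖T‖ ≤ θ) (hθ : θ < 1) :
    ‖Ring.inverse (1 - T)‖ ≤ (1 - θ)⁻¹ := by
  have hu : IsUnit (1 - T) := isUnit_one_sub_of_norm_lt_one (hT.trans_lt hθ)
  have h1θ : 0 < 1 - θ := by linarith
  refine ContinuousLinearMap.opNorm_le_bound _ (by positivity) fun y => ?_
  have h1 : (1 - T) (Ring.inverse (1 - T) y) = y := by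
    rw [← mul_apply_eq_comp, Ring.mul_inverse_cancel _ hu,
      one_apply_eq_self]
  set x := Ring.inverse (1 - T) y
  have h2 : x = y + T x := by
    rw [sub_apply, one_apply_eq_self] at h1
    rw [← h1]; abel
  have h3 : ‖x‖ ≤ ‖y‖ + θ * ‖x‖ := by
    calc ‖x‖ = ‖y + T x‖ := by rw [← h2]
      _ ≤ ‖y‖ + ‖T x‖ := norm_add_le _ _
      _ ≤ ‖y‖ + θ * ‖x‖ := by
        gcongr
        exact (T.le_opNorm x).trans (by gcongr)
  rw [inv_mul_eq_div, le_div_iff₀ h1θ]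
  linarith

/-- A bound for the derivatives of orders `1, …, n + 1` of the solution of `w - Q w = y • v`. -/
def fixedPointBound (n : ℕ) (M θ c : ℝ) : ℝ :=
  flowBound (n.factorial * (c * inverseBound ((1 - θ)⁻¹ + 1) n) * max 1 M ^ n) n

/-- The map id - Q is a Lipschitz-small perturbation of the identity, hence a homeomorphism, and a
diffeomorphism because its derivative is invertible. The solution curve satisfies W' = (1 - DQ(W))⁻¹
v, an autonomous equation whose right-hand side has bounded jets. This equation yields derivative
bounds in terms of `M`, `θ` and `‖v‖` alone. -/
theorem exists_smooth_solution {n : ℕ} {Q : X → X} {θ M : ℝ} (hθ : 0 ≤ θ) (hθ1 : θ < 1)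
    (hlip : ∀ w v, ‖Q w - Q v‖ ≤ θ * ‖w - v‖) (hQ : ContDiff ℝ (n + 1 : ℕ) Q)
    (hM : DerivBound (n + 1) M Q univ) (v : X) :
    ∃ W : ℝ → X, (∀ y w, w = W y ↔ w - Q w = y • v) ∧ ContDiff ℝ (n + 1 : ℕ) W ∧
      DerivBound (n + 1) (fixedPointBound n M θ ‖v‖) W univ := by
  have hfd : ∀ w, ‖fderiv ℝ Q w‖ ≤ θ := fun w => by
    have h1 : LipschitzWith ⟨θ, hθ⟩ Q := LipschitzWith.of_dist_le_mul fun a b => by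
      rw [dist_eq_norm, dist_eq_norm]; exact hlip a b
    exact norm_fderiv_le_of_lipschitz ℝ h1
  have hQd : ∀ w, HasFDerivAt Q (fderiv ℝ Q w) w := fun w =>
    (hQ.differentiable (by simp)).differentiableAt.hasFDerivAt
  have hu : ∀ w, IsUnit (1 - fderiv ℝ Q w) := fun w =>
    isUnit_one_sub_of_norm_lt_one ((hfd w).trans_lt hθ1)
  have happ : ApproximatesLinearOn (fun w => w - Q w)
      ((ContinuousLinearEquiv.refl ℝ X : X ≃L[ℝ] X) : X →L[ℝ] X) univ ⟨θ, hθ⟩ := by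
    intro a _ b _
    change ‖a - Q a - (b - Q b) - (a - b)‖ ≤ θ * ‖a - b‖
    rw [show a - Q a - (b - Q b) - (a - b) = -(Q a - Q b) by abel, norm_neg]
    exact hlip a b
  have hsub : Subsingleton X ∨ (⟨θ, hθ⟩ : NNReal) <
      ‖((ContinuousLinearEquiv.refl ℝ X).symm : X →L[ℝ] X)‖₊⁻¹ := by
    rcases subsingleton_or_nontrivial X with h | h
    · exact Or.inl h
    · right
      have : ‖((ContinuousLinearEquiv.refl ℝ X).symm : X →L[ℝ] X)‖₊ = 1 := by
        ext; exact ContinuousLinearMap.norm_id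
      rw [this, inv_one]
      exact (NNReal.coe_lt_coe (r₁ := ⟨θ, hθ⟩) (r₂ := 1)).1 hθ1
  let P : X ≃ₜ X := happ.toHomeomorph (fun w => w - Q w) hsub
  have hP : ∀ w, P w = w - Q w := fun w => rfl
  let P' : X → X ≃L[ℝ] X := fun w => ContinuousLinearEquiv.ofUnit (hu w).unit
  have hP'coe : ∀ w, ((P' w : X ≃L[ℝ] X) : X →L[ℝ] X) = 1 - fderiv ℝ Q w := fun w => rfl
  have hPd : ∀ w, HasFDerivAt P ((P' w : X ≃L[ℝ] X) : X →L[ℝ] X) w := fun w => by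
    rw [hP'coe]
    exact (hasFDerivAt_id w).sub (hQd w)
  have hPsymm : ContDiff ℝ (n + 1 : ℕ) P.symm :=
    P.contDiff_symm hPd (contDiff_id.sub hQ)
  have hWd : ∀ y, HasDerivAt (fun y : ℝ => P.symm (y • v))
      (Ring.inverse (1 - fderiv ℝ Q (P.symm (y • v))) v) y := by
    intro y
    have h1 : HasFDerivAt P.symm ((P' (P.symm (y • v))).symm : X →L[ℝ] X) (y • v) :=
      P.toOpenPartialHomeomorph.hasFDerivAt_symm (mem_univ _) (hPd _)
    have h2 : HasDerivAt (fun y : ℝ => y • v) v y := by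
      simpa using (hasDerivAt_id y).smul_const v
    have h3 := h1.comp_hasDerivAt y h2
    have h4 : ((P' (P.symm (y • v))).symm : X →L[ℝ] X)
        = Ring.inverse (1 - fderiv ℝ Q (P.symm (y • v))) := by
      rw [← hP'coe, ContinuousLinearMap.ringInverse_equiv, ContinuousLinearMap.inverse_equiv]
    rw [h4] at h3
    exact h3
  refine ⟨fun y => P.symm (y • v), fun y w => ?_, ?_, ?_⟩
  · rw [← hP w]
    exact ⟨fun h => by rw [h]; exact P.apply_symm_apply _, fun h => by
      dsimp only
      rw [← h]; exact (P.symm_apply_apply _).symm⟩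
  · exact hPsymm.comp (contDiff_id.smul contDiff_const)
  -- The added 1 makes the bound on the inverses strict, as membership in the open set `U` requires.
  · set c := (1 - θ)⁻¹ + 1 with hc
    have hc0 : 0 ≤ c := by
      have : 0 < 1 - θ := by linarith
      positivity
    set U : Set (X →L[ℝ] X) := {a | IsUnit a ∧ ‖Ring.inverse a‖ < c} with hU
    have hUo : IsOpen U := isOpen_setOf_norm_inverse_lt c
    have hmaps : MapsTo (fun w => 1 - fderiv ℝ Q w) univ U := fun w _ =>
      ⟨hu w, (norm_inverse_one_sub_le (hfd w) hθ1).trans_lt (by linarith)⟩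
    have hcd : ContDiff ℝ n (fun w => 1 - fderiv ℝ Q w) :=
      contDiff_const.sub (hQ.fderiv_right (by norm_cast))
    have hb : DerivBound n M (fun w => 1 - fderiv ℝ Q w) univ := by
      intro k h1 hk x _
      have e1 : (fun w => 1 - fderiv ℝ Q w) = fun w => (-fderiv ℝ Q) w - (-1) := by
        ext1 w; simp [sub_eq_add_neg, add_comm]
      rw [e1, norm_iteratedFDeriv_sub_const h1, iteratedFDeriv_neg, Pi.neg_apply, norm_neg,
        norm_iteratedFDeriv_fderiv]
      exact hM (k + 1) (by omega) (by omega) x (mem_univ _)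
    let ev : (X →L[ℝ] X) →L[ℝ] X := ContinuousLinearMap.apply ℝ X v
    have hev : ‖ev‖ ≤ ‖v‖ := ContinuousLinearMap.opNorm_le_bound _ (norm_nonneg _) fun T => by
      rw [mul_comm]; exact T.le_opNorm v
    have hi0 := inverseBound_nonneg hc0 n
    have hj : JetBound n (‖v‖ * inverseBound c n) (ev ∘ Ring.inverse) U :=
      (JetBound.clm_comp ev hUo (contDiffOn_ringInverse n c) (jetBound_ringInverse hc0 n)).mono
        le_rfl (by gcongr) Subset.rfl
    have hjc : ContDiffOn ℝ n (ev ∘ Ring.inverse) U :=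
      ev.contDiff.comp_contDiffOn (contDiffOn_ringInverse n c)
    have hV := JetBound.comp isOpen_univ hUo hjc hcd.contDiffOn hmaps hj hb (by positivity)
    exact derivBound_of_hasDerivAt_comp (by positivity) isOpen_univ isOpen_univ (mapsTo_univ _ _)
      (fun y _ => hWd y) (hjc.comp hcd.contDiffOn hmaps) hV

end FixedPoint

/-! ### Perturbations vanishing to first order. -/

section Perturbation

variable {E : Type*} [NormedAddCommGroup E] [NormedSpace ℝ E]

/-- A sequence of maps of class `C^n` that vanish to first order at `0`, are `η`-small in the
`C^1`-topology, and have derivatives of orders `1, …, n` bounded by `M`. -/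
structure IsPerturbation (n : ℕ) (η M : ℝ) (R : ℕ → E → E) : Prop where
  contDiff : ∀ m, ContDiff ℝ n (R m)
  map_zero : ∀ m, R m 0 = 0
  fderiv_zero : ∀ m, fderiv ℝ (R m) 0 = 0
  small : ∀ m z, ‖fderiv ℝ (R m) z‖ ≤ η
  bound : ∀ m, DerivBound n M (R m) univ

theorem norm_fderiv_le_of_derivBound {n : ℕ} (hn : 2 ≤ n) {M : ℝ} {f : E → E} {s : Set E}
    (hs : IsOpen s) (hsc : Convex ℝ s) (h0 : 0 ∈ s) (hf : ContDiffOn ℝ n f s)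
    (hM : ∀ x ∈ s, ‖iteratedFDeriv ℝ 2 f x‖ ≤ M) (hd : fderiv ℝ f 0 = 0) {z : E} (hz : z ∈ s) :
    ‖fderiv ℝ f z‖ ≤ M * ‖z‖ := by
  have h1 : ContDiffOn ℝ 1 (fderiv ℝ f) s :=
    ((hf.of_le (m := 2) (by exact_mod_cast hn)).fderiv_of_isOpen hs (by norm_num))
  have := hsc.norm_image_sub_le_of_norm_fderiv_le (𝕜 := ℝ) (f := fderiv ℝ f) (C := M)
    (fun x hx => (h1.contDiffAt (hs.mem_nhds hx)).differentiableAt (by simp))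
    (fun x hx => by
      rw [← norm_iteratedFDeriv_one', norm_iteratedFDeriv_fderiv]
      exact hM x hx) h0 hz
  simpa [hd] using this

theorem norm_le_of_derivBound {n : ℕ} (hn : 2 ≤ n) {M : ℝ} (hM0 : 0 ≤ M) {f : E → E} {δ : ℝ}
    (hf : ContDiffOn ℝ n f (Metric.ball 0 δ))
    (hM : ∀ x ∈ Metric.ball 0 δ, ‖iteratedFDeriv ℝ 2 f x‖ ≤ M)
    (h00 : f 0 = 0) (hd : fderiv ℝ f 0 = 0) {z : E} (hz : z ∈ Metric.ball 0 δ) :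
    ‖f z‖ ≤ M * ‖z‖ * ‖z‖ := by
  have hδ : 0 < δ := Metric.pos_of_mem_ball hz
  have hseg : segment ℝ 0 z ⊆ Metric.ball 0 δ :=
    (convex_ball (0 : E) δ).segment_subset (Metric.mem_ball_self hδ) hz
  have := (convex_segment (0 : E) z).norm_image_sub_le_of_norm_fderiv_le (𝕜 := ℝ) (f := f)
    (C := M * ‖z‖)
    (fun x hx => (hf.contDiffAt (Metric.isOpen_ball.mem_nhds (hseg hx))).differentiableAt (by
      norm_cast; omega))
    (fun x hx => (norm_fderiv_le_of_derivBound hn Metric.isOpen_ball (convex_ball _ _)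
      (Metric.mem_ball_self hδ) hf hM hd (hseg hx)).trans (by
        gcongr
        obtain ⟨t, ⟨ht0, ht1⟩, rfl⟩ := (segment_eq_image' ℝ 0 z) ▸ hx
        simp only [sub_zero, zero_add, norm_smul, Real.norm_of_nonneg ht0]
        exact mul_le_of_le_one_left (norm_nonneg _) ht1))
    (left_mem_segment ℝ _ _) (right_mem_segment ℝ _ _)
  simpa [h00] using this

variable {n : ℕ} {η M : ℝ} {R : ℕ → E → E}

theorem IsPerturbation.differentiable (h : IsPerturbation n η M R) (hn : 1 ≤ n) (m : ℕ) :
    Differentiable ℝ (R m) :=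
  (h.contDiff m).differentiable (by norm_cast; omega)

theorem IsPerturbation.norm_sub_le (h : IsPerturbation n η M R) (hn : 1 ≤ n) (m : ℕ) (z w : E) :
    ‖R m z - R m w‖ ≤ η * ‖z - w‖ :=
  convex_univ.norm_image_sub_le_of_norm_fderiv_le (𝕜 := ℝ)
    (fun x _ => h.differentiable hn m x) (fun x _ => h.small m x) (mem_univ w) (mem_univ z)

theorem IsPerturbation.norm_le (h : IsPerturbation n η M R) (hn : 1 ≤ n) (m : ℕ) (z : E) :
    ‖R m z‖ ≤ η * ‖z‖ := by
  simpa [h.map_zero m] using h.norm_sub_le hn m z 0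

theorem IsPerturbation.nonneg (h : IsPerturbation n η M R) : 0 ≤ η :=
  (norm_nonneg _).trans (h.small 0 0)

theorem IsPerturbation.bound_nonneg (h : IsPerturbation n η M R) (hn : 1 ≤ n) : 0 ≤ M :=
  (norm_nonneg _).trans (h.bound 0 1 le_rfl hn 0 (mem_univ _))

theorem IsPerturbation.norm_le_sq (h : IsPerturbation n η M R) (hn : 2 ≤ n) (m : ℕ) (z : E) :
    ‖R m z‖ ≤ M * ‖z‖ * ‖z‖ :=
  norm_le_of_derivBound (δ := ‖z‖ + 1) hn (h.bound_nonneg (by omega)) (h.contDiff m).contDiffOn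
    (fun x _ => h.bound m 2 (by norm_num) hn x (mem_univ _)) (h.map_zero m) (h.fderiv_zero m)
    (by simp)

theorem IsPerturbation.shift (h : IsPerturbation n η M R) (k : ℕ) :
    IsPerturbation n η M (fun m => R (k + m)) :=
  ⟨fun _ => h.contDiff _, fun _ => h.map_zero _, fun _ => h.fderiv_zero _, fun _ => h.small _,
    fun _ => h.bound _⟩

end Perturbation

/-! ### The Lyapunov–Perron construction of invariant graphs. -/

section LyapunovPerron

open BoundedContinuousFunction

theorem norm_shift_le (α β : ℝ) (i : ℕ) (w : ℕ →ᵇ ℝ × ℝ) (m : ℕ) :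
    ‖((α * (w (m + i)).1, Nat.casesOn m 0 fun k => β * (w k).2) : ℝ × ℝ)‖ ≤
      max |α| |β| * ‖w‖ := by
  refine max_le ?_ ?_
  · rw [norm_mul]
    exact mul_le_mul (le_max_left _ _)
      ((norm_fst_le _).trans (w.norm_coe_le_norm _)) (norm_nonneg _) (by positivity)
  · cases m with
    | zero => exact norm_zero.le.trans (by positivity)
    | succ k =>
      simp only [norm_mul]
      exact mul_le_mul (le_max_right _ _)
        ((norm_snd_le _).trans (w.norm_coe_le_norm _)) (norm_nonneg _) (by positivity)

/-- The operator `w ↦ (α x_{m+i}, β y_{m-1})_m` on bounded sequences `w_m = (x_m, y_m)`, where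
`y_{-1} = 0`. -/
def shiftOp (α β : ℝ) (i : ℕ) : (ℕ →ᵇ ℝ × ℝ) →L[ℝ] (ℕ →ᵇ ℝ × ℝ) :=
  LinearMap.mkContinuous
    { toFun := fun w => BoundedContinuousFunction.ofNormedAddCommGroupDiscrete
        (fun m => (α * (w (m + i)).1, Nat.casesOn m 0 fun k => β * (w k).2))
        (max |α| |β| * ‖w‖) (norm_shift_le α β i w)
      map_add' := fun w v => by
        ext m
        · simp [mul_add]
        · cases m <;> simp [mul_add]
      map_smul' := fun c w => by
        ext m
        · simp [mul_left_comm]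
        · cases m <;> simp [mul_left_comm] }
    (max |α| |β|) (fun w => (norm_le (by positivity)).2 (norm_shift_le α β i w))

theorem norm_shiftOp_le (α β : ℝ) (i : ℕ) : ‖shiftOp α β i‖ ≤ max |α| |β| :=
  LinearMap.mkContinuous_norm_le _ (le_max_of_le_left (abs_nonneg _)) _

/-- The conjugate of `R m` by the dilation by `μ ^ m`. -/
def rescale (μ : ℝ) (R : ℕ → ℝ × ℝ → ℝ × ℝ) (m : ℕ) (w : ℝ × ℝ) : ℝ × ℝ :=
  (μ ^ m)⁻¹ • R m (μ ^ m • w)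

variable {n : ℕ} {η M μ : ℝ} {R : ℕ → ℝ × ℝ → ℝ × ℝ}

theorem norm_rescale_sub_le (h : IsPerturbation n η M R) (hn : 1 ≤ n) (hμ : 0 < μ) (m : ℕ)
    (w v : ℝ × ℝ) : ‖rescale μ R m w - rescale μ R m v‖ ≤ η * ‖w - v‖ := by
  have hp : 0 < μ ^ m := pow_pos hμ m
  rw [rescale, rescale, ← smul_sub, norm_smul, norm_inv, Real.norm_of_nonneg hp.le,
    inv_mul_le_iff₀ hp]
  refine (h.norm_sub_le hn m _ _).trans_eq ?_
  rw [← smul_sub, norm_smul, Real.norm_of_nonneg hp.le]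
  ring

theorem rescale_zero (h : IsPerturbation n η M R) (m : ℕ) : rescale μ R m 0 = 0 := by
  simp [rescale, h.map_zero m]

theorem norm_rescale_le (h : IsPerturbation n η M R) (hn : 1 ≤ n) (hμ : 0 < μ) (m : ℕ)
    (w : ℝ × ℝ) : ‖rescale μ R m w‖ ≤ η * (1 + ‖w‖) := by
  have h1 := norm_rescale_sub_le h hn hμ m w 0
  rw [rescale_zero h, sub_zero, sub_zero] at h1
  nlinarith [h.nonneg]

theorem norm_rescale_le_sq (h : IsPerturbation n η M R) (hn : 2 ≤ n) (hμ : 0 < μ) (hμ1 : μ ≤ 1)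
    (m : ℕ) (w : ℝ × ℝ) : ‖rescale μ R m w‖ ≤ M * ‖w‖ * ‖w‖ := by
  have hp : 0 < μ ^ m := pow_pos hμ m
  have hp1 : μ ^ m ≤ 1 := pow_le_one₀ hμ.le hμ1
  have hM := h.bound_nonneg (by omega)
  rw [rescale, norm_smul, norm_inv, Real.norm_of_nonneg hp.le, inv_mul_le_iff₀ hp]
  refine (h.norm_le_sq hn m _).trans ?_
  rw [norm_smul, Real.norm_of_nonneg hp.le]
  have h2 : 0 ≤ M * ‖w‖ * ‖w‖ := by positivity
  calc M * (μ ^ m * ‖w‖) * (μ ^ m * ‖w‖) = μ ^ m * (μ ^ m * (M * ‖w‖ * ‖w‖)) := by ring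
    _ ≤ μ ^ m * (1 * (M * ‖w‖ * ‖w‖)) := by gcongr
    _ = _ := by ring

theorem contDiff_rescale (h : IsPerturbation n η M R) (m : ℕ) :
    ContDiff ℝ n (rescale μ R m) :=
  ContDiff.const_smul _ ((h.contDiff m).comp (contDiff_const_smul (μ ^ m)))

/-- A derivative of order k + 1 gains k + 1 factors μ^m and loses one. Orders at least 2 thus decay
in `m`, which is the tail condition of `contDiff_superpose`. -/
theorem norm_iteratedFDeriv_rescale_le (h : IsPerturbation n η M R) (hμ : 0 < μ) (m k : ℕ)
    (hk : k + 1 ≤ n) (w : ℝ × ℝ) :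
    ‖iteratedFDeriv ℝ (k + 1) (rescale μ R m) w‖ ≤ (μ ^ m) ^ k * M := by
  have hp : 0 < μ ^ m := pow_pos hμ m
  have hkn : ((k + 1 : ℕ) : WithTop ℕ∞) ≤ n := by exact_mod_cast hk
  have hc := (h.contDiff m).of_le hkn
  have e1 : rescale μ R m = (μ ^ m)⁻¹ • fun w => R m (μ ^ m • w) := rfl
  have hc' : ContDiff ℝ (k + 1 : ℕ) fun w => R m (μ ^ m • w) :=
    hc.comp (contDiff_const_smul (μ ^ m))
  rw [e1, iteratedFDeriv_const_smul_apply hc'.contDiffAt, iteratedFDeriv_comp_const_smul _ hc,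
    norm_smul, norm_smul, norm_inv, norm_pow _ (k + 1), Real.norm_of_nonneg hp.le]
  have := h.bound m (k + 1) (by omega) hk (μ ^ m • w) (mem_univ _)
  calc (μ ^ m)⁻¹ * ((μ ^ m) ^ (k + 1) * ‖iteratedFDeriv ℝ (k + 1) (R m) (μ ^ m • w)‖)
      = (μ ^ m) ^ k * ‖iteratedFDeriv ℝ (k + 1) (R m) (μ ^ m • w)‖ := by
        rw [pow_succ]; field_simp
    _ ≤ _ := by gcongr

theorem contDiff_superpose_rescale (h : IsPerturbation n η M R) (hn : 2 ≤ n) (hμ : 0 < μ)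
    (hμ1 : μ < 1) :
    ContDiff ℝ n (superpose (rescale μ R) η (norm_rescale_le h (by omega) hμ)) ∧
      DerivBound n M (superpose (rescale μ R) η (norm_rescale_le h (by omega) hμ)) univ := by
  have hM := h.bound_nonneg (by omega)
  refine contDiff_superpose n _ (fun m => contDiff_rescale h m) (fun m k h1 hk x _ => ?_) ?_
  · obtain ⟨k, rfl⟩ := Nat.exists_eq_add_of_le' h1
    refine (norm_iteratedFDeriv_rescale_le h hμ m k hk x).trans ?_
    exact mul_le_of_le_one_left hM (pow_le_one₀ (by positivity) (pow_le_one₀ hμ.le hμ1.le))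
  · intro ε hε
    obtain ⟨k, rfl⟩ := Nat.exists_eq_add_of_le' hn
    have ht : Tendsto (fun m : ℕ => μ ^ m * M) atTop (𝓝 (0 * M)) :=
      (tendsto_pow_atTop_nhds_zero_of_lt_one hμ.le hμ1).mul_const M
    rw [zero_mul] at ht
    obtain ⟨m₀, hm₀⟩ := eventually_atTop.1 (ht.eventually_lt_const hε)
    refine ⟨m₀, fun m hm x => ?_⟩
    refine (norm_iteratedFDeriv_rescale_le h hμ m (k + 1) le_rfl x).trans
      (le_trans ?_ (hm₀ m hm).le)
    gcongr
    exact pow_le_of_le_one (by positivity) (pow_le_one₀ hμ.le hμ1.le) (by omega)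

/-- The sequence `(0, 1), 0, 0, …`. -/
def initialSeq : ℕ →ᵇ ℝ × ℝ :=
  BoundedContinuousFunction.ofNormedAddCommGroupDiscrete
    (fun m => (0, Nat.casesOn m 1 fun _ => 0)) 1 (fun m => by cases m <;> simp [Prod.norm_def])

theorem norm_initialSeq_le : ‖initialSeq‖ ≤ 1 :=
  (norm_le zero_le_one).2 fun m => by
    change ‖((0, Nat.casesOn m 1 fun _ => 0) : ℝ × ℝ)‖ ≤ 1
    cases m <;> simp [Prod.norm_def]

theorem smul_initialSeq_zero (y : ℝ) : (y • initialSeq) 0 = (0, y) := by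
  change y • ((0, 1) : ℝ × ℝ) = _
  simp

theorem smul_initialSeq_succ (y : ℝ) (m : ℕ) : (y • initialSeq) (m + 1) = 0 := by
  change y • ((0, 0) : ℝ × ℝ) = _
  simp

/-- With w_m = μ^{-m} z_m the orbit equation for `z` becomes the equation in the statement. Solving
it backwards for the horizontal component and forwards for the vertical one gives w - Q w = y •
`initialSeq`, where Q = S + K ∘ N. Its linear part has norm at most max(μ/κx, κy/μ), which is less
than 1 exactly when κy < μ < κx. -/
theorem exists_lyapunovPerron (hn : 2 ≤ n) {κx κy θ : ℝ} (hκy : 0 < κy) (hκx : 0 < κx)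
    (hμ : 0 < μ) (hμ1 : μ < 1)
    (hθ : max (μ / κx) (κy / μ) + max κx⁻¹ μ⁻¹ * η ≤ θ) (hθ1 : θ < 1) (M : ℝ) :
    ∃ M' : ℝ, ∀ R : ℕ → ℝ × ℝ → ℝ × ℝ, IsPerturbation n η M R →
      ∃ W : ℝ → (ℕ →ᵇ ℝ × ℝ),
        (∀ y w, w = W y ↔ (w 0).2 = y ∧
          ∀ m, μ • w (m + 1) = (κx * (w m).1, κy * (w m).2) + rescale μ R m (w m)) ∧
        ContDiff ℝ n W ∧ DerivBound n M' W univ ∧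
        ∀ y y', ‖W y - W y'‖ ≤ (1 - θ)⁻¹ * |y - y'| := by
  obtain ⟨n, rfl⟩ := Nat.exists_eq_add_of_le' hn
  set S := shiftOp (μ / κx) (κy / μ) 1 with hS
  set K := shiftOp (-κx⁻¹) μ⁻¹ 0 with hK
  refine ⟨fixedPointBound (n + 1) (‖S‖ + ‖K‖ * M) θ ‖initialSeq‖, fun R h => ?_⟩
  have hSn : ‖S‖ ≤ max (μ / κx) (κy / μ) := by
    have := norm_shiftOp_le (μ / κx) (κy / μ) 1
    rwa [abs_of_pos (by positivity), abs_of_pos (by positivity)] at this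
  have hKn : ‖K‖ ≤ max κx⁻¹ μ⁻¹ := by
    have := norm_shiftOp_le (-κx⁻¹) μ⁻¹ 0
    rwa [abs_neg, abs_of_pos (by positivity), abs_of_pos (by positivity)] at this
  have hη := h.nonneg
  have hθ0 : 0 ≤ θ := by
    have : 0 ≤ max (μ / κx) (κy / μ) + max κx⁻¹ μ⁻¹ * η := by positivity
    linarith
  set N := superpose (rescale μ R) η (norm_rescale_le h (by omega) hμ) with hN
  obtain ⟨hNc, hNb⟩ := contDiff_superpose_rescale h hn hμ hμ1
  rw [← hN] at hNc hNb
  let Q : (ℕ →ᵇ ℝ × ℝ) → (ℕ →ᵇ ℝ × ℝ) := fun w => S w + (K ∘ N) w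
  have hQc : ContDiff ℝ (n + 1 + 1 : ℕ) Q := S.contDiff.add (K.contDiff.comp hNc)
  have hQb : DerivBound (n + 1 + 1) (‖S‖ + ‖K‖ * M) Q univ :=
    DerivBound.add isOpen_univ S.contDiff.contDiffOn (K.contDiff.comp hNc).contDiffOn
      (DerivBound.clm _ S univ) (DerivBound.clm_comp K isOpen_univ hNc.contDiffOn hNb)
  have hNl : ∀ w v, ‖N w - N v‖ ≤ η * ‖w - v‖ := fun w v =>
    (norm_le (by positivity)).2 fun m => (norm_rescale_sub_le h (by omega) hμ m _ _).trans (by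
      gcongr
      exact (w - v).norm_coe_le_norm m)
  have hQl : ∀ w v, ‖Q w - Q v‖ ≤ θ * ‖w - v‖ := fun w v => by
    have e : Q w - Q v = S (w - v) + K (N w - N v) := by
      simp only [Q, map_sub, Function.comp_apply]; abel
    calc ‖Q w - Q v‖ ≤ ‖S (w - v)‖ + ‖K (N w - N v)‖ := by rw [e]; exact norm_add_le _ _
      _ ≤ max (μ / κx) (κy / μ) * ‖w - v‖ + max κx⁻¹ μ⁻¹ * (η * ‖w - v‖) := by
        gcongr
        · exact (S.le_opNorm _).trans (by gcongr)
        · exact (K.le_opNorm _).trans (by gcongr; exact hNl w v)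
      _ = (max (μ / κx) (κy / μ) + max κx⁻¹ μ⁻¹ * η) * ‖w - v‖ := by ring
      _ ≤ θ * ‖w - v‖ := by gcongr
  obtain ⟨W, hW, hWc, hWb⟩ := exists_smooth_solution hθ0 hθ1 hQl hQc hQb initialSeq
  refine ⟨W, fun y w => (hW y w).trans ?_, hWc, hWb, fun y y' => ?_⟩
  · have hfst : ∀ m, ((w - Q w) m).1 = (w m).1 -
        (μ / κx * (w (m + 1)).1 + -κx⁻¹ * (rescale μ R m (w m)).1) := fun m => rfl
    have hs0 : ((w - Q w) 0).2 = (w 0).2 - (0 + 0) := rfl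
    have hs1 : ∀ m, ((w - Q w) (m + 1)).2 = (w (m + 1)).2 -
        (κy / μ * (w m).2 + μ⁻¹ * (rescale μ R m (w m)).2) := fun m => rfl
    constructor
    · intro hw
      have hw0 := congrArg (fun f : ℕ →ᵇ ℝ × ℝ => f 0) hw
      simp only [smul_initialSeq_zero] at hw0
      have hws : ∀ m, (w - Q w) (m + 1) = 0 := fun m => by rw [hw, smul_initialSeq_succ]
      have hf0 : ∀ m, ((w - Q w) m).1 = 0 := fun m => by
        cases m with
        | zero => rw [hw0]
        | succ m => rw [hws]; rfl
      refine ⟨?_, fun m => ?_⟩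
      · have := congrArg Prod.snd hw0
        rw [hs0] at this
        simpa using this
      · have h1 := hf0 m
        rw [hfst] at h1
        have h2 := congrArg Prod.snd (hws m)
        rw [hs1] at h2
        refine Prod.ext ?_ ?_
        · change μ * (w (m + 1)).1 = κx * (w m).1 + (rescale μ R m (w m)).1
          field_simp at h1
          linarith
        · change μ * (w (m + 1)).2 = κy * (w m).2 + (rescale μ R m (w m)).2
          simp only [Prod.snd_zero] at h2
          field_simp at h2
          linarith
    · rintro ⟨hy, hw⟩
      have h1 : ∀ m, μ * (w (m + 1)).1 = κx * (w m).1 + (rescale μ R m (w m)).1 := fun m =>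
        congrArg Prod.fst (hw m)
      have h2 : ∀ m, μ * (w (m + 1)).2 = κy * (w m).2 + (rescale μ R m (w m)).2 := fun m =>
        congrArg Prod.snd (hw m)
      have hf0 : ∀ m, ((w - Q w) m).1 = 0 := fun m => by
        rw [hfst]
        have := h1 m
        field_simp
        linarith
      refine BoundedContinuousFunction.ext fun m => ?_
      cases m with
      | zero =>
        rw [smul_initialSeq_zero]
        exact Prod.ext (hf0 0) (by rw [hs0, hy]; simp)
      | succ m =>
        rw [smul_initialSeq_succ]
        refine Prod.ext (hf0 _) ?_
        rw [hs1]
        have := h2 m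
        simp only [Prod.snd_zero]
        field_simp
        linarith
  · have e1 := (hW y (W y)).1 rfl
    have e2 := (hW y' (W y')).1 rfl
    have e3 : W y - W y' = (Q (W y) - Q (W y')) + (y - y') • initialSeq := by
      rw [sub_smul, ← e1, ← e2]; abel
    have h1θ : 0 < 1 - θ := by linarith
    rw [inv_mul_eq_div, le_div_iff₀ h1θ]
    have : ‖W y - W y'‖ ≤ θ * ‖W y - W y'‖ + |y - y'| * 1 := by
      calc ‖W y - W y'‖ ≤ ‖Q (W y) - Q (W y')‖ + ‖(y - y') • initialSeq‖ := by
            conv_lhs => rw [e3]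
            exact norm_add_le _ _
        _ ≤ _ := by
            rw [norm_smul, Real.norm_eq_abs]
            gcongr
            · exact hQl _ _
            · exact norm_initialSeq_le
    linarith

/-- Iterating `k` times leaves θ^k times a bounded quantity, so boundedness plays the role of a
terminal condition at infinity. -/
theorem abs_le_of_le_mul_succ {d : ℕ → ℝ} {θ c B : ℝ} (hθ : 0 ≤ θ) (hθ1 : θ < 1)
    (hB : ∀ m, |d m| ≤ B) (h : ∀ m, |d m| ≤ θ * |d (m + 1)| + c) (m : ℕ) :
    |d m| ≤ c / (1 - θ) := by
  have h1θ : 0 < 1 - θ := by linarith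
  have key : ∀ k m, |d m| - c / (1 - θ) ≤ θ ^ k * (|d (m + k)| - c / (1 - θ)) := by
    intro k
    induction k with
    | zero => intro m; simp
    | succ k ih =>
      intro m
      refine (ih m).trans ?_
      rw [pow_succ, mul_assoc]
      gcongr
      have := h (m + k)
      rw [show m + (k + 1) = m + k + 1 by ring]
      have e : c / (1 - θ) = θ * (c / (1 - θ)) + c := by field_simp; ring
      linarith
  have ht : Tendsto (fun k : ℕ => θ ^ k * (B - c / (1 - θ))) atTop (𝓝 (0 * (B - c / (1 - θ)))) :=
    (tendsto_pow_atTop_nhds_zero_of_lt_one hθ hθ1).mul_const _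
  rw [zero_mul] at ht
  have := ge_of_tendsto' ht fun k => (key k m).trans
    (mul_le_mul_of_nonneg_left (sub_le_sub_right (hB (m + k)) _) (pow_nonneg hθ k))
  linarith

/-- The horizontal component is recovered from infinity by a contraction, so it is controlled by the
difference of the forcing terms `u` and `u'` alone. This gives both the slope of the graphs and
their tangency to the vertical axis. -/
theorem abs_fst_sub_le {κx κy : ℝ} (hκx : 0 < κx) (hμ : 0 < μ) (hμκ : μ < κx) {c : ℝ}
    {w v u u' : ℕ →ᵇ ℝ × ℝ} (hc : ∀ m, ‖u m - u' m‖ ≤ c)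
    (hw : ∀ m, μ • w (m + 1) = (κx * (w m).1, κy * (w m).2) + u m)
    (hv : ∀ m, μ • v (m + 1) = (κx * (v m).1, κy * (v m).2) + u' m) :
    |(w 0).1 - (v 0).1| ≤ κx⁻¹ * c / (1 - μ / κx) := by
  refine abs_le_of_le_mul_succ (d := fun m => (w m).1 - (v m).1) (B := ‖w - v‖) (by positivity)
    ((div_lt_one hκx).2 hμκ)
    (fun m => (norm_fst_le ((w - v) m)).trans ((w - v).norm_coe_le_norm m)) (fun m => ?_) 0
  have h1 : μ * (w (m + 1)).1 = κx * (w m).1 + (u m).1 := congrArg Prod.fst (hw m)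
  have h2 : μ * (v (m + 1)).1 = κx * (v m).1 + (u' m).1 := congrArg Prod.fst (hv m)
  have h3 : (w m).1 - (v m).1 = μ / κx * ((w (m + 1)).1 - (v (m + 1)).1) +
      -(κx⁻¹ * ((u m).1 - (u' m).1)) := by
    field_simp
    linarith
  have h4 : |(u m).1 - (u' m).1| ≤ c := (norm_fst_le (u m - u' m)).trans (hc m)
  rw [h3]
  refine (abs_add_le _ _).trans ?_
  rw [abs_neg, abs_mul, abs_mul, abs_of_pos (by positivity : 0 < μ / κx),
    abs_of_pos (by positivity : 0 < κx⁻¹)]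
  have : κx⁻¹ * |(u m).1 - (u' m).1| ≤ κx⁻¹ * c := by gcongr
  have e := h3
  linarith

/-- The graph of `g m` consists of the initial points at time `m` whose orbits are O(μ^k). This
decay passes from an orbit to its tail, so one graph is mapped into the next. -/
theorem exists_invariant_graphs (hn : 2 ≤ n) {κx κy τ : ℝ} (hκy : 0 < κy) (hκyx : κy < κx)
    (hκy1 : κy < 1) (hτ : 0 < τ) :
    ∃ η₀ > 0, ∀ η ≤ η₀, ∀ M : ℝ, ∃ M' : ℝ, ∀ R : ℕ → ℝ × ℝ → ℝ × ℝ, IsPerturbation n η M R →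
      ∃ g : ℕ → ℝ → ℝ, (∀ m, ContDiff ℝ n (g m)) ∧ (∀ m, g m 0 = 0) ∧ (∀ m, deriv (g m) 0 = 0) ∧
        (∀ m y y', |g m y - g m y'| ≤ τ * |y - y'|) ∧ (∀ m, DerivBound n M' (g m) univ) ∧
        ∀ m y, κx * g m y + (R m (g m y, y)).1 = g (m + 1) (κy * y + (R m (g m y, y)).2) := by
  have hκx : 0 < κx := hκy.trans hκyx
  -- The position between κy and κx gives the contraction; μ < 1 gives the decay of the rescaled
  -- nonlinearity.
  obtain ⟨μ, hμκy, hμ'⟩ := exists_between (lt_min hκyx hκy1)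
  obtain ⟨hμκx, hμ1⟩ := lt_min_iff.1 hμ'
  have hμ : 0 < μ := hκy.trans hμκy
  set θ₀ := max (μ / κx) (κy / μ) with hθ₀
  have hθ₀1 : θ₀ < 1 := max_lt ((div_lt_one hκx).2 hμκx) ((div_lt_one hμ).2 hμκy)
  have hθ₀0 : 0 < θ₀ := lt_max_of_lt_left (by positivity)
  set ck := max κx⁻¹ μ⁻¹ with hck
  have hck0 : 0 < ck := lt_max_of_lt_left (by positivity)
  set θ := (1 + θ₀) / 2 with hθ
  have hθ1 : θ < 1 := by rw [hθ]; linarith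
  have h1θ : 0 < 1 - θ := by linarith
  have h1μ : 0 < 1 - μ / κx := by
    have := (div_lt_one hκx).2 hμκx
    linarith
  -- The first bound keeps the operator a contraction with constant θ, the second keeps the slopes
  -- of the graphs below τ.
  refine ⟨min ((1 - θ₀) / 2 / ck) (τ * (1 - μ / κx) * (1 - θ) * κx), by
    have : 0 < 1 - θ₀ := by linarith
    positivity, fun η hη M => ?_⟩
  obtain ⟨hη1, hη2⟩ := le_min_iff.1 hη
  have hθη : θ₀ + ck * η ≤ θ := by
    rw [le_div_iff₀ hck0] at hη1
    rw [hθ]; linarith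
  obtain ⟨M', hM'⟩ := exists_lyapunovPerron (η := η) hn hκy hκx hμ hμ1 hθη hθ1 M
  let π : (ℕ →ᵇ ℝ × ℝ) →L[ℝ] ℝ := (ContinuousLinearMap.fst ℝ ℝ ℝ).comp
    (BoundedContinuousFunction.evalCLM ℝ 0)
  refine ⟨‖π‖ * M', fun R h => ?_⟩
  choose W hW hWc hWb hWl using fun k => hM' (fun m => R (k + m)) (h.shift k)
  have hWeq : ∀ k y, (W k y 0).2 = y ∧ ∀ m, μ • W k y (m + 1) =
      (κx * (W k y m).1, κy * (W k y m).2) + rescale μ (fun m => R (k + m)) m (W k y m) :=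
    fun k y => (hW k y _).1 rfl
  have hη0 := h.nonneg
  have hM0 := h.bound_nonneg (by omega)
  have hW0 : ∀ k, W k 0 = 0 := fun k => by
    symm
    rw [hW]
    refine ⟨rfl, fun m => ?_⟩
    change μ • (0 : ℝ × ℝ) = (κx * 0, κy * 0) + rescale μ (fun m => R (k + m)) m 0
    rw [rescale_zero (h.shift k)]
    simp [Prod.ext_iff]
  have hpair : ∀ k y, W k y 0 = ((W k y 0).1, y) := fun k y => Prod.ext rfl (hWeq k y).1
  let U : ∀ k, (ℕ →ᵇ ℝ × ℝ) → (ℕ →ᵇ ℝ × ℝ) := fun k =>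
    superpose (rescale μ fun m => R (k + m)) η (norm_rescale_le (h.shift k) (by omega) hμ)
  refine ⟨fun k y => (W k y 0).1, fun k => ?_, fun k => ?_, fun k => ?_, fun k y y' => ?_,
    fun k => ?_, fun k y => ?_⟩
  · exact π.contDiff.comp (hWc k)
  · simp [hW0 k]
  -- The nonlinearity is quadratic along an orbit of size O(|y|), so the graph itself is O(|y|²) and
  -- has derivative zero at 0.
  · have hq : ∀ y, |(W k y 0).1| ≤
        κx⁻¹ * (M * ((1 - θ)⁻¹ * |y|) * ((1 - θ)⁻¹ * |y|)) / (1 - μ / κx) := by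
      intro y
      have hWy : ‖W k y‖ ≤ (1 - θ)⁻¹ * |y| := by simpa [hW0 k] using hWl k y 0
      have := abs_fst_sub_le (κy := κy) (w := W k y) (v := 0) (u := U k (W k y)) (u' := 0)
        hκx hμ hμκx (c := M * ((1 - θ)⁻¹ * |y|) * ((1 - θ)⁻¹ * |y|)) (fun m => ?_)
        (hWeq k y).2 (fun m => by simp [Prod.ext_iff])
      · simpa using this
      · have h1 := norm_rescale_le_sq (h.shift k) hn hμ hμ1.le m (W k y m)
        have h2 := ((W k y).norm_coe_le_norm m).trans hWy
        calc ‖U k (W k y) m - (0 : ℕ →ᵇ ℝ × ℝ) m‖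
            = ‖rescale μ (fun m => R (k + m)) m (W k y m)‖ := by simp [U]
          _ ≤ _ := h1.trans (by gcongr)
    have hO : (fun y => (W k y 0).1) =O[𝓝 0] fun y : ℝ => ‖y - 0‖ ^ 2 := by
      refine Asymptotics.IsBigO.of_bound (κx⁻¹ * (M * (1 - θ)⁻¹ * (1 - θ)⁻¹) / (1 - μ / κx))
        (Eventually.of_forall fun y => ?_)
      rw [sub_zero, norm_pow, norm_norm, Real.norm_eq_abs, Real.norm_eq_abs]
      refine (hq y).trans_eq ?_
      ring
    have := (hO.hasFDerivAt one_lt_two).hasDerivAt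
    simpa using this.deriv
  · have hl := hWl k y y'
    have := abs_fst_sub_le (κy := κy) (w := W k y) (v := W k y') (u := U k (W k y))
      (u' := U k (W k y')) hκx hμ hμκx (c := η * ((1 - θ)⁻¹ * |y - y'|)) (fun m => ?_)
      (hWeq k y).2 (hWeq k y').2
    · refine this.trans ?_
      rw [div_le_iff₀ h1μ, inv_mul_le_iff₀ hκx, ← mul_assoc, ← mul_assoc, ← mul_assoc]
      rw [← div_eq_mul_inv, div_mul_eq_mul_div, div_le_iff₀ h1θ]
      calc η * |y - y'| ≤ τ * (1 - μ / κx) * (1 - θ) * κx * |y - y'| := by gcongr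
        _ = _ := by ring
    · refine (norm_rescale_sub_le (h.shift k) (by omega) hμ m _ _).trans ?_
      gcongr
      exact ((W k y - W k y').norm_coe_le_norm m).trans hl
  · exact DerivBound.clm_comp π isOpen_univ (hWc k).contDiffOn (hWb k)
  · have hR0 : rescale μ (fun m => R (k + m)) 0 (W k y 0) = R k ((W k y 0).1, y) := by
      rw [← hpair]; simp [rescale]
    have h0 := (hWeq k y).2 0
    rw [hR0, (hWeq k y).1] at h0
    set y₁ := κy * y + (R k ((W k y 0).1, y)).2 with hy₁
    have hfst : μ * (W k y 1).1 = κx * (W k y 0).1 + (R k ((W k y 0).1, y)).1 :=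
      congrArg Prod.fst h0
    have hsnd : μ * (W k y 1).2 = y₁ := congrArg Prod.snd h0
    -- The tail of the solution, multiplied by μ, solves the problem that starts at time k + 1. By
    -- uniqueness it is `W (k + 1) y₁`, and its first component is the invariance relation.
    let v : ℕ →ᵇ ℝ × ℝ := BoundedContinuousFunction.ofNormedAddCommGroupDiscrete
      (fun m => μ • W k y (m + 1)) (‖μ‖ * ‖W k y‖) (fun m => by
        rw [norm_smul]
        gcongr
        exact (W k y).norm_coe_le_norm _)
    have hv : ∀ m, v m = μ • W k y (m + 1) := fun m => rfl
    have hvW : v = W (k + 1) y₁ := by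
      rw [hW]
      refine ⟨hsnd, fun m => ?_⟩
      have h1 := (hWeq k y).2 (m + 1)
      have h2 : rescale μ (fun m => R (k + 1 + m)) m (v m) =
          μ • rescale μ (fun m => R (k + m)) (m + 1) (W k y (m + 1)) := by
        simp only [rescale, hv, smul_smul]
        rw [show k + 1 + m = k + (m + 1) by ring, ← pow_succ]
        congr 1
        rw [pow_succ]
        field_simp
      rw [hv (m + 1), h1, h2, smul_add]
      congr 1
      rw [hv]
      simp only [Prod.smul_fst, Prod.smul_snd, Prod.smul_mk, smul_eq_mul]
      exact Prod.ext (by ring) (by ring)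
    change κx * (W k y 0).1 + (R k ((W k y 0).1, y)).1 = (W (k + 1) y₁ 0).1
    rw [← hvW, hv, ← hfst]
    rfl

end LyapunovPerron

/-! ### Inequalities between the rates. -/

section Rates

/-- The horizontal rate `lam^{1-ε} ρ^{-1-3ε}`. -/
def rateX (ε lam ρ : ℝ) : ℝ := lam ^ (1 - ε) / ρ ^ (1 + 3 * ε)

/-- The vertical rate `lam^{1-ε} ρ^{-2ε}`. -/
def rateY (ε lam ρ : ℝ) : ℝ := lam ^ (1 - ε) / ρ ^ (2 * ε)

/-- The rate `ρ^{4ε} lam^{2ε}` at which the regular radii decrease. -/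
def slow (ε lam ρ : ℝ) : ℝ := ρ ^ (4 * ε) * lam ^ (2 * ε)

/-- The relations between the rates on which the construction depends. -/
structure RateBounds (ε lam ρ : ℝ) : Prop where
  eps_mem : ε ∈ Ioo (0 : ℝ) 1
  lam_mem : lam ∈ Ioo (0 : ℝ) 1
  rho_mem : ρ ∈ Ioo (0 : ℝ) 1
  slow_pos : 0 < slow ε lam ρ
  slow_lt_one : slow ε lam ρ < 1
  lamCheck_pos : 0 < lamCheck ε lam
  rateY_pos : 0 < rateY ε lam ρ
  rateY_lt_rateX : rateY ε lam ρ < rateX ε lam ρ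
  vertical_lt_slow : rateY ε lam ρ + lamCheck ε lam < slow ε lam ρ
  lam_div_slow_lt : lam ^ (1 - ε) / slow ε lam ρ < rateX ε lam ρ - lamCheck ε lam
  vertical_div_slow_lt : (rateY ε lam ρ + lamCheck ε lam) / slow ε lam ρ < rateX ε lam ρ
  lam_lt_slow_sq : lam ^ (1 - ε) < slow ε lam ρ ^ 2
  lam_lt_rateY : lam ^ (1 - ε) < rateY ε lam ρ

/-- Let l = log λ and s = log ρ, both negative. The condition `hst` reads l(1 - 5ε) < 8εs and forces
ε < 1/5. Then `hreg` implies its own case r = 1, namely s(2 - 4ε) < l(1 + ε), whence s < l/2.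
Inserting this into `hst` improves the bound to ε < 1/9. -/
theorem rate_exponent_bounds {r : ℕ} (hr : 1 ≤ r) {ε lam ρ : ℝ} (hε : ε ∈ Ioo (0 : ℝ) 1)
    (hlam : lam ∈ Ioo (0 : ℝ) 1) (hρ : ρ ∈ Ioo (0 : ℝ) 1)
    (hreg : ρ ^ (((r : ℝ) + 1) - ε * (r + 3)) / lam ^ ((1 + ε) * r) < 1)
    (hst : lam ^ (1 - ε) < ρ ^ (8 * ε) * lam ^ (4 * ε)) :
    ε < 1 / 9 ∧ Real.log ρ < Real.log lam / 2 := by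
  obtain ⟨hε0, hε1⟩ := hε
  obtain ⟨hl0, hl1⟩ := hlam
  obtain ⟨hρ0, hρ1⟩ := hρ
  have hl := Real.log_neg hl0 hl1
  have hs := Real.log_neg hρ0 hρ1
  rw [div_lt_one (by positivity), Real.rpow_def_of_pos hρ0, Real.rpow_def_of_pos hl0,
    Real.exp_lt_exp] at hreg
  rw [Real.rpow_def_of_pos hρ0, Real.rpow_def_of_pos hl0, Real.rpow_def_of_pos hl0,
    ← Real.exp_add, Real.exp_lt_exp] at hst
  set l := Real.log lam
  set s := Real.log ρ
  have hr' : (1 : ℝ) ≤ r := by exact_mod_cast hr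
  have h5 : ε < 1 / 5 := by nlinarith
  -- The exponents r(2 - 4ε) and (r + 1) - ε(r + 3) differ by (r - 1)(1 - 3ε).
  have h6 : (r : ℝ) * (s * (2 - 4 * ε)) < r * (l * (1 + ε)) := by
    have : 0 ≤ ((r : ℝ) - 1) * (1 - 3 * ε) := mul_nonneg (by linarith) (by linarith)
    nlinarith
  have h7 : s * (2 - 4 * ε) < l * (1 + ε) := lt_of_mul_lt_mul_left h6 (by positivity)
  have h8 : s < l / 2 := by nlinarith
  refine ⟨?_, h8⟩
  nlinarith

theorem two_sub_mul_self_lt_one {x : ℝ} (hx : x < 1) : (2 - x) * x < 1 := by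
  nlinarith [mul_pos (sub_pos.2 hx) (sub_pos.2 hx)]

theorem sq_add_pow_four_le_one {x : ℝ} (hx0 : 0 < x) (hx : x < 1) :
    x ^ 2 + x ^ 4 * (1 - x) ≤ 1 := by
  have h1 : x ^ 4 * (1 - x) ≤ 1 * (1 - x) := by
    gcongr
    exact pow_le_one₀ hx0.le hx.le
  nlinarith

/-- All the rates are monomials in x = λ^ε, t = ρ^ε, a = λ^{1-ε} and b = ρ^{-(1-ε)}. The exponents
enter only through `hst'`, `hb4` and `hb3`; what remains are polynomial inequalities for x and t in
(0, 1). -/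
theorem rateBounds {r : ℕ} (hr : 1 ≤ r) {ε lam ρ : ℝ} (hε : ε ∈ Ioo (0 : ℝ) 1)
    (hlam : lam ∈ Ioo (0 : ℝ) 1) (hρ : ρ ∈ Ioo (0 : ℝ) 1)
    (hreg : ρ ^ (((r : ℝ) + 1) - ε * (r + 3)) / lam ^ ((1 + ε) * r) < 1)
    (hst : lam ^ (1 - ε) < ρ ^ (8 * ε) * lam ^ (4 * ε)) : RateBounds ε lam ρ := by
  obtain ⟨hε9, hs⟩ := rate_exponent_bounds hr hε hlam hρ hreg hst
  have hε' := hε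
  have hlam' := hlam
  have hρ' := hρ
  obtain ⟨hε0, hε1⟩ := hε'
  obtain ⟨hl0, hl1⟩ := hlam'
  obtain ⟨hρ0, hρ1⟩ := hρ'
  have hl := Real.log_neg hl0 hl1
  have hsn := Real.log_neg hρ0 hρ1
  obtain ⟨x, hx⟩ : ∃ x, x = lam ^ ε := ⟨_, rfl⟩
  obtain ⟨t, ht⟩ : ∃ t, t = ρ ^ ε := ⟨_, rfl⟩
  obtain ⟨a, ha⟩ : ∃ a, a = lam ^ (1 - ε) := ⟨_, rfl⟩
  obtain ⟨b, hb⟩ : ∃ b, b = ρ ^ (-(1 - ε)) := ⟨_, rfl⟩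
  have hx0 : 0 < x := by rw [hx]; positivity
  have ht0 : 0 < t := by rw [ht]; positivity
  have ha0 : 0 < a := by rw [ha]; positivity
  have hb0 : 0 < b := by rw [hb]; positivity
  have hx1 : x < 1 := by rw [hx]; exact Real.rpow_lt_one hl0.le hl1 hε0
  have ht1 : t < 1 := by rw [ht]; exact Real.rpow_lt_one hρ0.le hρ1 hε0
  have hlpow : ∀ k : ℕ, lam ^ ((k : ℝ) * ε) = x ^ k := fun k => by
    rw [hx, mul_comm, Real.rpow_mul_natCast hl0.le]
  have hρpow : ∀ k : ℕ, ρ ^ ((k : ℝ) * ε) = t ^ k := fun k => by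
    rw [ht, mul_comm, Real.rpow_mul_natCast hρ0.le]
  have hslow : slow ε lam ρ = t ^ 4 * x ^ 2 := by
    rw [slow, ← hlpow, ← hρpow]; norm_num
  have hlc : lamCheck ε lam = a * x ^ 2 * (1 - x) := by
    rw [lamCheck, ← hx, ha, ← hlpow, ← Real.rpow_add hl0]
    congr 2; push_cast; ring
  have hκy : rateY ε lam ρ = a / t ^ 2 := by
    rw [rateY, ← ha, ← hρpow]; norm_num
  have hκx : rateX ε lam ρ = a * b / t ^ 4 := by
    rw [rateX, ← ha, hb, ← hρpow, mul_div_assoc, ← Real.rpow_sub hρ0, div_eq_mul_inv,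
      ← Real.rpow_neg hρ0.le]
    congr 2; push_cast; ring
  have hst' : a < t ^ 8 * x ^ 4 := by
    rw [ha, ← hlpow, ← hρpow]
    exact_mod_cast hst
  -- After log ρ < (log λ)/2 is inserted, the exponents here and in `hb3` are nonnegative as soon as
  -- 9ε ≤ 1.
  have hb4 : 1 ≤ b * x ^ 4 := by
    rw [hb, ← hlpow, Real.rpow_def_of_pos hρ0, Real.rpow_def_of_pos hl0, ← Real.exp_add]
    apply Real.one_le_exp
    push_cast
    nlinarith
  have hb3 : 1 ≤ b * t ^ 2 * x ^ 3 := by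
    rw [hb, ← hlpow, ← hρpow, ← Real.rpow_add hρ0, Real.rpow_def_of_pos hρ0,
      Real.rpow_def_of_pos hl0, ← Real.exp_add]
    apply Real.one_le_exp
    push_cast
    nlinarith
  have h1x : 0 < 1 - x := by linarith
  have ht2 : t ^ 2 < 1 := pow_lt_one₀ ht0.le ht1 (by norm_num)
  have ht4 : t ^ 4 < 1 := pow_lt_one₀ ht0.le ht1 (by norm_num)
  have hx2 : x ^ 2 < 1 := pow_lt_one₀ hx0.le hx1 (by norm_num)
  have hx3 : x ^ 3 < 1 := pow_lt_one₀ hx0.le hx1 (by norm_num)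
  have hx4 : x ^ 4 < 1 := pow_lt_one₀ hx0.le hx1 (by norm_num)
  have hb1 : 1 < b := by
    by_contra hcon
    push Not at hcon
    have : b * x ^ 4 < 1 := by nlinarith [pow_pos hx0 4]
    linarith
  have hv : a / t ^ 2 + a * x ^ 2 * (1 - x) = a * (1 + t ^ 2 * x ^ 2 * (1 - x)) / t ^ 2 := by
    field_simp
  refine ⟨hε, hlam, hρ, ?_, ?_, ?_, ?_, ?_, ?_, ?_, ?_, ?_, ?_⟩
  · rw [hslow]; positivity
  · rw [hslow]; exact mul_lt_one_of_nonneg_of_lt_one_left (by positivity) ht4 hx2.le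
  · rw [hlc]; positivity
  · rw [hκy]; positivity
  · rw [hκy, hκx, div_lt_div_iff₀ (by positivity) (by positivity)]
    have : a * t ^ 2 * t ^ 2 < a * t ^ 2 * b := by
      apply mul_lt_mul_of_pos_left _ (by positivity)
      linarith
    calc a * t ^ 4 = a * t ^ 2 * t ^ 2 := by ring
      _ < a * t ^ 2 * b := this
      _ = _ := by ring
  · rw [hκy, hlc, hslow, hv, div_lt_iff₀ (by positivity)]
    have e1 : x ^ 2 + x ^ 4 * (1 - x) ≤ 1 := sq_add_pow_four_le_one hx0 hx1
    calc a * (1 + t ^ 2 * x ^ 2 * (1 - x)) < t ^ 8 * x ^ 4 * (1 + t ^ 2 * x ^ 2 * (1 - x)) := by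
          gcongr
      _ ≤ t ^ 8 * x ^ 4 * (1 + 1 * x ^ 2 * (1 - x)) := by gcongr
      _ = t ^ 8 * x ^ 2 * (x ^ 2 + x ^ 4 * (1 - x)) := by ring
      _ ≤ t ^ 8 * x ^ 2 * 1 := by gcongr
      _ = (t ^ 4 * x ^ 2 * t ^ 2) * t ^ 2 := by ring
      _ ≤ (t ^ 4 * x ^ 2 * t ^ 2) * 1 := by gcongr
      _ = _ := by ring
  · rw [← ha, hκx, hlc, hslow, lt_sub_iff_add_lt]
    have e : a / (t ^ 4 * x ^ 2) + a * x ^ 2 * (1 - x) =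
        a * (1 + t ^ 4 * x ^ 4 * (1 - x)) / x ^ 2 / t ^ 4 := by
      field_simp
    rw [e]
    gcongr
    rw [div_lt_iff₀ (by positivity)]
    have h1 : t ^ 4 * x ^ 4 * (1 - x) < 1 * 1 * (1 - x) := by gcongr
    have h2 : (1 + t ^ 4 * x ^ 4 * (1 - x)) * x ^ 2 < 1 := by
      have h5 : (2 - x) * x < 1 := by linarith [mul_pos h1x h1x]
      calc (1 + t ^ 4 * x ^ 4 * (1 - x)) * x ^ 2 ≤ (2 - x) * x ^ 2 := by gcongr; linarith
        _ = ((2 - x) * x) * x := by ring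
        _ < 1 * x := mul_lt_mul_of_pos_right h5 hx0
        _ ≤ 1 := by linarith
    have h3 : (1 + t ^ 4 * x ^ 4 * (1 - x)) * x ^ 2 < b * x ^ 2 * x ^ 2 := by
      calc _ < 1 := h2
        _ ≤ b * x ^ 4 := hb4
        _ = _ := by ring
    have h4 := lt_of_mul_lt_mul_right h3 (by positivity)
    calc a * (1 + t ^ 4 * x ^ 4 * (1 - x)) < a * (b * x ^ 2) := by gcongr
      _ = _ := by ring
  · rw [hκy, hlc, hslow, hv, hκx]
    rw [div_div, div_lt_div_iff₀ (by positivity) (by positivity)]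
    have h1 : t ^ 2 * x ^ 2 * (1 - x) < 1 * 1 * (1 - x) := by gcongr
    have h2 : (1 + t ^ 2 * x ^ 2 * (1 - x)) * x < 1 := by
      have h5 : (2 - x) * x < 1 := two_sub_mul_self_lt_one hx1
      refine lt_of_le_of_lt ?_ h5
      gcongr
      linarith
    have h3 : (1 + t ^ 2 * x ^ 2 * (1 - x)) * x < b * t ^ 2 * x ^ 2 * x := by
      calc _ < 1 := h2
        _ ≤ _ := hb3
        _ = _ := by ring
    have h4 := lt_of_mul_lt_mul_right h3 hx0.le
    calc a * (1 + t ^ 2 * x ^ 2 * (1 - x)) * t ^ 4 < a * (b * t ^ 2 * x ^ 2) * t ^ 4 := by gcongr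
      _ = _ := by ring
  · rw [← ha, hslow]
    calc a < t ^ 8 * x ^ 4 := hst'
      _ = _ := by ring
  · rw [← ha, hκy, lt_div_iff₀ (by positivity)]
    exact mul_lt_of_lt_one_right ha0 ht2

variable {ε lam ρ : ℝ}

theorem RateBounds.rateX_pos (h : RateBounds ε lam ρ) : 0 < rateX ε lam ρ :=
  h.rateY_pos.trans h.rateY_lt_rateX

theorem RateBounds.rateY_lt_one (h : RateBounds ε lam ρ) : rateY ε lam ρ < 1 := by
  linarith [h.vertical_lt_slow, h.lamCheck_pos, h.slow_lt_one]

/-- This ratio is the largest growth of the transverse direction relative to the stable one that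
regularity permits, so the two normalized columns of the frame stay comparable. -/
theorem RateBounds.rateX_div_rateY (h : RateBounds ε lam ρ) :
    rateX ε lam ρ / rateY ε lam ρ = (ρ ^ (1 + ε))⁻¹ := by
  have hl := Real.rpow_pos_of_pos h.lam_mem.1 (1 - ε)
  have h1 := Real.rpow_pos_of_pos h.rho_mem.1 (1 + 3 * ε)
  have h2 := Real.rpow_pos_of_pos h.rho_mem.1 (2 * ε)
  have h3 := Real.rpow_pos_of_pos h.rho_mem.1 (1 + ε)
  have e : ρ ^ (1 + 3 * ε) = ρ ^ (1 + ε) * ρ ^ (2 * ε) := by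
    rw [← Real.rpow_add h.rho_mem.1]; congr 1; ring
  rw [rateX, rateY, e, div_div_div_cancel_left' _ _ hl.ne', mul_comm (ρ ^ (1 + ε)),
    div_mul_cancel_left₀ h2.ne']

/-- This product governs the growth of ‖T n‖, which thereby matches the growth of `distortion`. -/
theorem RateBounds.rateX_mul (h : RateBounds ε lam ρ) :
    rateX ε lam ρ * ρ ^ (1 - ε) * (lam ^ (1 + ε))⁻¹ = (slow ε lam ρ)⁻¹ := by
  have h0 := h.lam_mem.1
  have h1 := h.rho_mem.1
  rw [rateX, slow, mul_inv, ← Real.rpow_neg h1.le, ← Real.rpow_neg h0.le, ← Real.rpow_neg h0.le,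
    div_eq_mul_inv, ← Real.rpow_neg h1.le]
  rw [mul_right_comm, mul_right_comm (lam ^ (1 - ε)), ← Real.rpow_add h0, mul_assoc,
    ← Real.rpow_add h1, mul_comm]
  congr 2 <;> ring

/-- This identity cancels all exponential growth in ‖T (n+1)‖ ‖(T n)⁻¹‖². -/
theorem RateBounds.rateX_mul_sq (h : RateBounds ε lam ρ) :
    rateX ε lam ρ * ρ ^ (1 - ε) * lam ^ (1 - ε) = rateY ε lam ρ ^ 2 := by
  have h1 := h.rho_mem.1
  have e : ρ ^ (1 + 3 * ε) = ρ ^ (1 - ε) * ρ ^ (2 * ε) * ρ ^ (2 * ε) := by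
    rw [← Real.rpow_add h1, ← Real.rpow_add h1]; congr 1; ring
  have h2 := Real.rpow_pos_of_pos h1 (2 * ε)
  have h3 := Real.rpow_pos_of_pos h1 (1 - ε)
  rw [rateX, rateY, e]
  field_simp

end Rates

/-! ### The area form and linear frames of the plane. -/

section Plane

/-- The area form of the plane. -/
def area (a b : Plane) : ℝ := a 0 * b 1 - a 1 * b 0

/-- The rotation by a right angle. -/
def rot (v : Plane) : Plane := !₂[v 1, -v 0]

theorem norm_sq_plane (v : Plane) : ‖v‖ ^ 2 = v 0 ^ 2 + v 1 ^ 2 := by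
  rw [EuclideanSpace.norm_sq_eq, Fin.sum_univ_two, Real.norm_eq_abs, Real.norm_eq_abs, sq_abs,
    sq_abs]

theorem abs_apply_le_norm (v : Plane) (i : Fin 2) : |v i| ≤ ‖v‖ := PiLp.norm_apply_le v i

theorem norm_le_abs_add_abs (v : Plane) : ‖v‖ ≤ |v 0| + |v 1| := by
  refine abs_le_of_sq_le_sq' ?_ (by positivity) |>.2
  rw [norm_sq_plane, ← sq_abs (v 0), ← sq_abs (v 1)]
  nlinarith [abs_nonneg (v 0), abs_nonneg (v 1)]

theorem area_rot_self (v : Plane) : area (rot v) v = ‖v‖ ^ 2 := by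
  rw [norm_sq_plane]; simp [area, rot]; ring

theorem abs_area_le (a b : Plane) : |area a b| ≤ ‖a‖ * ‖b‖ := by
  refine abs_le_of_sq_le_sq ?_ (by positivity)
  rw [mul_pow, norm_sq_plane, norm_sq_plane, area]
  nlinarith [sq_nonneg (a 0 * b 0 + a 1 * b 1)]

theorem inner_plane (a b : Plane) : inner ℝ a b = a 0 * b 0 + a 1 * b 1 := by
  rw [PiLp.inner_apply, Fin.sum_univ_two]
  simp [mul_comm]

theorem inner_sq_add_area_sq (a b : Plane) :
    inner ℝ a b ^ 2 + area a b ^ 2 = ‖a‖ ^ 2 * ‖b‖ ^ 2 := by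
  rw [norm_sq_plane, norm_sq_plane, area, inner_plane]
  ring

theorem eq_sum_smul_plane (v : Plane) : v = v 0 • !₂[(1 : ℝ), 0] + v 1 • !₂[(0 : ℝ), 1] := by
  ext i; fin_cases i <;> simp

theorem det_eq_area (M : Plane →L[ℝ] Plane) :
    M.det = area (M !₂[1, 0]) (M !₂[0, 1]) := by
  have e : ∀ i, (EuclideanSpace.basisFun (Fin 2) ℝ).toBasis i = if i = 0 then !₂[1, 0] else
      (!₂[0, 1] : Plane) := by
    intro i; ext j; fin_cases i <;> fin_cases j <;> simp
  rw [ContinuousLinearMap.det, ← LinearMap.det_toMatrix (EuclideanSpace.basisFun (Fin 2) ℝ).toBasis,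
    Matrix.det_fin_two, area]
  simp only [LinearMap.toMatrix_apply, e]
  simp
  ring

theorem area_map (M : Plane →L[ℝ] Plane) (a b : Plane) :
    area (M a) (M b) = M.det * area a b := by
  rw [det_eq_area]
  conv_lhs => rw [eq_sum_smul_plane a, eq_sum_smul_plane b]
  simp only [map_add, map_smul, area, PiLp.add_apply, PiLp.smul_apply, smul_eq_mul]
  ring

/-- The linear map with columns `u` and `v`. -/
def frame (u v : Plane) : Plane →L[ℝ] Plane :=
  (EuclideanSpace.proj (𝕜 := ℝ) 0).smulRight u + (EuclideanSpace.proj (𝕜 := ℝ) 1).smulRight v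

@[simp] theorem frame_apply (u v z : Plane) : frame u v z = z 0 • u + z 1 • v := rfl

/-- The inverse of `frame u v` when `area u v ≠ 0`. -/
def coframe (u v : Plane) : Plane →L[ℝ] Plane :=
  (area u v)⁻¹ • frame !₂[v 1, -u 1] !₂[-v 0, u 0]

theorem coframe_apply (u v w : Plane) :
    coframe u v w = !₂[area w v / area u v, area u w / area u v] := by
  ext i; fin_cases i <;> simp [coframe, area] <;> ring

/-- The linear automorphism with columns `u` and `v`. -/
def frameEquiv (u v : Plane) (h : area u v ≠ 0) : Plane ≃L[ℝ] Plane :=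
  ContinuousLinearEquiv.equivOfInverse (frame u v) (coframe u v)
    (fun z => by
      rw [coframe_apply]
      ext i
      fin_cases i
      · simp only [Fin.zero_eta, Matrix.cons_val_zero, frame_apply]
        rw [div_eq_iff h]; simp [area]; ring
      · simp only [Fin.mk_one, Matrix.cons_val_one, frame_apply]
        rw [Matrix.cons_val_fin_one, div_eq_iff h]; simp [area]; ring)
    (fun w => by
      rw [coframe_apply]
      ext i
      have : (area w v / area u v) * u i + (area u w / area u v) * v i = w i := by
        rw [div_mul_eq_mul_div, div_mul_eq_mul_div, ← add_div, div_eq_iff h]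
        fin_cases i <;> simp [area] <;> ring
      simpa using this)

theorem norm_frame_le (u v : Plane) : ‖frame u v‖ ≤ ‖u‖ + ‖v‖ :=
  ContinuousLinearMap.opNorm_le_bound _ (by positivity) fun z => by
    rw [frame_apply]
    calc ‖z 0 • u + z 1 • v‖ ≤ |z 0| * ‖u‖ + |z 1| * ‖v‖ := by
          refine (norm_add_le _ _).trans_eq ?_
          rw [norm_smul, norm_smul, Real.norm_eq_abs, Real.norm_eq_abs]
      _ ≤ ‖z‖ * ‖u‖ + ‖z‖ * ‖v‖ := by gcongr <;> exact abs_apply_le_norm z _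
      _ = _ := by ring

theorem norm_coframe_le (u v : Plane) : ‖coframe u v‖ ≤ (‖u‖ + ‖v‖) / |area u v| :=
  ContinuousLinearMap.opNorm_le_bound _ (by positivity) fun w => by
    rw [coframe_apply]
    refine (norm_le_abs_add_abs _).trans ?_
    simp only [Matrix.cons_val_zero, Matrix.cons_val_one,
      Matrix.cons_val_fin_one, abs_div]
    rw [← add_div, div_mul_eq_mul_div]
    gcongr
    linarith [abs_area_le w v, abs_area_le u w, mul_comm ‖w‖ ‖v‖]

end Plane

/-! ### Growth of tangent vectors along a regular orbit. -/

section Orbit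

variable {r : ℕ} {A B A' : ℝ} {Ω : Set Plane} {F : Plane → Plane}

theorem IsDissipativeDiffeo.mapsTo (h : IsDissipativeDiffeo r A B A' Ω F) : MapsTo F Ω Ω :=
  fun _ hq => h.closure_subset (subset_closure (mem_image_of_mem F hq))

theorem IsDissipativeDiffeo.iterate_mem (h : IsDissipativeDiffeo r A B A' Ω F) (n : ℕ)
    {q : Plane} (hq : q ∈ Ω) : F^[n] q ∈ Ω := h.mapsTo.iterate n hq

theorem IsDissipativeDiffeo.injOn_iterate (h : IsDissipativeDiffeo r A B A' Ω F) (n : ℕ) :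
    InjOn F^[n] Ω := h.injOn.iterate h.mapsTo n

theorem IsDissipativeDiffeo.contDiffOn_iterate (h : IsDissipativeDiffeo r A B A' Ω F) (n : ℕ) :
    ContDiffOn ℝ (r + 1 : ℕ) F^[n] Ω := by
  induction n with
  | zero => exact contDiffOn_id
  | succ n ih =>
    rw [Function.iterate_succ']
    exact h.contDiffOn.comp ih (h.mapsTo.iterate n)

theorem IsDissipativeDiffeo.differentiableAt (h : IsDissipativeDiffeo r A B A' Ω F)
    {q : Plane} (hq : q ∈ Ω) : DifferentiableAt ℝ F q :=
  (h.contDiffOn.contDiffAt (h.isOpen.mem_nhds hq)).differentiableAt (by simp)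

theorem IsDissipativeDiffeo.differentiableAt_iterate (h : IsDissipativeDiffeo r A B A' Ω F)
    (n : ℕ) {q : Plane} (hq : q ∈ Ω) : DifferentiableAt ℝ F^[n] q :=
  ((h.contDiffOn_iterate n).contDiffAt (h.isOpen.mem_nhds hq)).differentiableAt (by simp)

theorem IsDissipativeDiffeo.fderiv_iterate_succ (h : IsDissipativeDiffeo r A B A' Ω F) (n : ℕ)
    {q : Plane} (hq : q ∈ Ω) (v : Plane) :
    fderiv ℝ F^[n + 1] q v = fderiv ℝ F (F^[n] q) (fderiv ℝ F^[n] q v) := by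
  rw [Function.iterate_succ', fderiv_comp q (h.differentiableAt (h.iterate_mem n hq))
    (h.differentiableAt_iterate n hq)]
  rfl

theorem IsDissipativeDiffeo.fderiv_iterate_ne_zero (h : IsDissipativeDiffeo r A B A' Ω F) (n : ℕ)
    {q : Plane} (hq : q ∈ Ω) {v : Plane} (hv : v ≠ 0) : fderiv ℝ F^[n] q v ≠ 0 := by
  induction n with
  | zero =>
    rw [Function.iterate_zero, fderiv_id]
    exact hv
  | succ n ih =>
    rw [h.fderiv_iterate_succ n hq]
    intro h0
    have := h.norm_inv_le _ (h.iterate_mem n hq) (fderiv ℝ F^[n] q v)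
    rw [h0, norm_zero, mul_zero] at this
    exact ih (norm_eq_zero.1 (le_antisymm this (norm_nonneg _)))

theorem IsDissipativeDiffeo.exists_equiv (h : IsDissipativeDiffeo r A B A' Ω F) (n : ℕ)
    {q : Plane} (hq : q ∈ Ω) :
    ∃ T : Plane ≃L[ℝ] Plane, (T : Plane →L[ℝ] Plane) = fderiv ℝ F^[n] q := by
  have hinj : Function.Injective (fderiv ℝ F^[n] q) := by
    rw [injective_iff_map_eq_zero]
    intro v hv
    by_contra hne
    exact h.fderiv_iterate_ne_zero n hq hne hv
  refine ⟨(LinearEquiv.ofInjectiveEndo (fderiv ℝ F^[n] q : Plane →ₗ[ℝ] Plane)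
    hinj).toContinuousLinearEquiv, ?_⟩
  ext v : 1
  rfl

variable {L ε lam ρ δ : ℝ} {p e : Plane}

theorem IsRegularOrbit.bounds_pos (h : IsRegularOrbit r L ε lam ρ A B A' δ Ω F p e) :
    0 < A ∧ 0 < B ∧ 0 < A' := by
  have h1 := h.diffeo.norm_inv_le p h.mem e
  rw [h.norm_direction] at h1
  have hpos : 0 < ‖fderiv ℝ F p e‖ := by
    refine norm_pos_iff.2 fun h0 => ?_
    rw [h0, norm_zero, mul_zero] at h1
    linarith
  have h2 : ‖fderiv ℝ F p e‖ ≤ ‖fderiv ℝ F p‖ := by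
    simpa [h.norm_direction] using (fderiv ℝ F p).le_opNorm e
  refine ⟨?_, ?_, ?_⟩
  · linarith [h.diffeo.norm_fderiv_le p h.mem]
  · have := h.diffeo.norm_deriv_le p h.mem 1 le_rfl (by omega)
    rw [norm_iteratedFDeriv_one'] at this
    linarith
  · by_contra hc
    nlinarith

theorem IsRegularOrbit.norm_pos (h : IsRegularOrbit r L ε lam ρ A B A' δ Ω F p e) (n : ℕ) :
    0 < ‖fderiv ℝ F^[n] p e‖ := by
  refine norm_pos_iff.2 (h.diffeo.fderiv_iterate_ne_zero n h.mem ?_)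
  intro h0
  have := h.norm_direction
  rw [h0, norm_zero] at this
  exact zero_ne_one this

theorem IsRegularOrbit.jac_eq (h : IsRegularOrbit r L ε lam ρ A B A' δ Ω F p e) (n : ℕ) :
    jac F n p = |area (fderiv ℝ F^[n] p (rot e)) (fderiv ℝ F^[n] p e)| := by
  rw [area_map, area_rot_self, h.norm_direction, jac]
  simp

/-- Time 0 is included; there the estimates amount to L⁻¹ ≤ 1 ≤ L. -/
theorem IsRegularOrbit.regular_pow (hL : 1 ≤ L) (hl : 0 < lam) (hρ : 0 < ρ)
    (h : IsRegularOrbit r L ε lam ρ A B A' δ Ω F p e) (n : ℕ) :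
    (L⁻¹ * (lam ^ (1 + ε)) ^ n ≤ ‖fderiv ℝ (F^[n]) p e‖ ∧
      ‖fderiv ℝ (F^[n]) p e‖ ≤ L * (lam ^ (1 - ε)) ^ n) ∧
    (L⁻¹ * (ρ ^ (1 + ε)) ^ n ≤ ‖fderiv ℝ (F^[n]) p e‖ ^ 2 / jac F n p ∧
      ‖fderiv ℝ (F^[n]) p e‖ ^ 2 / jac F n p ≤ L * (ρ ^ (1 - ε)) ^ n) := by
  rcases Nat.eq_zero_or_pos n with rfl | hn
  · have hL' : L⁻¹ ≤ 1 := inv_le_one_of_one_le₀ hL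
    have hj : jac F 0 p = 1 := by
      rw [h.jac_eq]; simp [area_rot_self, h.norm_direction]
    rw [hj]
    simp [h.norm_direction, hL, hL']
  · have := h.regular n hn le_top
    rwa [Real.rpow_mul_natCast hl.le, Real.rpow_mul_natCast hl.le, Real.rpow_mul_natCast hρ.le,
      Real.rpow_mul_natCast hρ.le] at this

theorem IsRegularOrbit.jac_pos (hL : 1 ≤ L) (hl : 0 < lam) (hρ : 0 < ρ)
    (h : IsRegularOrbit r L ε lam ρ A B A' δ Ω F p e) (n : ℕ) : 0 < jac F n p := by
  have h1 := (h.regular_pow hL hl hρ n).2.1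
  have h2 : 0 < L⁻¹ * (ρ ^ (1 + ε)) ^ n := by positivity
  have h3 : 0 ≤ jac F n p := abs_nonneg _
  rcases h3.eq_or_lt with h0 | h0
  · rw [← h0, div_zero] at h1
    linarith
  · exact h0

theorem IsRegularOrbit.norm_le_succ (h : IsRegularOrbit r L ε lam ρ A B A' δ Ω F p e) (n : ℕ) :
    ‖fderiv ℝ F^[n] p e‖ ≤ A' * ‖fderiv ℝ F^[n + 1] p e‖ := by
  rw [h.diffeo.fderiv_iterate_succ n h.mem]
  exact h.diffeo.norm_inv_le _ (h.diffeo.iterate_mem n h.mem) _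

/-- Split the image of the normal vector into its component along the image of `e` and an orthogonal
remainder. The remainder is determined by the Jacobian and hence by regularity. The coefficient of
the component grows at each step only through the remainder, and summing gives a geometric series
with ratio q > 1, dominated by its last term. -/
theorem IsRegularOrbit.norm_transverse_le (hL : 1 ≤ L) (hε : 0 < ε) (hl : 0 < lam) (hρ : 0 < ρ)
    (hρ1 : ρ < 1) (h : IsRegularOrbit r L ε lam ρ A B A' δ Ω F p e) (n : ℕ) :
    ‖fderiv ℝ F^[n] p (rot e)‖ ≤
      (A * A' * L / ((ρ ^ (1 + ε))⁻¹ - 1) + L) * ((ρ ^ (1 + ε))⁻¹) ^ n * ‖fderiv ℝ F^[n] p e‖ := by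
  obtain ⟨hA, -, hA'⟩ := h.bounds_pos
  set q := (ρ ^ (1 + ε))⁻¹ with hq
  have hq1 : 1 < q := (one_lt_inv₀ (by positivity)).2 (Real.rpow_lt_one hρ.le hρ1 (by linarith))
  have hL0 : 0 < L := by linarith
  set a : ℕ → Plane := fun n => fderiv ℝ F^[n] p e with ha
  set b : ℕ → Plane := fun n => fderiv ℝ F^[n] p (rot e) with hb
  have hEp : ∀ n, 0 < ‖a n‖ := h.norm_pos
  set s : ℕ → ℝ := fun n => inner ℝ (b n) (a n) / ‖a n‖ ^ 2 with hs
  set w : ℕ → Plane := fun n => b n - s n • a n with hw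
  have horth : ∀ n, inner ℝ (w n) (a n) = 0 := fun n => by
    have := (pow_pos (hEp n) 2).ne'
    simp only [hw, hs, inner_sub_left, inner_smul_left, real_inner_self_eq_norm_sq]
    simp [this]
  -- By orthogonality ‖w n‖ ‖a n‖ is the area spanned with `a n`, that is, the Jacobian; the lower
  -- bound on ‖a n‖² / `jac` then applies.
  have hwn : ∀ n, ‖w n‖ ≤ L * q ^ n * ‖a n‖ := fun n => by
    have h1 := inner_sq_add_area_sq (w n) (a n)
    rw [horth n, zero_pow two_ne_zero, zero_add, ← mul_pow] at h1
    have h2 : |area (w n) (a n)| = ‖w n‖ * ‖a n‖ := by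
      rw [← abs_of_nonneg (mul_nonneg (norm_nonneg (w n)) (norm_nonneg (a n)))]
      exact (sq_eq_sq_iff_abs_eq_abs _ _).1 h1
    have h3 : area (w n) (a n) = area (b n) (a n) := by
      simp only [hw, area, PiLp.sub_apply, PiLp.smul_apply, smul_eq_mul]; ring
    rw [h3, ← h.jac_eq] at h2
    have h4 := (h.regular_pow hL hl hρ n).2.1
    rw [le_div_iff₀ (h.jac_pos hL hl hρ n), h2] at h4
    have h5 : L⁻¹ * (ρ ^ (1 + ε)) ^ n * ‖w n‖ ≤ ‖a n‖ := by
      have := hEp n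
      refine le_of_mul_le_mul_right ?_ this
      calc _ = L⁻¹ * (ρ ^ (1 + ε)) ^ n * (‖w n‖ * ‖a n‖) := by ring
        _ ≤ ‖a n‖ ^ 2 := h4
        _ = _ := by ring
    have hpow : (0 : ℝ) < (ρ ^ (1 + ε)) ^ n := by positivity
    calc ‖w n‖ = L * q ^ n * (L⁻¹ * (ρ ^ (1 + ε)) ^ n * ‖w n‖) := by
          rw [hq, inv_pow]; field_simp
      _ ≤ _ := by gcongr
  -- The factor `A'` compares ‖a n‖ with ‖a (n + 1)‖, since the remainder is estimated at time n and
  -- projected at time n + 1.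
  have hsucc : ∀ n, |s (n + 1)| ≤ |s n| + A * A' * L * q ^ n := fun n => by
    set M := fderiv ℝ F (F^[n] p) with hM
    have ha1 : a (n + 1) = M (a n) := h.diffeo.fderiv_iterate_succ n h.mem e
    have hb1 : b (n + 1) = M (b n) := h.diffeo.fderiv_iterate_succ n h.mem (rot e)
    have hb2 : b (n + 1) = s n • a (n + 1) + M (w n) := by
      rw [hb1, ha1, ← map_smul, ← map_add]; congr 1; simp only [hw]; abel
    have hne := (hEp (n + 1))
    have e1 : s (n + 1) = s n + inner ℝ (M (w n)) (a (n + 1)) / ‖a (n + 1)‖ ^ 2 := by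
      have : s (n + 1) = inner ℝ (b (n + 1)) (a (n + 1)) / ‖a (n + 1)‖ ^ 2 := rfl
      rw [this, hb2, inner_add_left, inner_smul_left, real_inner_self_eq_norm_sq]
      simp only [conj_trivial]
      field_simp
    have hMw : ‖M (w n)‖ ≤ A * ‖w n‖ := (M.le_opNorm _).trans (by
      gcongr; exact h.diffeo.norm_fderiv_le _ (h.diffeo.iterate_mem n h.mem))
    have e2 : |inner ℝ (M (w n)) (a (n + 1)) / ‖a (n + 1)‖ ^ 2| ≤ A * A' * L * q ^ n := by
      rw [abs_div, abs_of_pos (pow_pos hne 2), div_le_iff₀ (pow_pos hne 2)]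
      calc |inner ℝ (M (w n)) (a (n + 1))| ≤ ‖M (w n)‖ * ‖a (n + 1)‖ := abs_real_inner_le_norm _ _
        _ ≤ (A * (L * q ^ n * (A' * ‖a (n + 1)‖))) * ‖a (n + 1)‖ := by
            gcongr
            refine hMw.trans ?_
            gcongr
            refine (hwn n).trans ?_
            gcongr
            exact h.norm_le_succ n
        _ = _ := by ring
    rw [e1]
    exact (abs_add_le _ _).trans (by gcongr)
  have hsn : ∀ n, |s n| ≤ A * A' * L / (q - 1) * (q ^ n - 1) := by
    intro n
    have hq1' : q - 1 ≠ 0 := by linarith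
    induction n with
    | zero =>
      have : s 0 = 0 := by
        simp only [hs, ha, hb, Function.iterate_zero, fderiv_id, ContinuousLinearMap.id_apply]
        rw [inner_plane]; simp [rot]; left; ring
      rw [this]; simp
    | succ n ih =>
      refine (hsucc n).trans ((add_le_add_left ih _).trans_eq ?_)
      field_simp
      ring
  have hbn : b n = s n • a n + w n := by simp only [hw]; abel
  have hc : 0 ≤ A * A' * L / (q - 1) := div_nonneg (by positivity) (by linarith)
  change ‖b n‖ ≤ (A * A' * L / (q - 1) + L) * q ^ n * ‖a n‖
  rw [hbn]
  calc ‖s n • a n + w n‖ ≤ |s n| * ‖a n‖ + ‖w n‖ := by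
        refine (norm_add_le _ _).trans_eq ?_
        rw [norm_smul, Real.norm_eq_abs]
    _ ≤ A * A' * L / (q - 1) * q ^ n * ‖a n‖ + L * q ^ n * ‖a n‖ := by
        gcongr
        · refine (hsn n).trans ?_
          gcongr
          linarith
        · exact hwn n
    _ = _ := by ring

end Orbit

/-! ### Linear coordinates in which the derivative cocycle is diagonal. -/

section Frames

variable {r : ℕ} {A B A' : ℝ} {Ω : Set Plane} {F : Plane → Plane} {L ε lam ρ δ : ℝ} {p e : Plane}

/-- The diagonal map `(x, y) ↦ (a x, b y)`. -/
def diag (a b : ℝ) : Plane →L[ℝ] Plane := frame !₂[a, 0] !₂[0, b]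

@[simp] theorem diag_apply_zero (a b : ℝ) (z : Plane) : diag a b z 0 = a * z 0 := by
  simp [diag, mul_comm]

@[simp] theorem diag_apply_one (a b : ℝ) (z : Plane) : diag a b z 1 = b * z 1 := by
  simp [diag, mul_comm]

/-- The data of `T n`: linear coordinates at `F^n p` in which `DF` is diagonal. -/
structure IsDiagonalizing (ε lam ρ c : ℝ) (F : Plane → Plane) (p e : Plane)
    (T : ℕ → Plane ≃L[ℝ] Plane) : Prop where
  norm_symm_le : ∀ n, ‖((T n).symm : Plane →L[ℝ] Plane)‖ ≤
    c * ((rateY ε lam ρ ^ n)⁻¹ * ‖fderiv ℝ F^[n] p e‖)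
  norm_symm_le_const : ∀ n, ‖((T n).symm : Plane →L[ℝ] Plane)‖ ≤ c
  norm_le : ∀ n, ‖(T n : Plane →L[ℝ] Plane)‖ ≤ c * (slow ε lam ρ ^ n)⁻¹
  norm_mul_sq_le : ∀ n, ‖(T (n + 1) : Plane →L[ℝ] Plane)‖ *
    ‖((T n).symm : Plane →L[ℝ] Plane)‖ ^ 2 ≤ c
  vertical : ∀ n, T n (fderiv ℝ F^[n] p e) = rateY ε lam ρ ^ n • (!₂[0, 1] : Plane)
  conj : ∀ n z, fderiv ℝ F (F^[n] p) ((T n).symm z) =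
    (T (n + 1)).symm (diag (rateX ε lam ρ) (rateY ε lam ρ) z)

/-- The columns are images of fixed vectors divided by powers of the two rates, so the conjugacy
with a constant diagonal matrix holds by construction. The inverse frame is bounded by the sum of
the column lengths over their area. All estimates thus reduce to E n = ‖DF^n e‖ and the Jacobian: (T
n)⁻¹ is of order κy^{-n} E n, and `T n` of order κx^n E n / `jac`. -/
theorem exists_isDiagonalizing (hrb : RateBounds ε lam ρ) (hL : 1 ≤ L) (hA : 0 < A)
    (hA' : 0 < A') (r : ℕ) (B δ : ℝ) :
    ∃ c : ℝ, 1 ≤ c ∧ ∀ (Ω : Set Plane) (F : Plane → Plane) (p e : Plane),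
      IsRegularOrbit r L ε lam ρ A B A' δ Ω F p e →
      ∃ T : ℕ → Plane ≃L[ℝ] Plane, IsDiagonalizing ε lam ρ c F p e T := by
  have hl := hrb.lam_mem.1
  have hρ := hrb.rho_mem.1
  have hε := hrb.eps_mem.1
  set κx := rateX ε lam ρ with hκx
  set κy := rateY ε lam ρ with hκy
  have hκx0 : 0 < κx := hrb.rateX_pos
  have hκy0 : 0 < κy := hrb.rateY_pos
  set q := (ρ ^ (1 + ε))⁻¹ with hq
  have hq1 : 1 < q :=
    (one_lt_inv₀ (by positivity)).2 (Real.rpow_lt_one hρ.le hrb.rho_mem.2 (by linarith))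
  set cU := A * A' * L / (q - 1) + L + 1 with hcU
  have hdiv : 0 ≤ A * A' * L / (q - 1) := div_nonneg (by positivity) (by linarith)
  have hcU1 : 1 ≤ cU := by rw [hcU]; linarith
  have hcU0 : 0 ≤ cU := by linarith
  have hL0 : 0 < L := by linarith
  set c := cU + cU * L + cU * L ^ 2 + cU ^ 3 * L ^ 2 * A' ^ 2 * κy ^ 2 with hc
  have p1 : 0 ≤ cU * L := by positivity
  have p2 : 0 ≤ cU * L ^ 2 := by positivity
  have p3 : 0 ≤ cU ^ 3 * L ^ 2 * A' ^ 2 * κy ^ 2 := by positivity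
  refine ⟨c, by linarith, fun Ω F p e h => ?_⟩
  set E : ℕ → ℝ := fun n => ‖fderiv ℝ F^[n] p e‖ with hE
  have hE0 : ∀ n, 0 < E n := h.norm_pos
  have hJ0 : ∀ n, 0 < jac F n p := h.jac_pos hL hl hρ
  set u : ℕ → Plane := fun n => (κx ^ n)⁻¹ • fderiv ℝ F^[n] p (rot e) with hu
  set v : ℕ → Plane := fun n => (κy ^ n)⁻¹ • fderiv ℝ F^[n] p e with hv
  have harea : ∀ n, |area (u n) (v n)| = (κx ^ n)⁻¹ * (κy ^ n)⁻¹ * jac F n p := fun n => by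
    have : area (u n) (v n) = (κx ^ n)⁻¹ * (κy ^ n)⁻¹ *
        area (fderiv ℝ F^[n] p (rot e)) (fderiv ℝ F^[n] p e) := by
      simp only [hu, hv, area, PiLp.smul_apply, smul_eq_mul]; ring
    rw [this, abs_mul, abs_of_pos (by positivity), h.jac_eq]
  have hareapos : ∀ n, 0 < |area (u n) (v n)| := fun n => by
    rw [harea]; have := hJ0 n; positivity
  have huv : ∀ n, ‖u n‖ + ‖v n‖ ≤ cU * ((κy ^ n)⁻¹ * E n) := fun n => by
    have h1 : ‖v n‖ = (κy ^ n)⁻¹ * E n := by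
      simp only [hv, norm_smul]
      rw [Real.norm_of_nonneg (by positivity)]
    have h2 : ‖u n‖ ≤ (A * A' * L / (q - 1) + L) * ((κy ^ n)⁻¹ * E n) := by
      simp only [hu, norm_smul]
      rw [Real.norm_of_nonneg (by positivity)]
      have h3 := h.norm_transverse_le hL hε hl hρ hrb.rho_mem.2 n
      rw [← hq] at h3
      have h4 : κx = q * κy := by
        have := hrb.rateX_div_rateY
        rw [← hκx, ← hκy, ← hq] at this
        rwa [div_eq_iff hκy0.ne'] at this
      have hq0 : 0 < q := by linarith
      calc (κx ^ n)⁻¹ * ‖fderiv ℝ F^[n] p (rot e)‖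
          ≤ (κx ^ n)⁻¹ * ((A * A' * L / (q - 1) + L) * q ^ n * E n) := by gcongr
        _ = _ := by rw [h4, mul_pow]; field_simp
    rw [h1, hcU]
    linarith
  have hElow : ∀ n, L⁻¹ * (lam ^ (1 + ε)) ^ n ≤ E n := fun n => (h.regular_pow hL hl hρ n).1.1
  have hEup : ∀ n, E n ≤ L * (lam ^ (1 - ε)) ^ n := fun n => (h.regular_pow hL hl hρ n).1.2
  have hEJ : ∀ n, E n ^ 2 / jac F n p ≤ L * (ρ ^ (1 - ε)) ^ n := fun n =>
    (h.regular_pow hL hl hρ n).2.2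
  let T : ℕ → Plane ≃L[ℝ] Plane := fun n =>
    (frameEquiv (u n) (v n) (abs_pos.1 (hareapos n))).symm
  have hTs : ∀ n, (((T n).symm : Plane ≃L[ℝ] Plane) : Plane →L[ℝ] Plane) = frame (u n) (v n) :=
    fun n => rfl
  have hTn : ∀ n, ‖((T n : Plane ≃L[ℝ] Plane) : Plane →L[ℝ] Plane)‖ ≤
      cU * (κx ^ n * (E n / jac F n p)) := fun n => by
    refine (norm_coframe_le (u n) (v n)).trans ?_
    rw [div_le_iff₀ (hareapos n), harea]
    have := hJ0 n
    refine (huv n).trans_eq ?_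
    field_simp
  have hTsn : ∀ n, ‖(((T n).symm : Plane ≃L[ℝ] Plane) : Plane →L[ℝ] Plane)‖ ≤
      cU * ((κy ^ n)⁻¹ * E n) := fun n => by
    rw [hTs]; exact (norm_frame_le _ _).trans (huv n)
  refine ⟨T, ⟨fun n => (hTsn n).trans ?_, fun n => (hTsn n).trans ?_, fun n => (hTn n).trans ?_,
    fun n => ?_, fun n => ?_, fun n z => ?_⟩⟩
  · have := hE0 n
    gcongr
    linarith
  · have h1 : (κy ^ n)⁻¹ * E n ≤ L := by
      rw [inv_mul_le_iff₀ (by positivity), mul_comm]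
      refine (hEup n).trans ?_
      gcongr
      exact hrb.lam_lt_rateY.le
    calc cU * ((κy ^ n)⁻¹ * E n) ≤ cU * L := by gcongr
      _ ≤ c := by linarith
  · have h1 : E n / jac F n p ≤ L * (ρ ^ (1 - ε)) ^ n * (L * ((lam ^ (1 + ε)) ^ n)⁻¹) := by
      have h2 : E n / jac F n p = E n ^ 2 / jac F n p * (E n)⁻¹ := by
        have := (hE0 n).ne'
        field_simp
      have hpos : 0 < L⁻¹ * (lam ^ (1 + ε)) ^ n := by positivity
      rw [h2]
      have h3 : (E n)⁻¹ ≤ L * ((lam ^ (1 + ε)) ^ n)⁻¹ := by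
        refine (inv_anti₀ hpos (hElow n)).trans_eq ?_
        rw [mul_inv, inv_inv]
      have h4 := hEJ n
      have h5 := hE0 n
      gcongr
    have h2 := hrb.rateX_mul
    rw [← hκx] at h2
    calc cU * (κx ^ n * (E n / jac F n p))
        ≤ cU * (κx ^ n * (L * (ρ ^ (1 - ε)) ^ n * (L * ((lam ^ (1 + ε)) ^ n)⁻¹))) := by gcongr
      _ = cU * L ^ 2 * (κx * ρ ^ (1 - ε) * (lam ^ (1 + ε))⁻¹) ^ n := by
          rw [mul_pow, mul_pow, inv_pow]; ring
      _ = cU * L ^ 2 * (slow ε lam ρ ^ n)⁻¹ := by rw [h2, inv_pow]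
      _ ≤ c * (slow ε lam ρ ^ n)⁻¹ := by
          have := hrb.slow_pos
          gcongr
          linarith
  -- One step back costs `A'` and brings all factors to time n + 1, where E³ / `jac` is the product
  -- of E² / `jac` and E, both bounded by regularity.
  · have hJ := hJ0 (n + 1)
    have h1 : E n ≤ A' * E (n + 1) := h.norm_le_succ n
    have h5 := hE0 n
    have h6 := hE0 (n + 1)
    calc _ ≤ (cU * (κx ^ (n + 1) * (E (n + 1) / jac F (n + 1) p))) *
          (cU * ((κy ^ n)⁻¹ * E n)) ^ 2 := by
          gcongr
          · exact hTn (n + 1)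
          · exact hTsn n
      _ ≤ (cU * (κx ^ (n + 1) * (E (n + 1) / jac F (n + 1) p))) *
          (cU * ((κy ^ n)⁻¹ * (A' * E (n + 1)))) ^ 2 := by gcongr
      _ = cU ^ 3 * A' ^ 2 * κx ^ (n + 1) * ((κy ^ n)⁻¹) ^ 2 *
          ((E (n + 1) ^ 2 / jac F (n + 1) p) * E (n + 1)) := by ring
      _ ≤ cU ^ 3 * A' ^ 2 * κx ^ (n + 1) * ((κy ^ n)⁻¹) ^ 2 *
          ((L * (ρ ^ (1 - ε)) ^ (n + 1)) * (L * (lam ^ (1 - ε)) ^ (n + 1))) := by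
          gcongr
          · exact hEJ _
          · exact hEup _
      _ = cU ^ 3 * L ^ 2 * A' ^ 2 * ((κx * ρ ^ (1 - ε) * lam ^ (1 - ε)) ^ (n + 1) *
          ((κy ^ n)⁻¹) ^ 2) := by
          rw [mul_pow, mul_pow]; ring
      _ = cU ^ 3 * L ^ 2 * A' ^ 2 * κy ^ 2 := by
          rw [hκx, hrb.rateX_mul_sq, ← hκy]
          congr 1
          field_simp
          ring
      _ ≤ c := by linarith
  · rw [← ContinuousLinearEquiv.eq_symm_apply]
    change _ = frame (u n) (v n) _
    rw [map_smul, frame_apply]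
    have : (κy ^ n) ≠ 0 := by positivity
    rw [← hκy]
    simp [hv, smul_smul, this]
  · change fderiv ℝ F (F^[n] p) (frame (u n) (v n) z) = frame (u (n + 1)) (v (n + 1)) _
    rw [frame_apply, frame_apply, diag_apply_zero, diag_apply_one]
    simp only [hu, hv, map_add, map_smul]
    rw [h.diffeo.fderiv_iterate_succ n h.mem, h.diffeo.fderiv_iterate_succ n h.mem, smul_smul,
      smul_smul, smul_smul, smul_smul]
    congr 2
    · rw [← hκx, pow_succ]; field_simp
    · rw [← hκy, pow_succ]; field_simp

end Frames

/-! ### Cutting off a nonlinearity. -/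

section Cutoff

/-- A smooth function equal to `1` on the unit disc and to `0` outside the disc of radius `2`. -/
def bump : ContDiffBump (0 : Plane) := ⟨1, 2, one_pos, one_lt_two⟩

theorem exists_jetBound_bump (n : ℕ) : ∃ C : ℝ, 0 ≤ C ∧ JetBound n C bump univ := by
  have hc : ∀ k : ℕ, ∃ C, ∀ x, ‖iteratedFDeriv ℝ k bump x‖ ≤ C := fun k =>
    ((bump.hasCompactSupport.iteratedFDeriv k).exists_bound_of_continuous
      (bump.contDiff.continuous_iteratedFDeriv (m := k) (n := k) le_rfl))
  choose C hC using hc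
  have hC0 : ∀ k, 0 ≤ C k := fun k => (norm_nonneg _).trans (hC k 0)
  refine ⟨∑ k ∈ Finset.range (n + 1), C k, Finset.sum_nonneg fun k _ => hC0 k,
    fun k hk x _ => (hC k x).trans ?_⟩
  exact Finset.single_le_sum (f := C) (fun k _ => hC0 k) (Finset.mem_range.2 (by omega))

/-- Since h is O(|z|²) and its derivative O(|z|), multiplication by a bump at scale σ gives a
C¹-size of order σ, although the bump has slope of order 1/σ. The higher derivatives may become
large as σ shrinks, but σ and their bound are independent of h. -/
theorem exists_cutoff {n : ℕ} (hn : 2 ≤ n) {M δ η : ℝ} (hM : 0 ≤ M) (hδ : 0 < δ) (hη : 0 < η) :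
    ∃ σ > 0, σ < δ ∧ ∃ M' : ℝ, ∀ h : Plane → Plane, ContDiffOn ℝ n h (Metric.ball 0 δ) → h 0 = 0 →
      fderiv ℝ h 0 = 0 →
      (∀ k, 2 ≤ k → k ≤ n → ∀ z ∈ Metric.ball 0 δ, ‖iteratedFDeriv ℝ k h z‖ ≤ M) →
      ∃ R : Plane → Plane, ContDiff ℝ n R ∧ (∀ z ∈ Metric.closedBall 0 σ, R z = h z) ∧
        (∀ z, ‖fderiv ℝ R z‖ ≤ η) ∧ DerivBound n M' R univ := by
  obtain ⟨C, hC0, hC⟩ := exists_jetBound_bump n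
  set σ := min (δ / 3) (η / (M * (2 + 4 * C) + 1)) with hσ
  have hσ0 : 0 < σ := by positivity
  have hσδ : 3 * σ ≤ δ := by
    have := min_le_left (δ / 3) (η / (M * (2 + 4 * C) + 1))
    rw [← hσ] at this; linarith
  have hση : σ * (M * (2 + 4 * C)) ≤ η := by
    have := min_le_right (δ / 3) (η / (M * (2 + 4 * C) + 1))
    rw [← hσ, le_div_iff₀ (by positivity)] at this
    nlinarith
  set χ : Plane → ℝ := fun z => bump (σ⁻¹ • z) with hχ
  have hχc : ContDiff ℝ n χ := bump.contDiff.comp (contDiff_const_smul σ⁻¹)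
  have hχj : JetBound n (max 1 σ⁻¹ ^ n * C) χ univ := fun k hk x _ => by
    rw [hχ, iteratedFDeriv_comp_const_smul _ bump.contDiff, norm_smul, norm_pow, norm_inv,
      Real.norm_of_nonneg hσ0.le]
    have h1 := hC k hk (σ⁻¹ • x) (mem_univ _)
    have h2 : σ⁻¹ ^ k ≤ max 1 σ⁻¹ ^ n :=
      (pow_le_pow_left₀ (by positivity) (le_max_right _ _) k).trans
        (pow_le_pow_right₀ (le_max_left _ _) hk)
    gcongr
  have hχ1 : ∀ z, |χ z| ≤ 1 := fun z => by
    rw [abs_of_nonneg bump.nonneg]; exact bump.le_one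
  have hχd : ∀ z, ‖fderiv ℝ χ z‖ ≤ σ⁻¹ * C := fun z => by
    rw [← norm_iteratedFDeriv_one', hχ, iteratedFDeriv_comp_const_smul _ bump.contDiff, norm_smul,
      pow_one, norm_inv, Real.norm_of_nonneg hσ0.le]
    have h1 := hC 1 (by omega) (σ⁻¹ • z) (mem_univ _)
    gcongr
  have hχone : ∀ z ∈ Metric.closedBall (0 : Plane) σ, χ z = 1 := fun z hz => by
    refine bump.one_of_mem_closedBall ?_
    rw [mem_closedBall_zero_iff] at hz ⊢
    rw [norm_smul, norm_inv, Real.norm_of_nonneg hσ0.le, inv_mul_le_iff₀ hσ0]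
    change ‖z‖ ≤ σ * 1
    linarith
  have hχzero : ∀ z, 2 * σ ≤ ‖z‖ → χ z = 0 := fun z hz => by
    refine bump.zero_of_le_dist ?_
    rw [dist_zero_right, norm_smul, norm_inv, Real.norm_of_nonneg hσ0.le, ← div_eq_inv_mul,
      le_div_iff₀ hσ0]
    exact hz
  -- Orders 0 and 1 are bounded through the second derivative, since h vanishes to first order at 0.
  set Mh := M * (1 + δ) ^ 2 with hMh
  set B : ℝ →L[ℝ] Plane →L[ℝ] Plane := ContinuousLinearMap.lsmul ℝ ℝ with hB
  set Mχ := max 1 σ⁻¹ ^ n * C with hMχ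
  have hMχ0 : 0 ≤ Mχ := by positivity
  refine ⟨σ, hσ0, by linarith, ‖B‖ * (2 ^ n * Mχ * Mh), fun h hh h0 hd hhM => ?_⟩
  have hh2 : ∀ x ∈ Metric.ball 0 δ, ‖iteratedFDeriv ℝ 2 h x‖ ≤ M := hhM 2 le_rfl hn
  have hd1 : ∀ z ∈ Metric.ball (0 : Plane) δ, ‖fderiv ℝ h z‖ ≤ M * ‖z‖ := fun z hz =>
    norm_fderiv_le_of_derivBound hn Metric.isOpen_ball (convex_ball _ _)
      (Metric.mem_ball_self hδ) hh hh2 hd hz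
  have hd0 : ∀ z ∈ Metric.ball (0 : Plane) δ, ‖h z‖ ≤ M * ‖z‖ * ‖z‖ := fun z hz =>
    norm_le_of_derivBound hn hM hh hh2 h0 hd hz
  have hhj : JetBound n Mh h (Metric.ball 0 δ) := by
    intro k hk z hz
    have hzδ : ‖z‖ ≤ 1 + δ := by
      rw [mem_ball_zero_iff] at hz; linarith
    have h1 : 1 ≤ 1 + δ := by linarith
    rcases Nat.lt_or_ge k 2 with hk2 | hk2
    · interval_cases k
      · rw [norm_iteratedFDeriv_zero]
        refine (hd0 z hz).trans ?_
        rw [hMh, pow_two, mul_assoc]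
        gcongr
      · rw [norm_iteratedFDeriv_one']
        refine (hd1 z hz).trans ?_
        rw [hMh]
        gcongr
        exact hzδ.trans (le_self_pow₀ h1 two_ne_zero)
    · refine (hhM k hk2 hk z hz).trans ?_
      rw [hMh]
      exact le_mul_of_one_le_right hM (one_le_pow₀ h1)
  have hopen : IsOpen {z : Plane | 2 * σ < ‖z‖} := isOpen_lt continuous_const continuous_norm
  have hcov : ∀ z : Plane, z ∈ Metric.ball (0 : Plane) δ ∨ z ∈ {z : Plane | 2 * σ < ‖z‖} :=
    fun z => by
      rw [mem_ball_zero_iff, mem_ofPred_eq]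
      by_contra! hcon
      linarith [hcon.1, hcon.2]
  have hout : EqOn (fun z => χ z • h z) (fun _ => 0) {z : Plane | 2 * σ < ‖z‖} := fun z hz => by
    have hz' : 2 * σ ≤ ‖z‖ := le_of_lt hz
    simp only [hχzero z hz', zero_smul]
  have hin : ContDiffOn ℝ n (fun z => χ z • h z) (Metric.ball 0 δ) := hχc.contDiffOn.smul hh
  refine ⟨fun z => χ z • h z, ?_, fun z hz => by simp only [hχone z hz, one_smul], fun z => ?_, ?_⟩
  · rw [contDiff_iff_contDiffAt]
    intro z
    rcases hcov z with hz | hz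
    · exact hin.contDiffAt (Metric.isOpen_ball.mem_nhds hz)
    · exact contDiffAt_const.congr_of_eventuallyEq
        (hout.eventuallyEq_of_mem (hopen.mem_nhds hz))
  · rcases hcov z with hz | hz
    · rcases lt_or_ge (2 * σ) ‖z‖ with hz' | hz'
      · rw [← norm_iteratedFDeriv_one', iteratedFDeriv_congr_of_eqOn hopen hout 1 hz']
        simp [hη.le]
      · have hhd : DifferentiableAt ℝ h z :=
          (hh.contDiffAt (Metric.isOpen_ball.mem_nhds hz)).differentiableAt (by
            norm_cast; omega)
        have hχdiff : DifferentiableAt ℝ χ z :=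
          (hχc.differentiable (by norm_cast; omega)).differentiableAt
        rw [fderiv_fun_smul hχdiff hhd]
        calc _ ≤ ‖χ z • fderiv ℝ h z‖ + ‖(fderiv ℝ χ z).smulRight (h z)‖ := norm_add_le _ _
          _ ≤ 1 * (M * (2 * σ)) + (σ⁻¹ * C) * (M * (2 * σ) * (2 * σ)) := by
              rw [norm_smul, ContinuousLinearMap.norm_smulRight_apply, Real.norm_eq_abs]
              gcongr
              · exact hχ1 z
              · exact (hd1 z hz).trans (by gcongr)
              · exact hχd z
              · exact (hd0 z hz).trans (by gcongr)
          _ = σ * (M * (2 + 4 * C)) := by field_simp; ring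
          _ ≤ η := hση
    · rw [← norm_iteratedFDeriv_one', iteratedFDeriv_congr_of_eqOn hopen hout 1 hz]
      simp [hη.le]
  · intro k h1 hk z _
    rcases hcov z with hz | hz
    · exact JetBound.bilinear B Metric.isOpen_ball hχc.contDiffOn hh
        (hχj.mono le_rfl le_rfl (subset_univ _)) hhj hMχ0 k hk z hz
    · rw [iteratedFDeriv_congr_of_eqOn hopen hout k hz, iteratedFDeriv_const_of_ne (by omega)]
      simp only [Pi.zero_apply, norm_zero]
      positivity

end Cutoff

/-! ### Adapted coordinates of uniform size and their invariant graphs. -/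

section Adapted

theorem norm_iteratedFDeriv_affine_le {E : Type*} [NormedAddCommGroup E] [NormedSpace ℝ E] {n : ℕ}
    {F : E → E} {Ω : Set E} (hΩ : IsOpen Ω)
    (hF : ContDiffOn ℝ n F Ω) (T U : E →L[ℝ] E) (P P' : E) {k : ℕ} (hk1 : 1 ≤ k)
    (hk : k ≤ n) {z : E} (hz : P + U z ∈ Ω) :
    ‖iteratedFDeriv ℝ k (fun z => T (F (P + U z) - P')) z‖ ≤
      ‖T‖ * ‖iteratedFDeriv ℝ k F (P + U z)‖ * ‖U‖ ^ k := by
  have hkn : ((k : ℕ) : WithTop ℕ∞) ≤ n := by exact_mod_cast hk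
  set s : Set E := (fun w => P + w) ⁻¹' Ω with hs
  have hso : IsOpen s := hΩ.preimage (continuous_const.add continuous_id)
  have hUo : IsOpen (U ⁻¹' s) := hso.preimage U.continuous
  have hzs : z ∈ U ⁻¹' s := hz
  have hG : ContDiffOn ℝ n (fun w => F (P + w)) s :=
    hF.comp (contDiff_const.add contDiff_id).contDiffOn fun w hw => hw
  have hGU : ContDiffOn ℝ n ((fun w => F (P + w)) ∘ U) (U ⁻¹' s) :=
    hG.comp U.contDiff.contDiffOn fun w hw => hw
  have e1 : (fun z => T (F (P + U z) - P')) =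
      fun z => (T ∘ ((fun w => F (P + w)) ∘ U)) z - T P' := by
    ext1 z; simp
  rw [e1, norm_iteratedFDeriv_sub_const hk1]
  have h1 := T.norm_iteratedFDeriv_comp_left (hGU.contDiffAt (hUo.mem_nhds hzs)) hkn
  refine h1.trans ?_
  rw [mul_assoc]
  gcongr
  rw [← iteratedFDerivWithin_of_isOpen k hUo hzs,
    U.iteratedFDerivWithin_comp_right hG hso.uniqueDiffOn hUo.uniqueDiffOn hzs hkn,
    iteratedFDerivWithin_of_isOpen k hso hzs, iteratedFDeriv_comp_add_left]
  refine (ContinuousMultilinearMap.norm_compContinuousLinearMap_le _ _).trans ?_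
  simp

/-- The identification of `ℝ × ℝ` with the plane. -/
def toPlane : (ℝ × ℝ) ≃L[ℝ] Plane :=
  ContinuousLinearEquiv.equivOfInverse
    ((ContinuousLinearMap.fst ℝ ℝ ℝ).smulRight !₂[(1 : ℝ), 0] +
      (ContinuousLinearMap.snd ℝ ℝ ℝ).smulRight !₂[(0 : ℝ), 1])
    ((EuclideanSpace.proj (𝕜 := ℝ) (0 : Fin 2)).prod (EuclideanSpace.proj (𝕜 := ℝ) (1 : Fin 2)))
    (fun z => by simp) (fun w => by ext i; fin_cases i <;> simp)

theorem toPlane_apply (a b : ℝ) : toPlane (a, b) = !₂[a, b] := by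
  change a • !₂[(1 : ℝ), 0] + b • !₂[(0 : ℝ), 1] = _
  ext i; fin_cases i <;> simp

theorem toPlane_symm_apply (z : Plane) : toPlane.symm z = (z 0, z 1) := rfl

theorem norm_toPlane_le : ‖(toPlane : (ℝ × ℝ) →L[ℝ] Plane)‖ ≤ 2 :=
  ContinuousLinearMap.opNorm_le_bound _ (by norm_num) fun z => by
    obtain ⟨a, b⟩ := z
    rw [ContinuousLinearEquiv.coe_coe, toPlane_apply]
    refine (norm_le_abs_add_abs _).trans ?_
    have h1 : |a| ≤ ‖(a, b)‖ := norm_fst_le (a, b)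
    have h2 : |b| ≤ ‖(a, b)‖ := norm_snd_le (a, b)
    simp only [Matrix.cons_val_zero, Matrix.cons_val_one, Matrix.cons_val_fin_one]
    linarith

theorem norm_toPlane_symm_le : ‖(toPlane.symm : Plane →L[ℝ] ℝ × ℝ)‖ ≤ 1 :=
  ContinuousLinearMap.opNorm_le_bound _ zero_le_one fun z => by
    rw [one_mul, ContinuousLinearEquiv.coe_coe, toPlane_symm_apply]
    exact max_le (abs_apply_le_norm z 0) (abs_apply_le_norm z 1)

/-- The graphs are constructed in the sup norm of ℝ × ℝ, whereas the coordinates carry the Euclidean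
norm; the passage doubles the C¹-size. -/
theorem IsPerturbation.toProd {n : ℕ} {η M : ℝ} {R : ℕ → Plane → Plane}
    (h : IsPerturbation n η M R) (hn : 1 ≤ n) :
    IsPerturbation n (2 * η) (n.factorial * M * 2 ^ n)
      (fun m w => toPlane.symm (R m (toPlane w))) := by
  have hM := h.bound_nonneg hn
  have hη := h.nonneg
  have hc : ∀ m, ContDiff ℝ n (fun w => R m (toPlane w)) := fun m =>
    (h.contDiff m).comp toPlane.contDiff
  have hd : ∀ m w, HasFDerivAt (fun w => toPlane.symm (R m (toPlane w)))
      ((toPlane.symm : Plane →L[ℝ] ℝ × ℝ).comp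
        ((fderiv ℝ (R m) (toPlane w)).comp (toPlane : (ℝ × ℝ) →L[ℝ] Plane))) w := fun m w =>
    (toPlane.symm : Plane →L[ℝ] ℝ × ℝ).hasFDerivAt.comp w
      ((h.differentiable hn m (toPlane w)).hasFDerivAt.comp w toPlane.hasFDerivAt)
  refine ⟨fun m => toPlane.symm.contDiff.comp (hc m), fun m => by simp [h.map_zero m],
    fun m => ?_, fun m w => ?_, fun m => ?_⟩
  · rw [(hd m 0).fderiv, _root_.map_zero, h.fderiv_zero]; simp
  · rw [(hd m w).fderiv]
    calc _ ≤ ‖(toPlane.symm : Plane →L[ℝ] ℝ × ℝ)‖ *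
          (‖fderiv ℝ (R m) (toPlane w)‖ * ‖(toPlane : (ℝ × ℝ) →L[ℝ] Plane)‖) :=
          (ContinuousLinearMap.opNorm_comp_le _ _).trans (by
            gcongr; exact ContinuousLinearMap.opNorm_comp_le _ _)
      _ ≤ 1 * (η * 2) := by
          gcongr
          · exact norm_toPlane_symm_le
          · exact h.small m _
          · exact norm_toPlane_le
      _ = 2 * η := by ring
  · have h1 := DerivBound.comp isOpen_univ isOpen_univ (h.contDiff m).contDiffOn
      toPlane.contDiff.contDiffOn (mapsTo_univ _ _) (h.bound m)
      (DerivBound.clm n (toPlane : (ℝ × ℝ) →L[ℝ] Plane) univ) hM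
    have h2 := DerivBound.clm_comp (toPlane.symm : Plane →L[ℝ] ℝ × ℝ) isOpen_univ
      (hc m).contDiffOn h1
    refine DerivBound.mono h2 le_rfl ?_ Subset.rfl
    calc _ ≤ 1 * (n.factorial * M * 2 ^ n) := by
          gcongr
          · exact norm_toPlane_symm_le
          · exact max_le (by norm_num) norm_toPlane_le
      _ = _ := one_mul _

/-- Linear coordinates `T n` along the orbit of `p`, a globally defined small perturbation of the
diagonal map that represents `F` near the orbit, and its invariant vertical graphs `g n`. -/
structure IsAdapted (r : ℕ) (ε lam ρ c σ τ η M : ℝ) (Ω : Set Plane) (F : Plane → Plane)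
    (p e : Plane) (T : ℕ → Plane ≃L[ℝ] Plane) (R : ℕ → Plane → Plane) (g : ℕ → ℝ → ℝ) :
    Prop where
  diagonalizing : IsDiagonalizing ε lam ρ c F p e T
  perturbation : IsPerturbation (r + 1) η M R
  mem : ∀ n z, ‖z‖ ≤ σ → F^[n] p + (T n).symm z ∈ Ω
  conj : ∀ n z, ‖z‖ ≤ σ → F (F^[n] p + (T n).symm z) =
    F^[n + 1] p + (T (n + 1)).symm (diag (rateX ε lam ρ) (rateY ε lam ρ) z + R n z)
  contDiff : ∀ n, ContDiff ℝ (r + 1 : ℕ) (g n)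
  map_zero : ∀ n, g n 0 = 0
  deriv_zero : ∀ n, deriv (g n) 0 = 0
  lipschitz : ∀ n y y', |g n y - g n y'| ≤ τ * |y - y'|
  bound : ∀ n, DerivBound (r + 1) M (g n) univ
  invariant : ∀ n y, rateX ε lam ρ * g n y + R n !₂[g n y, y] 0 =
    g (n + 1) (rateY ε lam ρ * y + R n !₂[g n y, y] 1)

/-- The linear part of `F` in the coordinates `T n` is exactly diagonal, so only derivatives of
order at least 2 need a uniform bound. The cutoff and the graph construction then apply with
constants that depend neither on the orbit nor on `n`. -/
theorem exists_isAdapted {r : ℕ} (hr : 1 ≤ r) {L ε lam ρ A B A' δ : ℝ} (hrb : RateBounds ε lam ρ)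
    (hL : 1 ≤ L) (hδ : 0 < δ) (hA : 0 < A) (hB : 0 < B) (hA' : 0 < A') {τ η : ℝ} (hτ : 0 < τ)
    (hη : 0 < η) :
    ∃ c σ M : ℝ, 1 ≤ c ∧ 0 < σ ∧ 0 ≤ M ∧
      ∀ (Ω : Set Plane) (F : Plane → Plane) (p e : Plane),
        IsRegularOrbit r L ε lam ρ A B A' δ Ω F p e →
        ∃ T R g, IsAdapted r ε lam ρ c σ τ η M Ω F p e T R g := by
  obtain ⟨c, hc1, hT⟩ := exists_isDiagonalizing hrb hL hA hA' r B δ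
  obtain ⟨η₀, hη₀, hgraph⟩ := exists_invariant_graphs (n := r + 1) (by omega) hrb.rateY_pos
    hrb.rateY_lt_rateX hrb.rateY_lt_one hτ
  set η₁ := min η (η₀ / 2) with hη₁
  have hη₁0 : 0 < η₁ := by positivity
  have hc0 : 0 < c := by linarith
  -- A derivative of order k ≥ 2 is at most ‖T (n+1)‖ ‖(T n)⁻¹‖^k B ≤ c · c^{k-2} · B. The inverse
  -- coordinates map the disc of radius δ/c into the ball of radius δ, which lies in Ω.
  obtain ⟨σ, hσ, hσδ, M₁, hcut⟩ := exists_cutoff (n := r + 1) (by omega)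
    (M := c * c ^ (r + 1) * B) (δ := δ / c) (by positivity) (by positivity) hη₁0
  obtain ⟨M₂, hM₂⟩ := hgraph (2 * η₁) (by
    have := min_le_right η (η₀ / 2)
    rw [← hη₁] at this; linarith) ((r + 1).factorial * M₁ * 2 ^ (r + 1))
  refine ⟨c, σ, max (max M₁ M₂) 0, hc1, hσ, le_max_right _ _, fun Ω F p e h => ?_⟩
  obtain ⟨T, hTd⟩ := hT Ω F p e h
  set D := diag (rateX ε lam ρ) (rateY ε lam ρ) with hD
  have hmem : ∀ n z, ‖z‖ < δ / c → F^[n] p + (T n).symm z ∈ Ω := fun n z hz => by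
    refine h.ball_subset n ?_
    rw [Metric.mem_ball, dist_eq_norm, add_sub_cancel_left]
    calc ‖(T n).symm z‖ ≤ ‖((T n).symm : Plane →L[ℝ] Plane)‖ * ‖z‖ :=
          ((T n).symm : Plane →L[ℝ] Plane).le_opNorm z
      _ ≤ c * ‖z‖ := by gcongr; exact hTd.norm_symm_le_const n
      _ < δ := by rw [lt_div_iff₀ hc0] at hz; linarith
  have hR : ∀ n, ∃ R : Plane → Plane, ContDiff ℝ (r + 1 : ℕ) R ∧
      (∀ z ∈ Metric.closedBall 0 σ,
        R z = T (n + 1) (F (F^[n] p + (T n).symm z) - F^[n + 1] p) - D z) ∧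
      (∀ z, ‖fderiv ℝ R z‖ ≤ η₁) ∧ DerivBound (r + 1) M₁ R univ ∧ R 0 = 0 ∧
      fderiv ℝ R 0 = 0 := by
    intro n
    set f : Plane → Plane := fun z => T (n + 1) (F (F^[n] p + (T n).symm z) - F^[n + 1] p) with hf
    have hfc : ContDiffOn ℝ (r + 1 : ℕ) f (Metric.ball 0 (δ / c)) := by
      refine (T (n + 1)).contDiff.comp_contDiffOn (ContDiffOn.sub ?_ contDiffOn_const)
      refine h.diffeo.contDiffOn.comp
        (contDiff_const.add (T n).symm.contDiff).contDiffOn fun z hz => ?_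
      exact hmem n z (mem_ball_zero_iff.1 hz)
    have h0 : f 0 - D 0 = 0 := by
      simp only [hf, map_zero, add_zero, sub_zero]
      rw [Function.iterate_succ_apply', sub_self, map_zero]
    have hball0 : (0 : Plane) ∈ Metric.ball (0 : Plane) (δ / c) :=
      Metric.mem_ball_self (by positivity)
    have hfd : HasFDerivAt f D 0 := by
      have h1 : HasFDerivAt (fun z => F^[n] p + (T n).symm z)
          ((T n).symm : Plane →L[ℝ] Plane) 0 := ((T n).symm.hasFDerivAt).const_add _
      have h2 : HasFDerivAt F (fderiv ℝ F (F^[n] p)) (F^[n] p + (T n).symm 0) := by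
        rw [map_zero, add_zero]
        exact (h.diffeo.differentiableAt (h.diffeo.iterate_mem n h.mem)).hasFDerivAt
      have h3 := (T (n + 1)).hasFDerivAt.comp (0 : Plane) ((h2.comp 0 h1).sub_const (F^[n + 1] p))
      refine h3.congr_fderiv ?_
      ext1 z
      change T (n + 1) (fderiv ℝ F (F^[n] p) ((T n).symm z)) = D z
      rw [hTd.conj n z, ContinuousLinearEquiv.apply_symm_apply]
    have hd0 : fderiv ℝ (fun z => f z - D z) 0 = 0 := by
      have := (hfd.sub D.hasFDerivAt).fderiv
      rw [sub_self] at this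
      exact this
    obtain ⟨R, hRc, hRe, hRs, hRb⟩ := hcut (fun z => f z - D z) (hfc.sub D.contDiff.contDiffOn) h0
      hd0 (fun k hk2 hk z hz => by
        have hkn : ((k : ℕ) : WithTop ℕ∞) ≤ (r + 1 : ℕ) := by exact_mod_cast hk
        have e1 : iteratedFDeriv ℝ k (fun z => f z - D z) z = iteratedFDeriv ℝ k f z := by
          have hca := (hfc.contDiffAt (Metric.isOpen_ball.mem_nhds hz)).of_le hkn
          obtain ⟨j, rfl⟩ := Nat.exists_eq_add_of_le' hk2
          have : (fun z => f z - D z) = fun z => f z + (-D) z := by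
            ext1 z; simp [sub_eq_add_neg]
          rw [this, show (fun z => f z + (-D) z) = f + ⇑(-D) from rfl,
            iteratedFDeriv_add_apply hca (-D).contDiff.contDiffAt, iteratedFDeriv_two_clm, add_zero]
        rw [e1]
        have hzΩ := hmem n z (mem_ball_zero_iff.1 hz)
        refine (norm_iteratedFDeriv_affine_le h.diffeo.isOpen h.diffeo.contDiffOn
          (T (n + 1) : Plane →L[ℝ] Plane) ((T n).symm : Plane →L[ℝ] Plane) (F^[n] p)
          (F^[n + 1] p) (by omega : 1 ≤ k) hk hzΩ).trans ?_
        obtain ⟨j, rfl⟩ := Nat.exists_eq_add_of_le' hk2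
        have hB' := h.diffeo.norm_deriv_le _ hzΩ (j + 2) (by omega) hk
        have h1 := hTd.norm_mul_sq_le n
        have h2 := hTd.norm_symm_le_const n
        set t := ‖(T (n + 1) : Plane →L[ℝ] Plane)‖
        set u := ‖((T n).symm : Plane →L[ℝ] Plane)‖
        have hu0 : 0 ≤ u := norm_nonneg _
        have ht0 : 0 ≤ t := norm_nonneg _
        calc _ ≤ t * B * u ^ (j + 2) := by gcongr; exact hB'
          _ = (t * u ^ 2) * u ^ j * B := by ring
          _ ≤ c * c ^ j * B := by gcongr
          _ ≤ c * c ^ (r + 1) * B := by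
              gcongr
              omega)
    have hev : R =ᶠ[𝓝 0] fun z => f z - D z := by
      filter_upwards [Metric.closedBall_mem_nhds (0 : Plane) hσ] with z hz using hRe z hz
    exact ⟨R, hRc, hRe, hRs, hRb, by rw [hRe 0 (Metric.mem_closedBall_self hσ.le), h0],
      by rw [hev.fderiv_eq, hd0]⟩
  choose R hRc hRe hRs hRb hR0 hRd using hR
  have hpert : IsPerturbation (r + 1) η₁ M₁ R := ⟨hRc, hR0, hRd, hRs, hRb⟩
  obtain ⟨g, hg1, hg2, hg3, hg4, hg5, hg6⟩ := hM₂ _ (hpert.toProd (by omega))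
  refine ⟨T, R, g, hTd, ⟨hRc, hR0, hRd, fun m z => (hRs m z).trans (min_le_left _ _),
    fun m => (hRb m).mono le_rfl ((le_max_left _ _).trans (le_max_left _ _)) Subset.rfl⟩,
    fun n z hz => hmem n z (hz.trans_lt hσδ), fun n z hz => ?_, hg1, hg2, hg3, hg4,
    fun m => (hg5 m).mono le_rfl ((le_max_right _ _).trans (le_max_left _ _)) Subset.rfl,
    fun n y => ?_⟩
  · rw [hRe n z (mem_closedBall_zero_iff.2 hz), add_sub_cancel,
      ContinuousLinearEquiv.symm_apply_apply, add_sub_cancel]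
  · have := hg6 n y
    rw [toPlane_apply, toPlane_symm_apply] at this
    exact this

end Adapted

/-! ### Shears straightening a graph. -/

section Shear

/-- The shear `(x, y) ↦ (x + g(y), y)`. -/
def shear (g : ℝ → ℝ) (z : Plane) : Plane := z + g (z 1) • !₂[(1 : ℝ), 0]

theorem shear_apply_zero (g : ℝ → ℝ) (z : Plane) : shear g z 0 = z 0 + g (z 1) := by
  simp [shear]

theorem shear_apply_one (g : ℝ → ℝ) (z : Plane) : shear g z 1 = z 1 := by simp [shear]

theorem plane_ext {z w : Plane} (h0 : z 0 = w 0) (h1 : z 1 = w 1) : z = w := by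
  ext i; fin_cases i
  · exact h0
  · exact h1

theorem shear_neg_shear (g : ℝ → ℝ) (z : Plane) : shear (-g) (shear g z) = z :=
  plane_ext (by simp [shear_apply_zero, shear_apply_one]) (by simp [shear_apply_one])

theorem shear_shear_neg (g : ℝ → ℝ) (z : Plane) : shear g (shear (-g) z) = z :=
  plane_ext (by simp [shear_apply_zero, shear_apply_one]) (by simp [shear_apply_one])

theorem norm_e₀ : ‖(!₂[(1 : ℝ), 0] : Plane)‖ = 1 := by
  have := norm_sq_plane !₂[(1 : ℝ), 0]
  simp only [Matrix.cons_val_zero, Matrix.cons_val_one] at this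
  have h0 := norm_nonneg (!₂[(1 : ℝ), 0] : Plane)
  nlinarith

theorem shear_eq (g : ℝ → ℝ) : shear g = fun z => (ContinuousLinearMap.id ℝ Plane) z +
    (((ContinuousLinearMap.id ℝ ℝ).smulRight (!₂[(1 : ℝ), 0] : Plane)) ∘
      (g ∘ (EuclideanSpace.proj (𝕜 := ℝ) (1 : Fin 2) : Plane →L[ℝ] ℝ))) z := rfl

theorem norm_proj_le (i : Fin 2) :
    ‖(EuclideanSpace.proj (𝕜 := ℝ) i : Plane →L[ℝ] ℝ)‖ ≤ 1 :=
  ContinuousLinearMap.opNorm_le_bound _ zero_le_one fun z => by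
    rw [one_mul]; exact abs_apply_le_norm z i

theorem contDiff_shear {n : ℕ} {g : ℝ → ℝ} (hg : ContDiff ℝ n g) : ContDiff ℝ n (shear g) := by
  rw [shear_eq]
  exact (ContinuousLinearMap.contDiff _).add ((ContinuousLinearMap.contDiff _).comp
    (hg.comp (ContinuousLinearMap.contDiff _)))

theorem derivBound_shear {n : ℕ} {M : ℝ} {g : ℝ → ℝ} (hg : ContDiff ℝ n g)
    (hM : DerivBound n M g univ) (hM0 : 0 ≤ M) :
    DerivBound n (1 + n.factorial * M) (shear g) univ := by
  set π := (EuclideanSpace.proj (𝕜 := ℝ) (1 : Fin 2) : Plane →L[ℝ] ℝ)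
  set S := (ContinuousLinearMap.id ℝ ℝ).smulRight (!₂[(1 : ℝ), 0] : Plane)
  have hS : ‖S‖ ≤ 1 := by
    rw [ContinuousLinearMap.norm_smulRight_apply, norm_e₀, mul_one]
    exact ContinuousLinearMap.norm_id_le
  have hgc : ContDiff ℝ n (g ∘ π) := hg.comp π.contDiff
  have h1 := DerivBound.comp isOpen_univ isOpen_univ hg.contDiffOn π.contDiff.contDiffOn
    (mapsTo_univ _ _) hM (DerivBound.clm n π univ) hM0
  have h2 := DerivBound.clm_comp S isOpen_univ hgc.contDiffOn h1
  have h3 := DerivBound.add isOpen_univ (ContinuousLinearMap.contDiff _).contDiffOn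
    (S.contDiff.comp hgc).contDiffOn (DerivBound.clm n (ContinuousLinearMap.id ℝ Plane) univ) h2
  rw [shear_eq]
  refine DerivBound.mono h3 le_rfl ?_ Subset.rfl
  refine add_le_add ContinuousLinearMap.norm_id_le ?_
  calc _ ≤ 1 * (n.factorial * M * 1 ^ n) := by
        gcongr
        exact max_le le_rfl (norm_proj_le 1)
    _ = _ := by rw [one_pow, one_mul, mul_one]

theorem hasFDerivAt_shear {g : ℝ → ℝ} (hg : Differentiable ℝ g) (z : Plane) :
    HasFDerivAt (shear g) (ContinuousLinearMap.id ℝ Plane + deriv g (z 1) •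
      (EuclideanSpace.proj (𝕜 := ℝ) (1 : Fin 2) : Plane →L[ℝ] ℝ).smulRight
        (!₂[(1 : ℝ), 0] : Plane)) z := by
  have h1 : HasFDerivAt (fun z : Plane => g (z 1)) (deriv g (z 1) •
      (EuclideanSpace.proj (𝕜 := ℝ) (1 : Fin 2) : Plane →L[ℝ] ℝ)) z :=
    (hg (z 1)).hasDerivAt.comp_hasFDerivAt z
      (EuclideanSpace.proj (𝕜 := ℝ) (1 : Fin 2) : Plane →L[ℝ] ℝ).hasFDerivAt
  refine ((hasFDerivAt_id z).add (h1.smul_const (!₂[(1 : ℝ), 0] : Plane))).congr_fderiv ?_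
  ext v : 1
  simp [smul_smul]

theorem norm_fderiv_shear_sub_le {g : ℝ → ℝ} {τ : ℝ} (hg : Differentiable ℝ g)
    (hτ : ∀ y y', |g y - g y'| ≤ τ * |y - y'|) (z : Plane) :
    ‖fderiv ℝ (shear g) z - ContinuousLinearMap.id ℝ Plane‖ ≤ τ := by
  have hτ0 : 0 ≤ τ := by simpa using (abs_nonneg _).trans (hτ 1 0)
  have hd : ‖deriv g (z 1)‖ ≤ τ := by
    have h1 : LipschitzWith ⟨τ, hτ0⟩ g := LipschitzWith.of_dist_le_mul fun a b => by
      rw [Real.dist_eq, Real.dist_eq]; exact hτ a b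
    exact norm_deriv_le_of_lipschitz h1
  rw [(hasFDerivAt_shear hg z).fderiv, add_sub_cancel_left, norm_smul,
    ContinuousLinearMap.norm_smulRight_apply, norm_e₀, mul_one]
  calc _ ≤ τ * 1 := by gcongr; exact norm_proj_le 1
    _ = τ := mul_one τ

/-- The shear as a homeomorphism. -/
def shearHomeo (g : ℝ → ℝ) (hg : Continuous g) : Plane ≃ₜ Plane where
  toFun := shear (-g)
  invFun := shear g
  left_inv := shear_shear_neg g
  right_inv := shear_neg_shear g
  continuous_toFun := by
    have h1 : Continuous fun z : Plane => z 1 := (EuclideanSpace.proj (𝕜 := ℝ) (1 : Fin 2)).continuous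
    exact continuous_id.add (((hg.neg).comp h1).smul continuous_const)
  continuous_invFun := by
    have h1 : Continuous fun z : Plane => z 1 := (EuclideanSpace.proj (𝕜 := ℝ) (1 : Fin 2)).continuous
    exact continuous_id.add ((hg.comp h1).smul continuous_const)

end Shear

/-! ### Global invertibility of perturbed diagonal maps. -/

section Diffeo

theorem le_norm_diag {a b : ℝ} (hb : 0 ≤ b) (hab : b ≤ a) (z : Plane) :
    b * ‖z‖ ≤ ‖diag a b z‖ := by
  refine abs_le_of_sq_le_sq' ?_ (norm_nonneg _) |>.2
  rw [mul_pow, norm_sq_plane, norm_sq_plane, diag_apply_zero, diag_apply_one, mul_pow, mul_pow]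
  have : b ^ 2 ≤ a ^ 2 := pow_le_pow_left₀ hb hab 2
  nlinarith [mul_le_mul_of_nonneg_right this (sq_nonneg (z 0))]

theorem exists_equiv_of_le_norm {T : Plane →L[ℝ] Plane} {c : ℝ} (hc : 0 < c)
    (h : ∀ v, c * ‖v‖ ≤ ‖T v‖) : ∃ S : Plane ≃L[ℝ] Plane, (S : Plane →L[ℝ] Plane) = T := by
  have hinj : Function.Injective (T : Plane →ₗ[ℝ] Plane) := by
    rw [injective_iff_map_eq_zero]
    intro v hv
    have h1 := h v
    have hv' : T v = 0 := hv
    rw [hv', norm_zero] at h1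
    have := norm_nonneg v
    exact norm_eq_zero.1 (by nlinarith)
  exact ⟨(LinearEquiv.ofInjectiveEndo (T : Plane →ₗ[ℝ] Plane) hinj).toContinuousLinearEquiv, by
    ext v : 1; rfl⟩

theorem exists_inverse_diag_add {n : ℕ} (hn : 1 ≤ n) {a b η M : ℝ} (hb : 0 < b) (hab : b ≤ a)
    {R : ℕ → Plane → Plane} (hR : IsPerturbation n η M R) (hη : η < b) (m : ℕ) :
    ∃ H : Plane → Plane, ContDiff ℝ n H ∧ Function.LeftInverse H (fun z => diag a b z + R m z) ∧
      Function.RightInverse H (fun z => diag a b z + R m z) := by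
  obtain ⟨S, hS⟩ := exists_equiv_of_le_norm hb (le_norm_diag hb.le hab)
  have happ : ApproximatesLinearOn (fun z => diag a b z + R m z)
      (S : Plane →L[ℝ] Plane) univ ⟨η, hR.nonneg⟩ := by
    intro x _ y _
    rw [hS]
    change ‖diag a b x + R m x - (diag a b y + R m y) - diag a b (x - y)‖ ≤ η * ‖x - y‖
    rw [map_sub, show diag a b x + R m x - (diag a b y + R m y) - (diag a b x - diag a b y) =
      R m x - R m y by abel]
    exact hR.norm_sub_le hn m x y
  have hSn : ‖(S.symm : Plane →L[ℝ] Plane)‖ ≤ b⁻¹ :=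
    ContinuousLinearMap.opNorm_le_bound _ (by positivity) fun z => by
      have := le_norm_diag hb.le hab (S.symm z)
      rw [← hS, ContinuousLinearEquiv.coe_coe, ContinuousLinearEquiv.apply_symm_apply] at this
      rw [inv_mul_eq_div, le_div_iff₀ hb, ContinuousLinearEquiv.coe_coe]
      linarith
  have hSpos : 0 < ‖(S.symm : Plane →L[ℝ] Plane)‖ := S.norm_symm_pos
  have hlt : (⟨η, hR.nonneg⟩ : NNReal) < ‖(S.symm : Plane →L[ℝ] Plane)‖₊⁻¹ := by
    have : η < ‖(S.symm : Plane →L[ℝ] Plane)‖⁻¹ := by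
      refine hη.trans_le ?_
      rw [le_inv_comm₀ hb hSpos]
      exact hSn
    exact this
  let N : Plane ≃ₜ Plane := happ.toHomeomorph _ (Or.inr hlt)
  have hN : ∀ z, N z = diag a b z + R m z := fun z => rfl
  have hd : ∀ z, HasFDerivAt N (diag a b + fderiv ℝ (R m) z) z := fun z =>
    (diag a b).hasFDerivAt.add (hR.differentiable hn m z).hasFDerivAt
  have hequiv : ∀ z, ∃ S : Plane ≃L[ℝ] Plane,
      (S : Plane →L[ℝ] Plane) = diag a b + fderiv ℝ (R m) z := fun z =>
    exists_equiv_of_le_norm (sub_pos.2 hη) fun v => by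
      have h1 := le_norm_diag hb.le hab v
      have h2 : ‖fderiv ℝ (R m) z v‖ ≤ η * ‖v‖ :=
        ((fderiv ℝ (R m) z).le_opNorm v).trans (by gcongr; exact hR.small m z)
      have h3 := norm_sub_le_norm_add (diag a b v) (fderiv ℝ (R m) z v)
      rw [add_apply]
      linarith
  choose S' hS' using hequiv
  refine ⟨N.symm, N.contDiff_symm (f₀' := S') (fun z => by rw [hS']; exact hd z)
    ((diag a b).contDiff.add (hR.contDiff m)), fun z => N.symm_apply_apply z,
    fun z => N.apply_symm_apply z⟩

end Diffeo

/-! ### Radii and distortion of regular charts. -/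

section Charts

theorem isOpen_box (l : ℝ) : IsOpen (box l) := by
  have h0 : Continuous fun z : Plane => |z 0| :=
    (EuclideanSpace.proj (𝕜 := ℝ) (0 : Fin 2)).continuous.abs
  have h1 : Continuous fun z : Plane => |z 1| :=
    (EuclideanSpace.proj (𝕜 := ℝ) (1 : Fin 2)).continuous.abs
  exact (isOpen_lt h0 continuous_const).inter (isOpen_lt h1 continuous_const)

variable {L ε lam ρ A A' : ℝ}

theorem coneOpening_nonneg (hrb : RateBounds ε lam ρ) (hA : 0 < A) (hA' : 0 < A') :
    0 ≤ coneOpening ε ρ A A' := by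
  have h1 : 0 < ρ ^ (1 - ε) := Real.rpow_pos_of_pos hrb.rho_mem.1 _
  have h2 : ρ ^ (1 - ε) < 1 :=
    Real.rpow_lt_one hrb.rho_mem.1.le hrb.rho_mem.2 (by linarith [hrb.eps_mem.2])
  have h3 : 0 < 1 - ρ ^ (1 - ε) := by linarith
  rw [coneOpening]
  positivity

theorem distortion_zero_pos (hrb : RateBounds ε lam ρ) (hL : 1 ≤ L) (hA : 0 < A) (hA' : 0 < A') :
    0 < distortion L ε lam ρ A A' 0 := by
  have h1 := coneOpening_nonneg hrb hA hA'
  have h2 := hrb.rho_mem.1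
  have h3 := hrb.lam_mem.1
  rw [distortion]
  positivity

theorem distortion_eq (hrb : RateBounds ε lam ρ) (n : ℕ) :
    distortion L ε lam ρ A A' n = distortion L ε lam ρ A A' 0 * (slow ε lam ρ ^ n)⁻¹ := by
  rw [distortion, distortion, slow, Real.rpow_mul_natCast hrb.rho_mem.1.le,
    Real.rpow_mul_natCast hrb.lam_mem.1.le, mul_pow]
  simp [div_eq_mul_inv]

theorem distortion_pos (hrb : RateBounds ε lam ρ) (hL : 1 ≤ L) (hA : 0 < A) (hA' : 0 < A')
    (n : ℕ) : 0 < distortion L ε lam ρ A A' n := by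
  have := distortion_zero_pos hrb hL hA hA'
  have := hrb.slow_pos
  rw [distortion_eq hrb]
  positivity

theorem regularRadius_eq (hrb : RateBounds ε lam ρ) (C : ℝ) (n : ℕ) :
    regularRadius L ε lam ρ A A' C n =
      regularRadius L ε lam ρ A A' C 0 * slow ε lam ρ ^ n := by
  rw [regularRadius, regularRadius, distortion_eq hrb n, ← mul_assoc, ← div_div, div_inv_eq_mul]

theorem regularRadius_pos (hrb : RateBounds ε lam ρ) (hL : 1 ≤ L) (hA : 0 < A) (hA' : 0 < A')
    {C : ℝ} (hC : 1 ≤ C) (n : ℕ) : 0 < regularRadius L ε lam ρ A A' C n := by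
  have h1 := distortion_pos hrb hL hA hA' n
  have h2 := hrb.lamCheck_pos
  rw [regularRadius]
  positivity

theorem regularRadius_le (hrb : RateBounds ε lam ρ) (hL : 1 ≤ L) (hA : 0 < A) (hA' : 0 < A')
    {C : ℝ} (hC : 1 ≤ C) (n : ℕ) : regularRadius L ε lam ρ A A' C n ≤
      regularRadius L ε lam ρ A A' C 0 := by
  rw [regularRadius_eq hrb]
  exact mul_le_of_le_one_right (regularRadius_pos hrb hL hA hA' hC 0).le
    (pow_le_one₀ hrb.slow_pos.le hrb.slow_lt_one.le)

end Charts

/-! ### Construction of regular charts. -/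

section ChartSystem

/-- The homeomorphism `q ↦ S (T (q - P))`, where `S` is the shear straightening the graph of `g`. -/
def straighten (P : Plane) (T : Plane ≃L[ℝ] Plane) (g : ℝ → ℝ) (hg : Continuous g) :
    Plane ≃ₜ Plane :=
  (Homeomorph.subRight P).trans (T.toHomeomorph.trans (shearHomeo g hg))

/-- The restriction of `straighten` to the preimage of the square of radius `l`. -/
def straightChart (P : Plane) (T : Plane ≃L[ℝ] Plane) (g : ℝ → ℝ) (hg : Continuous g) (l : ℝ) :
    OpenPartialHomeomorph Plane Plane :=
  (straighten P T g hg).toOpenPartialHomeomorphOfImageEq (straighten P T g hg ⁻¹' box l)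
    ((isOpen_box l).preimage (straighten P T g hg).continuous) (box l)
    (image_preimage_eq _ (straighten P T g hg).surjective)

section

variable {P : Plane} {T : Plane ≃L[ℝ] Plane} {g : ℝ → ℝ} {hg : Continuous g} {l : ℝ}

theorem straightChart_apply (q : Plane) : straightChart P T g hg l q = shear (-g) (T (q - P)) := rfl

theorem mem_straightChart_source {q : Plane} :
    q ∈ (straightChart P T g hg l).source ↔ shear (-g) (T (q - P)) ∈ box l := Iff.rfl

theorem shear_zero (h0 : g 0 = 0) : shear g 0 = 0 := by simp [shear, h0]

theorem norm_shear_le {τ : ℝ} (hτ : τ ≤ 1) (h0 : g 0 = 0)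
    (hl : ∀ y y', |g y - g y'| ≤ τ * |y - y'|) (z : Plane) :
    ‖shear g z‖ ≤ |z 0| + 2 * |z 1| := by
  refine (norm_le_abs_add_abs _).trans ?_
  rw [shear_apply_zero, shear_apply_one]
  have h1 := hl (z 1) 0
  rw [h0, sub_zero, sub_zero] at h1
  have h2 := abs_add_le (z 0) (g (z 1))
  nlinarith [abs_nonneg (z 1)]

theorem fderiv_shear_zero (hg : Differentiable ℝ g) (h0 : deriv g 0 = 0) :
    fderiv ℝ (shear g) 0 = ContinuousLinearMap.id ℝ Plane := by
  rw [(hasFDerivAt_shear hg 0).fderiv]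
  simp [h0]

theorem norm_comp_comp_sub_le {A₁ A₂ D R : Plane →L[ℝ] Plane} {t : ℝ} (ht : t ≤ 1)
    (h₁ : ‖A₁ - ContinuousLinearMap.id ℝ Plane‖ ≤ t)
    (h₂ : ‖A₂ - ContinuousLinearMap.id ℝ Plane‖ ≤ t) (hR : ‖R‖ ≤ t) :
    ‖A₂.comp ((D + R).comp A₁) - D‖ ≤ t * (3 * ‖D‖ + 4) := by
  have ht0 : 0 ≤ t := (norm_nonneg _).trans hR
  set I := ContinuousLinearMap.id ℝ Plane
  have e : A₂.comp ((D + R).comp A₁) - D =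
      (A₂ - I).comp ((D + R).comp A₁) + (R.comp A₁ + D.comp (A₁ - I)) := by
    ext v : 1
    simp [I]
    abel
  have hA₁ : ‖A₁‖ ≤ 2 := by
    calc ‖A₁‖ = ‖(A₁ - I) + I‖ := by rw [sub_add_cancel]
      _ ≤ ‖A₁ - I‖ + ‖I‖ := norm_add_le _ _
      _ ≤ t + 1 := add_le_add h₁ ContinuousLinearMap.norm_id_le
      _ ≤ 2 := by linarith
  have hDR : ‖D + R‖ ≤ ‖D‖ + 1 := (norm_add_le _ _).trans (by linarith)
  rw [e]
  calc _ ≤ ‖A₂ - I‖ * (‖D + R‖ * ‖A₁‖) + (‖R‖ * ‖A₁‖ + ‖D‖ * ‖A₁ - I‖) := by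
        refine (norm_add_le _ _).trans (add_le_add ?_ ((norm_add_le _ _).trans (add_le_add
          (ContinuousLinearMap.opNorm_comp_le _ _) (ContinuousLinearMap.opNorm_comp_le _ _))))
        exact (ContinuousLinearMap.opNorm_comp_le _ _).trans
          (by gcongr; exact ContinuousLinearMap.opNorm_comp_le _ _)
    _ ≤ t * ((‖D‖ + 1) * 2) + (t * 2 + ‖D‖ * t) := by gcongr
    _ = _ := by ring

end

variable {r : ℕ} {L ε lam ρ A B A' δ c σ τ η M C : ℝ} {Ω : Set Plane} {F : Plane → Plane}
  {p e : Plane} {T : ℕ → Plane ≃L[ℝ] Plane} {R : ℕ → Plane → Plane} {g : ℕ → ℝ → ℝ}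

/-- The expression of `F` in straightened adapted coordinates. -/
def straightMap (ε lam ρ : ℝ) (R : ℕ → Plane → Plane) (g : ℕ → ℝ → ℝ) (n : ℕ) : Plane → Plane :=
  shear (-g (n + 1)) ∘ ((fun w => diag (rateX ε lam ρ) (rateY ε lam ρ) w + R n w) ∘ shear (g n))

/-- A bound for the derivatives of `straightMap`. -/
def straightMapBound (r : ℕ) (ε lam ρ M : ℝ) : ℝ :=
  r.factorial * (1 + r.factorial * M) * max 1 (r.factorial *
    (‖diag (rateX ε lam ρ) (rateY ε lam ρ)‖ + M) * max 1 (1 + r.factorial * M) ^ r) ^ r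

theorem IsAdapted.contDiff_of_le (h : IsAdapted r ε lam ρ c σ τ η M Ω F p e T R g) (n : ℕ) :
    ContDiff ℝ r (g n) := (h.contDiff n).of_le (by norm_cast; omega)

theorem IsAdapted.differentiable (h : IsAdapted r ε lam ρ c σ τ η M Ω F p e T R g) (n : ℕ) :
    Differentiable ℝ (g n) := (h.contDiff n).differentiable (by simp)

theorem derivBound_neg {n : ℕ} {M : ℝ} {f : ℝ → ℝ} {s : Set ℝ} (h : DerivBound n M f s) :
    DerivBound n M (-f) s := fun k h1 hk x hx => by
  rw [iteratedFDeriv_neg_apply, norm_neg]; exact h k h1 hk x hx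

theorem IsAdapted.derivBound_straightMap (h : IsAdapted r ε lam ρ c σ τ η M Ω F p e T R g)
    (hM : 0 ≤ M) (n : ℕ) :
    DerivBound r (straightMapBound r ε lam ρ M) (straightMap ε lam ρ R g n) univ := by
  have hb : ∀ n, DerivBound r M (g n) univ := fun n => (h.bound n).mono (by omega) le_rfl Subset.rfl
  have hR : ContDiff ℝ r (R n) := (h.perturbation.contDiff n).of_le (by norm_cast; omega)
  have h1 := derivBound_shear (h.contDiff_of_le n) (hb n) hM
  have h2 := derivBound_shear (h.contDiff_of_le (n + 1)).neg (derivBound_neg (hb (n + 1))) hM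
  have h3 := DerivBound.add isOpen_univ (diag (rateX ε lam ρ) (rateY ε lam ρ)).contDiff.contDiffOn
    hR.contDiffOn (DerivBound.clm r _ univ)
    ((h.perturbation.bound n).mono (by omega) le_rfl Subset.rfl)
  have hN : ContDiff ℝ r (fun w => diag (rateX ε lam ρ) (rateY ε lam ρ) w + R n w) :=
    (diag (rateX ε lam ρ) (rateY ε lam ρ)).contDiff.add hR
  have h4 := DerivBound.comp isOpen_univ isOpen_univ hN.contDiffOn
    (contDiff_shear (h.contDiff_of_le n)).contDiffOn (mapsTo_univ _ _) h3 h1 (by positivity)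
  exact DerivBound.comp isOpen_univ isOpen_univ
    (contDiff_shear (h.contDiff_of_le (n + 1)).neg).contDiffOn
    (hN.comp (contDiff_shear (h.contDiff_of_le n))).contDiffOn (mapsTo_univ _ _) h2 h4
    (by positivity)

theorem IsAdapted.hasFDerivAt_straightMap (h : IsAdapted r ε lam ρ c σ τ η M Ω F p e T R g)
    (n : ℕ) (z : Plane) : HasFDerivAt (straightMap ε lam ρ R g n)
      ((fderiv ℝ (shear (-g (n + 1))) (diag (rateX ε lam ρ) (rateY ε lam ρ) (shear (g n) z) +
        R n (shear (g n) z))).comp ((diag (rateX ε lam ρ) (rateY ε lam ρ) +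
        fderiv ℝ (R n) (shear (g n) z)).comp (fderiv ℝ (shear (g n)) z))) z := by
  have h1 := (hasFDerivAt_shear (h.differentiable n) z).differentiableAt.hasFDerivAt
  have h2 := (hasFDerivAt_shear (h.differentiable (n + 1)).neg
    (diag (rateX ε lam ρ) (rateY ε lam ρ) (shear (g n) z) +
        R n (shear (g n) z))).differentiableAt.hasFDerivAt
  have h3 := (diag (rateX ε lam ρ) (rateY ε lam ρ)).hasFDerivAt.add
    (h.perturbation.differentiable (by omega) n (shear (g n) z)).hasFDerivAt
  exact HasFDerivAt.comp z h2 (HasFDerivAt.comp z h3 h1)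

/-- The chart is the linear coordinate followed by the shear that straightens the invariant graph;
invariance of the graph becomes invariance of the vertical axis. Because the graph has zero slope at
0, the shear affects neither the derivative at the origin nor the vertical direction. The condition
`hCσ` puts the sheared box inside the disc on which the global map represents `F`. -/
theorem IsAdapted.isRegularChartSystem (hr : 1 ≤ r) (hrb : RateBounds ε lam ρ) (hL : 1 ≤ L)
    (hA : 0 < A) (hA' : 0 < A') (hM : 0 ≤ M) (hc : 1 ≤ c)
    (h : IsAdapted r ε lam ρ c σ τ η M Ω F p e T R g) (hτ1 : τ ≤ 1) (hητ : η ≤ τ)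
    (hηy : η < rateY ε lam ρ)
    (hτ : τ * (3 * ‖diag (rateX ε lam ρ) (rateY ε lam ρ)‖ + 4) < lamCheck ε lam)
    (hC : 1 ≤ C) (hCσ : 3 * regularRadius L ε lam ρ A A' C 0 ≤ σ)
    (hC₁ : c * (1 + r.factorial * M) ≤ C)
    (hC₂ : (1 + r.factorial * M) * max 1 (c / distortion L ε lam ρ A A' 0) ^ r ≤ C)
    (hC₃ : straightMapBound r ε lam ρ M ≤ C * B) :
    IsRegularChartSystem r L ε lam ρ A B A' C Ω F p e
      (fun n => straightChart (F^[n] p) (T n) (g n) (h.contDiff n).continuous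
        (regularRadius L ε lam ρ A A' C n)) (straightMap ε lam ρ R g) := by
  have hω := coneOpening_nonneg hrb hA hA'
  have hd0 := distortion_zero_pos hrb hL hA hA'
  have hb : ∀ n, DerivBound r M (g n) univ := fun n => (h.bound n).mono (by omega) le_rfl Subset.rfl
  have hneg0 : ∀ n, (-g n) 0 = 0 := fun n => by simp [h.map_zero n]
  have hnegd : ∀ n, deriv (-g n) 0 = 0 := fun n => by rw [deriv.neg, h.deriv_zero n, neg_zero]
  have hnegl : ∀ n y y', |(-g n) y - (-g n) y'| ≤ τ * |y - y'| := fun n y y' => by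
    rw [Pi.neg_apply, Pi.neg_apply, ← neg_sub, neg_sub_neg, abs_neg, abs_sub_comm]
    rw [abs_sub_comm (g n y')]
    exact h.lipschitz n y y'
  have hsc := fun n => contDiff_shear (h.contDiff_of_le n)
  have hscn : ∀ n, ContDiff ℝ r (shear (-g n)) := fun n =>
    contDiff_shear (h.contDiff_of_le n).neg
  have hsmall : ∀ n z, z ∈ box (regularRadius L ε lam ρ A A' C n) → ‖shear (g n) z‖ ≤ σ := by
    intro n z hz
    have h1 := norm_shear_le hτ1 (h.map_zero n) (h.lipschitz n) z
    have h2 := regularRadius_le hrb hL hA hA' hC n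
    linarith [hz.1, hz.2]
  have hD0 : ∀ n, fderiv ℝ (straightMap ε lam ρ R g n) 0 = diag (rateX ε lam ρ) (rateY ε lam ρ) := by
    intro n
    rw [(h.hasFDerivAt_straightMap n 0).fderiv, shear_zero (h.map_zero n), _root_.map_zero,
      h.perturbation.map_zero, add_zero, h.perturbation.fderiv_zero, add_zero,
      fderiv_shear_zero (h.differentiable n) (h.deriv_zero n),
      fderiv_shear_zero (h.differentiable (n + 1)).neg (hnegd (n + 1))]
    rfl
  have hrep : ∀ n q, q = F^[n] p + (T n).symm (shear (g n) (shear (-g n) (T n (q - F^[n] p)))) := by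
    intro n q
    rw [shear_shear_neg]; simp
  refine ⟨fun n q hq => ?_, fun n => rfl, fun n => ?_, fun n => ?_, fun n => ?_, fun n => ?_,
    fun n => ⟨rateY ε lam ρ ^ n, ?_⟩, fun n z _ k hk1 hk => ?_, fun n q _ k hk1 hk => ?_,
    fun n => ⟨?_, ?_⟩, fun n q hq hq' => ?_, fun n => ?_, fun n z k hk1 hk => ?_, fun n v => ?_,
    fun n z => ?_, fun n y => ?_⟩
  · rw [hrep n q]
    exact h.mem n _ (hsmall n _ hq)
  · rw [mem_straightChart_source, sub_self, _root_.map_zero, shear_zero (hneg0 n)]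
    have := regularRadius_pos hrb hL hA hA' hC n
    simpa [box] using this
  · rw [straightChart_apply, sub_self, _root_.map_zero, shear_zero (hneg0 n)]
  · exact ((hscn n).comp ((T n).contDiff.comp (contDiff_id.sub contDiff_const))).contDiffOn
  · exact (((T n).symm.contDiff.comp (hsc n)).add contDiff_const).contDiffOn
  · have h1 : HasFDerivAt (fun q => T n (q - F^[n] p)) (T n : Plane →L[ℝ] Plane) (F^[n] p) :=
      (T n : Plane →L[ℝ] Plane).hasFDerivAt.comp (F^[n] p) ((hasFDerivAt_id _).sub_const _)
    have h2 := (hasFDerivAt_shear (h.differentiable n).neg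
      (T n (F^[n] p - F^[n] p))).differentiableAt.hasFDerivAt
    have h3 := (HasFDerivAt.comp (F^[n] p) h2 h1).fderiv
    rw [sub_self, _root_.map_zero, fderiv_shear_zero (h.differentiable n).neg (hnegd n)] at h3
    change fderiv ℝ (shear (-g n) ∘ fun q => T n (q - F^[n] p)) (F^[n] p) _ = _
    rw [h3]
    exact h.diagonalizing.vertical n
  · have h1 := norm_iteratedFDeriv_affine_le isOpen_univ (hsc n).contDiffOn
      ((T n).symm : Plane →L[ℝ] Plane) (ContinuousLinearMap.id ℝ Plane) 0 (-(T n (F^[n] p))) hk1 hk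
      (z := z) (mem_univ _)
    have e1 : (fun z => ((T n).symm : Plane →L[ℝ] Plane) (shear (g n)
        (0 + ContinuousLinearMap.id ℝ Plane z) - -(T n (F^[n] p)))) =
        fun z => (T n).symm (shear (g n) z) + F^[n] p := by
      ext1 z
      simp
    rw [e1] at h1
    refine h1.trans ?_
    calc _ ≤ c * (1 + r.factorial * M) * 1 ^ k := by
          gcongr
          · exact h.diagonalizing.norm_symm_le_const n
          · exact derivBound_shear (h.contDiff_of_le n) (hb n) hM k hk1 hk _ (mem_univ _)
          · exact ContinuousLinearMap.norm_id_le
      _ ≤ C * 1 := by rw [one_pow]; linarith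
      _ ≤ _ := by gcongr; linarith
  · have h1 := norm_iteratedFDeriv_affine_le isOpen_univ (hscn n).contDiffOn
      (ContinuousLinearMap.id ℝ Plane) (T n : Plane →L[ℝ] Plane) (-(T n (F^[n] p))) 0 hk1 hk
      (z := q) (mem_univ _)
    have e1 : (fun z => ContinuousLinearMap.id ℝ Plane (shear (-g n)
        (-(T n (F^[n] p)) + (T n : Plane →L[ℝ] Plane) z) - 0)) =
        fun q => shear (-g n) (T n (q - F^[n] p)) := by
      ext1 q
      simp only [ContinuousLinearMap.coe_id', id_eq, sub_zero, ContinuousLinearEquiv.coe_coe, map_sub,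
        neg_add_eq_sub]
    rw [e1] at h1
    refine h1.trans ?_
    have hdn := distortion_pos hrb hL hA hA' n
    have hT : ‖(T n : Plane →L[ℝ] Plane)‖ ≤ max 1 (c / distortion L ε lam ρ A A' 0) *
        distortion L ε lam ρ A A' n := by
      calc _ ≤ c * (slow ε lam ρ ^ n)⁻¹ := h.diagonalizing.norm_le n
        _ = c / distortion L ε lam ρ A A' 0 * distortion L ε lam ρ A A' n := by
          rw [distortion_eq hrb n]; field_simp
        _ ≤ _ := by gcongr; exact le_max_right _ _
    calc _ ≤ 1 * (1 + r.factorial * M) * (max 1 (c / distortion L ε lam ρ A A' 0) *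
        distortion L ε lam ρ A A' n) ^ k := by
          gcongr
          · exact ContinuousLinearMap.norm_id_le
          · exact derivBound_shear (h.contDiff_of_le n).neg (derivBound_neg (hb n)) hM k hk1 hk _
              (mem_univ _)
      _ = (1 + r.factorial * M) * max 1 (c / distortion L ε lam ρ A A' 0) ^ k *
          distortion L ε lam ρ A A' n ^ k := by rw [mul_pow]; ring
      _ ≤ (1 + r.factorial * M) * max 1 (c / distortion L ε lam ρ A A' 0) ^ r *
          distortion L ε lam ρ A A' n ^ k := by
          gcongr
          exact le_max_left _ _
      _ ≤ _ := by gcongr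
  · exact (hscn (n + 1)).comp (((diag _ _).contDiff.add
      ((h.perturbation.contDiff n).of_le (by norm_cast; omega))).comp (hsc n))
  · obtain ⟨H, hH, hl, hr'⟩ := exists_inverse_diag_add (by omega) hrb.rateY_pos
      hrb.rateY_lt_rateX.le h.perturbation hηy n
    refine ⟨shear (-g n) ∘ (H ∘ shear (g (n + 1))), (hscn n).comp
      ((hH.of_le (by norm_cast; omega)).comp (hsc (n + 1))), fun z => ?_, fun z => ?_⟩
    · simp only [straightMap, Function.comp_apply, shear_shear_neg]
      rw [hl (shear (g n) z), shear_neg_shear]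
    · simp only [straightMap, Function.comp_apply, shear_shear_neg]
      have := hr' (shear (g (n + 1)) z)
      simp only at this
      rw [this, shear_neg_shear]
  · simp only [straightChart_apply, straightMap, Function.comp_apply, shear_shear_neg]
    have h1 := h.conj n _ (hsmall n (shear (-g n) (T n (q - F^[n] p))) hq)
    rw [← hrep n q] at h1
    rw [h1, shear_shear_neg, add_sub_cancel_left, ContinuousLinearEquiv.apply_symm_apply]
  · simp only [straightMap, Function.comp_apply]
    rw [shear_zero (h.map_zero n), _root_.map_zero, h.perturbation.map_zero, add_zero,
      shear_zero (hneg0 (n + 1))]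
  · exact (h.derivBound_straightMap hM n k hk1 hk z (mem_univ _)).trans hC₃
  · rw [hD0]
    exact plane_ext (by simp [rateX]) (by simp [rateY])
  · rw [hD0, (h.hasFDerivAt_straightMap n z).fderiv]
    exact (norm_comp_comp_sub_le hτ1 (norm_fderiv_shear_sub_le (h.differentiable n)
      (h.lipschitz n) z) (norm_fderiv_shear_sub_le (h.differentiable (n + 1)).neg
      (hnegl (n + 1)) _) ((h.perturbation.small n _).trans hητ)).trans_lt hτ
  · have h1 : shear (g n) !₂[0, y] = !₂[g n y, y] := plane_ext (by simp [shear]) (by simp [shear])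
    have h2 := h.invariant n y
    simp only [straightMap, Function.comp_apply, h1, shear_apply_zero, PiLp.add_apply,
      diag_apply_zero, diag_apply_one, Pi.neg_apply]
    simp only [Matrix.cons_val_zero, Matrix.cons_val_one]
    rw [h2, add_neg_cancel]

theorem exists_isRegularChartSystem (hr : 1 ≤ r) (hrb : RateBounds ε lam ρ) (hL : 1 ≤ L)
    (hδ : 0 < δ) (A B A' : ℝ) :
    ∃ C : ℝ, 1 ≤ C ∧ ∀ (Ω : Set Plane) (F : Plane → Plane) (p e : Plane),
      IsRegularOrbit r L ε lam ρ A B A' δ Ω F p e →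
      ∃ (Φ : ℕ → OpenPartialHomeomorph Plane Plane) (G : ℕ → Plane → Plane),
        IsRegularChartSystem r L ε lam ρ A B A' C Ω F p e Φ G := by
  by_cases hpos : 0 < A ∧ 0 < B ∧ 0 < A'
  swap
  -- A regular orbit forces these constants to be positive, so otherwise any `C` serves.
  · exact ⟨1, le_rfl, fun Ω F p e h => absurd h.bounds_pos hpos⟩
  obtain ⟨hA, hB, hA'⟩ := hpos
  set N := 3 * ‖diag (rateX ε lam ρ) (rateY ε lam ρ)‖ + 4 with hN
  have hN0 : 0 < N := by positivity
  have hlc := hrb.lamCheck_pos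
  have hy := hrb.rateY_pos
  set t := min (min 1 (rateY ε lam ρ / 2)) (lamCheck ε lam / (2 * N)) with ht
  have ht0 : 0 < t := by positivity
  have ht1 : t ≤ 1 := (min_le_left _ _).trans (min_le_left _ _)
  have hty : t < rateY ε lam ρ :=
    ((min_le_left _ _).trans (min_le_right _ _)).trans_lt (by linarith)
  have htN : t * N < lamCheck ε lam := by
    have h1 : t ≤ lamCheck ε lam / (2 * N) := min_le_right _ _
    rw [le_div_iff₀ (by positivity)] at h1
    nlinarith
  obtain ⟨c, σ, M, hc, hσ, hM, had⟩ := exists_isAdapted hr hrb hL hδ hA hB hA' ht0 ht0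
  have hd0 := distortion_zero_pos hrb hL hA hA'
  set C₁ := c * (1 + r.factorial * M) with hC₁
  set C₂ := (1 + r.factorial * M) * max 1 (c / distortion L ε lam ρ A A' 0) ^ r with hC₂
  set C₃ := straightMapBound r ε lam ρ M / B with hC₃
  -- The radius is proportional to 1/C, so a large `C` fits the boxes into the disc of radius σ.
  set C₄ := 3 * lamCheck ε lam / (σ * distortion L ε lam ρ A A' 0) with hC₄
  set C := max (max 1 C₁) (max C₂ (max C₃ C₄)) with hC
  have hC1 : 1 ≤ C := (le_max_left _ _).trans (le_max_left _ _)
  refine ⟨C, hC1, fun Ω F p e h => ?_⟩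
  obtain ⟨T, R, g, hT⟩ := had Ω F p e h
  refine ⟨_, _, hT.isRegularChartSystem hr hrb hL hA hA' hM hc ht1 le_rfl hty htN hC1 ?_
    ((le_max_right _ _).trans (le_max_left _ _)) ((le_max_left _ _).trans (le_max_right _ _)) ?_⟩
  · have h4 : C₄ ≤ C := (le_max_right _ _).trans ((le_max_right _ _).trans (le_max_right _ _))
    rw [hC₄, div_le_iff₀ (by positivity)] at h4
    rw [regularRadius, mul_div_assoc', div_le_iff₀ (by positivity)]
    linarith
  · have h3 : C₃ ≤ C := (le_max_left _ _).trans ((le_max_right _ _).trans (le_max_right _ _))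
    rw [hC₃, div_le_iff₀ hB] at h3
    exact h3

end ChartSystem

/-! ### Growth of sequences and the strong stable condition. -/

section Sequences

/-- Expansion gives α^k |x_m| ≤ K β^{m+k}, impossible for large k unless x_m = 0. This is what
places points on the vertical axis of a chart and on the leaves. -/
theorem eq_zero_of_expansion {x : ℕ → ℝ} {α β K : ℝ} {N : ℕ} (hβ : 0 ≤ β) (hβα : β < α)
    (h₁ : ∀ m ≥ N, α * |x m| ≤ |x (m + 1)|) (h₂ : ∀ m ≥ N, |x m| ≤ K * β ^ m) :
    ∀ m ≥ N, x m = 0 := by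
  intro m hm
  have hα : 0 < α := hβ.trans_lt hβα
  have key : ∀ k, α ^ k * |x m| ≤ |x (m + k)| := by
    intro k
    induction k with
    | zero => simp
    | succ k ih =>
      calc _ = α * (α ^ k * |x m|) := by ring
        _ ≤ α * |x (m + k)| := by gcongr
        _ ≤ _ := h₁ _ (by omega)
  have hle : ∀ k, |x m| ≤ K * β ^ m * (β / α) ^ k := by
    intro k
    have h3 := (key k).trans (h₂ (m + k) (by omega))
    have : α ^ k * |x m| ≤ α ^ k * (K * β ^ m * (β / α) ^ k) := by
      rw [div_pow]; field_simp; rw [pow_add] at h3; linarith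
    exact le_of_mul_le_mul_left this (by positivity)
  have hlim : Tendsto (fun k => K * β ^ m * (β / α) ^ k) atTop (𝓝 (K * β ^ m * 0)) :=
    (tendsto_pow_atTop_nhds_zero_of_lt_one (by positivity) ((div_lt_one hα).2 hβα)).const_mul _
  have := ge_of_tendsto' hlim hle
  rw [mul_zero] at this
  exact abs_nonpos_iff.1 this

/-- The product of the factors 1 + b θ^j converges, so the relative errors cost a constant but leave
the exponential rate at κ. -/
theorem le_of_perturbed_contraction {a : ℕ → ℝ} {κ b θ : ℝ} (hκ : 0 ≤ κ) (hb : 0 ≤ b)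
    (hθ0 : 0 ≤ θ) (hθ : θ < 1) (ha0 : ∀ k, 0 ≤ a k)
    (ha : ∀ k, a (k + 1) ≤ κ * a k * (1 + b * θ ^ k)) (k : ℕ) :
    a k ≤ κ ^ k * a 0 * Real.exp (b * (1 - θ)⁻¹) := by
  have h0 := ha0 0
  have key : ∀ k, a k ≤ κ ^ k * a 0 * Real.exp (b * ∑ j ∈ Finset.range k, θ ^ j) := by
    intro k
    induction k with
    | zero => simp
    | succ k ih =>
      calc _ ≤ κ * a k * (1 + b * θ ^ k) := ha k
        _ ≤ κ * (κ ^ k * a 0 * Real.exp (b * ∑ j ∈ Finset.range k, θ ^ j)) *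
            Real.exp (b * θ ^ k) := by
          gcongr
          linarith [Real.add_one_le_exp (b * θ ^ k)]
        _ = _ := by rw [Finset.sum_range_succ, mul_add, Real.exp_add]; ring
  refine (key k).trans ?_
  gcongr
  rw [← tsum_geometric_of_lt_one hθ0 hθ]
  exact (summable_geometric_of_lt_one hθ0 hθ).sum_le_tsum _ fun _ _ => by positivity

theorem log_edist_div_le_iff {x y : Plane} {n : ℕ} (hn : 1 ≤ n) (c : ℝ) :
    ENNReal.log (edist x y) / ((n : ℝ) : EReal) ≤ (c : EReal) ↔
      ‖x - y‖ ≤ Real.exp c ^ n := by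
  have hn0 : (0 : EReal) < ((n : ℝ) : EReal) := by exact_mod_cast hn
  have e : ((n : ℝ) : EReal) * (c : EReal) = ENNReal.log (ENNReal.ofReal (Real.exp c ^ n)) := by
    rw [ENNReal.log_ofReal_of_pos (by positivity), Real.log_pow, Real.log_exp]
    norm_cast
  rw [EReal.div_le_iff_le_mul hn0 (EReal.coe_ne_top _), e, ENNReal.log_le_log_iff, edist_dist,
    ENNReal.ofReal_le_ofReal_iff (by positivity), dist_eq_norm]

/-- The constant `K` is absorbed by any rate strictly larger than λ^{1-ε}, and the upper limit only
sees the infimum of such rates. -/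
theorem mem_strongStable_of_le {ε lam : ℝ} {Ω : Set Plane} {F : Plane → Plane} {p q : Plane}
    (hlam : 0 < lam) (hq : q ∈ Ω) {K : ℝ} {N : ℕ}
    (h : ∀ m ≥ N, ‖F^[m] q - F^[m] p‖ ≤ K * (lam ^ (1 - ε)) ^ m) :
    q ∈ strongStable ε lam Ω F p := by
  refine ⟨hq, ?_⟩
  refine EReal.le_of_forall_lt_iff_le.1 fun c hc => ?_
  have hc' : (1 - ε) * Real.log lam < c := by exact_mod_cast hc
  have hb0 : 0 < lam ^ (1 - ε) := Real.rpow_pos_of_pos hlam _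
  have hlt : lam ^ (1 - ε) < Real.exp c := by
    rw [Real.rpow_def_of_pos hlam, Real.exp_lt_exp]; linarith
  have hlim : Tendsto (fun m : ℕ => K * (lam ^ (1 - ε) / Real.exp c) ^ m) atTop (𝓝 (K * 0)) :=
    (tendsto_pow_atTop_nhds_zero_of_lt_one (by positivity)
      ((div_lt_one (Real.exp_pos c)).2 hlt)).const_mul _
  rw [mul_zero] at hlim
  refine limsup_le_of_le (by isBoundedDefault) ?_
  filter_upwards [hlim.eventually (gt_mem_nhds one_pos), eventually_ge_atTop N,
    eventually_ge_atTop 1] with m hm hmN hm1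
  rw [log_edist_div_le_iff hm1]
  refine (h m hmN).trans ?_
  rw [div_pow, mul_div_assoc', div_lt_one (by positivity)] at hm
  exact hm.le

theorem eventually_le_of_mem_strongStable {ε lam : ℝ} {Ω : Set Plane} {F : Plane → Plane}
    {p q : Plane} (hlam : 0 < lam) (h : q ∈ strongStable ε lam Ω F p) {β : ℝ}
    (hβ : lam ^ (1 - ε) < β) : ∀ᶠ m in atTop, ‖F^[m] q - F^[m] p‖ ≤ β ^ m := by
  have hb0 : 0 < lam ^ (1 - ε) := Real.rpow_pos_of_pos hlam _
  have hβ0 : 0 < β := hb0.trans hβ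
  have hlt : (((1 - ε) * Real.log lam : ℝ) : EReal) < (Real.log β : EReal) := by
    rw [EReal.coe_lt_coe_iff, ← Real.log_rpow hlam]
    exact Real.log_lt_log hb0 hβ
  filter_upwards [eventually_lt_of_limsup_lt (h.2.trans_lt hlt) (by isBoundedDefault),
    eventually_ge_atTop 1] with m hm hm1
  have := (log_edist_div_le_iff hm1 _).1 hm.le
  rwa [Real.exp_log hβ0] at this

end Sequences

/-! ### Dynamics on the adapted leaves. -/

section Leaves

variable {r : ℕ} {L ε lam ρ A B A' δ c σ τ η M C : ℝ} {Ω : Set Plane} {F : Plane → Plane}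
  {p e : Plane} {T : ℕ → Plane ≃L[ℝ] Plane} {R : ℕ → Plane → Plane} {g : ℕ → ℝ → ℝ}

/-- The perturbation parameters are small with respect to the gaps between the rates. -/
structure IsSmallPerturbation (ε lam ρ τ η : ℝ) : Prop where
  slope_le : τ ≤ 1
  contracting : rateY ε lam ρ + 2 * η < 1
  expanding : (rateY ε lam ρ + lamCheck ε lam) / slow ε lam ρ < rateX ε lam ρ - 2 * η

theorem exists_isSmallPerturbation (hrb : RateBounds ε lam ρ) :
    ∃ η > 0, IsSmallPerturbation ε lam ρ 1 η := by
  have h1 := hrb.rateY_lt_one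
  have h2 := hrb.vertical_div_slow_lt
  set a := (1 - rateY ε lam ρ) / 3
  set b := (rateX ε lam ρ - (rateY ε lam ρ + lamCheck ε lam) / slow ε lam ρ) / 3
  have ha : 0 < a := by simp only [a]; linarith
  have hb : 0 < b := by simp only [b]; linarith
  have h3 := min_le_left a b
  have h4 := min_le_right a b
  refine ⟨min a b, lt_min ha hb, le_rfl, ?_, ?_⟩
  · simp only [a] at ha h3 ⊢; linarith
  · simp only [b] at hb h4 ⊢; linarith

/-- The `n`-th leaf, parametrized by the vertical adapted coordinate. -/
def leaf (F : Plane → Plane) (p : Plane) (T : ℕ → Plane ≃L[ℝ] Plane) (g : ℕ → ℝ → ℝ) (n : ℕ)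
    (y : ℝ) : Plane := F^[n] p + (T n).symm !₂[g n y, y]

/-- The vertical adapted coordinate. -/
def leafCoord (F : Plane → Plane) (p : Plane) (T : ℕ → Plane ≃L[ℝ] Plane) (n : ℕ)
    (q : Plane) : ℝ := T n (q - F^[n] p) 1

/-- The points of `Ω` that `F^n` maps to the `n`-th leaf. -/
def leafPiece (Ω : Set Plane) (F : Plane → Plane) (p : Plane) (T : ℕ → Plane ≃L[ℝ] Plane)
    (g : ℕ → ℝ → ℝ) (s : ℝ) (n : ℕ) : Set Plane :=
  {q | q ∈ Ω ∧ F^[n] q ∈ leaf F p T g n '' Ioo (-s) s}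

/-- The action of `F` on the leaves. -/
def leafMap (ε lam ρ : ℝ) (R : ℕ → Plane → Plane) (g : ℕ → ℝ → ℝ) (n : ℕ) (y : ℝ) : ℝ :=
  rateY ε lam ρ * y + R n !₂[g n y, y] 1

theorem apply_leaf_sub (n : ℕ) (y : ℝ) :
    T n (leaf F p T g n y - F^[n] p) = !₂[g n y, y] := by
  simp [leaf]

theorem leafCoord_leaf (n : ℕ) (y : ℝ) : leafCoord F p T n (leaf F p T g n y) = y := by
  rw [leafCoord, apply_leaf_sub]; simp

theorem continuous_leafCoord (n : ℕ) : Continuous (leafCoord F p T n) :=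
  (EuclideanSpace.proj (𝕜 := ℝ) (1 : Fin 2)).continuous.comp
    ((T n).continuous.comp (continuous_id.sub continuous_const))

theorem leaf_leafCoord {n : ℕ} {q : Plane} {s : Set ℝ} (hq : q ∈ leaf F p T g n '' s) :
    leaf F p T g n (leafCoord F p T n q) = q := by
  obtain ⟨y, -, rfl⟩ := hq
  rw [leafCoord_leaf]

theorem leafCoord_mem {n : ℕ} {q : Plane} {s : Set ℝ} (hq : q ∈ leaf F p T g n '' s) :
    leafCoord F p T n q ∈ s := by
  obtain ⟨y, hy, rfl⟩ := hq
  rwa [leafCoord_leaf]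

theorem leaf_injective (n : ℕ) : Function.Injective (leaf F p T g n) :=
  Function.LeftInverse.injective (leafCoord_leaf n)

theorem leaf_zero (h0 : ∀ n, g n 0 = 0) (n : ℕ) : leaf F p T g n 0 = F^[n] p := by
  have : (!₂[(0 : ℝ), 0] : Plane) = 0 := plane_ext rfl rfl
  rw [leaf, h0, this, map_zero, add_zero]

theorem IsAdapted.norm_graph_le (h : IsAdapted r ε lam ρ c σ τ η M Ω F p e T R g)
    (hτ : τ ≤ 1) (n : ℕ) (y : ℝ) :
    ‖(!₂[g n y, y] : Plane)‖ ≤ 2 * |y| := by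
  have h1 := norm_shear_le hτ (h.map_zero n) (h.lipschitz n) !₂[0, y]
  have h2 : shear (g n) !₂[0, y] = !₂[g n y, y] := plane_ext (by simp [shear]) (by simp [shear])
  rw [h2] at h1
  simpa using h1

theorem IsAdapted.leaf_mem (h : IsAdapted r ε lam ρ c σ τ η M Ω F p e T R g)
    (hτ : τ ≤ 1) (n : ℕ) {y : ℝ} (hy : |y| ≤ σ / 2) :
    leaf F p T g n y ∈ Ω :=
  h.mem n _ ((h.norm_graph_le hτ n y).trans (by linarith))

theorem IsAdapted.map_leaf (h : IsAdapted r ε lam ρ c σ τ η M Ω F p e T R g)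
    (hτ : τ ≤ 1) (n : ℕ) {y : ℝ} (hy : |y| ≤ σ / 2) :
    F (leaf F p T g n y) = leaf F p T g (n + 1) (leafMap ε lam ρ R g n y) := by
  rw [leaf, h.conj n _ ((h.norm_graph_le hτ n y).trans (by linarith)), leaf]
  congr 2
  refine plane_ext ?_ ?_
  · rw [PiLp.add_apply, diag_apply_zero]
    exact h.invariant n y
  · rw [PiLp.add_apply, diag_apply_one]
    rfl

theorem IsAdapted.abs_leafMap_le (h : IsAdapted r ε lam ρ c σ τ η M Ω F p e T R g)
    (hrb : RateBounds ε lam ρ) (hτ : τ ≤ 1) (n : ℕ) (y : ℝ) :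
    |leafMap ε lam ρ R g n y| ≤ (rateY ε lam ρ + 2 * η) * |y| := by
  have h1 := (abs_apply_le_norm (R n !₂[g n y, y]) 1).trans (h.perturbation.norm_le (by omega) n _)
  have h2 := h.norm_graph_le hτ n y
  have h3 := h.perturbation.nonneg
  calc _ ≤ |rateY ε lam ρ * y| + |R n !₂[g n y, y] 1| := abs_add_le _ _
    _ ≤ rateY ε lam ρ * |y| + η * (2 * |y|) := by
      rw [abs_mul, abs_of_pos hrb.rateY_pos]
      gcongr
      exact h1.trans (by gcongr)
    _ = _ := by ring

theorem IsAdapted.abs_leafMap_le_sq (h : IsAdapted r ε lam ρ c σ τ η M Ω F p e T R g)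
    (hr : 1 ≤ r) (hrb : RateBounds ε lam ρ) (hτ : τ ≤ 1) (n : ℕ)
    (y : ℝ) : |leafMap ε lam ρ R g n y| ≤ rateY ε lam ρ * |y| + 4 * M * |y| ^ 2 := by
  have h1 := (abs_apply_le_norm (R n !₂[g n y, y]) 1).trans
    (h.perturbation.norm_le_sq (by omega) n _)
  have h2 := h.norm_graph_le hτ n y
  have h3 := h.perturbation.bound_nonneg (by omega)
  calc _ ≤ |rateY ε lam ρ * y| + |R n !₂[g n y, y] 1| := abs_add_le _ _
    _ ≤ rateY ε lam ρ * |y| + M * (2 * |y|) * (2 * |y|) := by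
      rw [abs_mul, abs_of_pos hrb.rateY_pos]
      gcongr
      exact h1.trans (by gcongr)
    _ = _ := by ring

theorem IsAdapted.leaf_iterate (h : IsAdapted r ε lam ρ c σ τ η M Ω F p e T R g)
    (hrb : RateBounds ε lam ρ)
    (hs : IsSmallPerturbation ε lam ρ τ η) (n : ℕ) {y : ℝ} (hy : |y| ≤ σ / 2) :
    ∃ u : ℕ → ℝ, u 0 = y ∧ (∀ k, u (k + 1) = leafMap ε lam ρ R g (n + k) (u k)) ∧
      (∀ k, |u k| ≤ (rateY ε lam ρ + 2 * η) ^ k * |y|) ∧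
      ∀ k, F^[k] (leaf F p T g n y) = leaf F p T g (n + k) (u k) := by
  let u : ℕ → ℝ := fun k => Nat.rec y (fun k z => leafMap ε lam ρ R g (n + k) z) k
  have hu : ∀ k, u (k + 1) = leafMap ε lam ρ R g (n + k) (u k) := fun k => rfl
  have hη := h.perturbation.nonneg
  have hy0 := hrb.rateY_pos
  have hb : ∀ k, |u k| ≤ (rateY ε lam ρ + 2 * η) ^ k * |y| := by
    intro k
    induction k with
    | zero => simp [u]
    | succ k ih =>
      rw [hu]
      refine (h.abs_leafMap_le hrb hs.slope_le _ _).trans ?_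
      rw [pow_succ', mul_assoc]
      gcongr
  refine ⟨u, rfl, hu, hb, fun k => ?_⟩
  induction k with
  | zero => rfl
  | succ k ih =>
    rw [Function.iterate_succ_apply', ih, h.map_leaf hs.slope_le, hu]
    · rfl
    · refine (hb k).trans (le_trans ?_ hy)
      exact mul_le_of_le_one_left (abs_nonneg _) (pow_le_one₀ (by positivity) hs.contracting.le)

theorem IsAdapted.iterate_leaf_mem (h : IsAdapted r ε lam ρ c σ τ η M Ω F p e T R g)
    (hrb : RateBounds ε lam ρ)
    (hs : IsSmallPerturbation ε lam ρ τ η) (n k : ℕ) {q : Plane}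
    (hq : q ∈ leaf F p T g n '' Ioo (-(σ / 2)) (σ / 2)) :
    F^[k] q ∈ leaf F p T g (n + k) '' Ioo (-(σ / 2)) (σ / 2) := by
  obtain ⟨y, hy, rfl⟩ := hq
  have hy' : |y| < σ / 2 := abs_lt.2 hy
  obtain ⟨u, -, -, hb, hu⟩ := h.leaf_iterate hrb hs n hy'.le
  refine ⟨u k, abs_lt.1 (lt_of_le_of_lt ?_ hy'), (hu k).symm⟩
  have hη := h.perturbation.nonneg
  have hy0 := hrb.rateY_pos
  exact (hb k).trans (mul_le_of_le_one_left (abs_nonneg _)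
    (pow_le_one₀ (by positivity) hs.contracting.le))

theorem IsAdapted.leafPiece_subset_add (h : IsAdapted r ε lam ρ c σ τ η M Ω F p e T R g)
    (hrb : RateBounds ε lam ρ)
    (hs : IsSmallPerturbation ε lam ρ τ η) (n k : ℕ) :
    leafPiece Ω F p T g (σ / 2) n ⊆ leafPiece Ω F p T g (σ / 2) (n + k) := fun q hq =>
  ⟨hq.1, by
    rw [add_comm n k, Function.iterate_add_apply, add_comm k n]
    exact h.iterate_leaf_mem hrb hs n k hq.2⟩

/-- The crude contraction rate κ + 2η would not suffice. Since the nonlinearity is quadratic and the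
orbit decays geometrically, its relative effect is summable and the vertical coordinate is O(κ^k).
The factor κ^{-n} ‖DF^n e‖ in the bound for (T n)⁻¹ cancels κ, leaving λ^{(1-ε)n}. -/
theorem IsAdapted.leafPiece_subset_strongStable (h : IsAdapted r ε lam ρ c σ τ η M Ω F p e T R g)
    (hr : 1 ≤ r) (hrb : RateBounds ε lam ρ)
    (hL : 1 ≤ L) (ho : IsRegularOrbit r L ε lam ρ A B A' δ Ω F p e) (hc : 1 ≤ c)
    (hs : IsSmallPerturbation ε lam ρ τ η) (n : ℕ) :
    leafPiece Ω F p T g (σ / 2) n ⊆ strongStable ε lam Ω F p := by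
  rintro q ⟨hq, y, hy, hyq⟩
  have hy' : |y| < σ / 2 := abs_lt.2 hy
  obtain ⟨u, hu0, hu, hb, huF⟩ := h.leaf_iterate hrb hs n hy'.le
  have hη := h.perturbation.nonneg
  have hM := h.perturbation.bound_nonneg (by omega)
  have hy0 := hrb.rateY_pos
  set κ := rateY ε lam ρ with hκ
  set b := 4 * M * |y| / κ with hb'
  have hθ0 : 0 ≤ κ + 2 * η := by positivity
  have hstep : ∀ k, |u (k + 1)| ≤ κ * |u k| * (1 + b * (κ + 2 * η) ^ k) := by
    intro k
    rw [hu]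
    refine (h.abs_leafMap_le_sq hr hrb hs.slope_le _ _).trans ?_
    rw [← hκ]
    have e1 : κ * |u k| * (1 + b * (κ + 2 * η) ^ k) =
        κ * |u k| + 4 * M * (|u k| * ((κ + 2 * η) ^ k * |y|)) := by
      rw [hb']; field_simp
    rw [e1, sq]
    gcongr
    exact hb k
  have hk := le_of_perturbed_contraction hy0.le (by positivity : 0 ≤ b) hθ0 hs.contracting
    (fun k => abs_nonneg (u k)) hstep
  set E := Real.exp (b * (1 - (κ + 2 * η))⁻¹)
  refine mem_strongStable_of_le hrb.lam_mem.1 hq (N := n)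
    (K := c * L * (2 * (|y| * E) * (κ ^ n)⁻¹)) fun m hm => ?_
  obtain ⟨k, rfl⟩ := Nat.exists_eq_add_of_le hm
  have e2 : F^[n + k] q = leaf F p T g (n + k) (u k) := by
    rw [add_comm n k, Function.iterate_add_apply, ← hyq, huF, add_comm]
  rw [e2, leaf, add_sub_cancel_left]
  have hreg := (ho.regular_pow hL hrb.lam_mem.1 hrb.rho_mem.1 (n + k)).1.2
  have hl0 : 0 < lam ^ (1 - ε) := Real.rpow_pos_of_pos hrb.lam_mem.1 _
  calc _ ≤ ‖((T (n + k)).symm : Plane →L[ℝ] Plane)‖ * ‖(!₂[g (n + k) (u k), u k] : Plane)‖ :=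
        ((T (n + k)).symm : Plane →L[ℝ] Plane).le_opNorm _
    _ ≤ c * ((κ ^ (n + k))⁻¹ * (L * (lam ^ (1 - ε)) ^ (n + k))) *
        (2 * (κ ^ k * |y| * E)) := by
      gcongr
      · refine (h.diagonalizing.norm_symm_le (n + k)).trans ?_
        gcongr
      · refine (h.norm_graph_le hs.slope_le _ _).trans ?_
        have := hk k
        rw [hu0] at this
        gcongr
    _ = _ := by rw [pow_add κ]; field_simp

/-- Compare `z` with the graph point at the same height, whose image lies on the next graph. The
nonlinearity contributes an error η horizontally and, through a slope of at most 1, another η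
vertically. -/
theorem IsAdapted.expansion (h : IsAdapted r ε lam ρ c σ τ η M Ω F p e T R g)
    (n : ℕ) (hτ : τ ≤ 1) (z : Plane) :
    (rateX ε lam ρ - 2 * η) * |z 0 - g n (z 1)| ≤
      |rateX ε lam ρ * z 0 + R n z 0 - g (n + 1) (rateY ε lam ρ * z 1 + R n z 1)| := by
  have hη := h.perturbation.nonneg
  set w : Plane := !₂[g n (z 1), z 1] with hw
  have hzw : ‖z - w‖ ≤ |z 0 - g n (z 1)| := by
    refine (norm_le_abs_add_abs _).trans ?_
    simp [hw]
  have hR := h.perturbation.norm_sub_le (by omega) n z w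
  have h0 : |R n z 0 - R n w 0| ≤ η * |z 0 - g n (z 1)| :=
    (abs_apply_le_norm (R n z - R n w) 0).trans (hR.trans (by gcongr))
  have h1 : |R n z 1 - R n w 1| ≤ η * |z 0 - g n (z 1)| :=
    (abs_apply_le_norm (R n z - R n w) 1).trans (hR.trans (by gcongr))
  have h2 := h.lipschitz (n + 1) (rateY ε lam ρ * z 1 + R n z 1) (rateY ε lam ρ * z 1 + R n w 1)
  rw [add_sub_add_left_eq_sub] at h2
  have h3 := h.invariant n (z 1)
  rw [← hw] at h3
  have h2' : |g (n + 1) (rateY ε lam ρ * z 1 + R n z 1) -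
      g (n + 1) (rateY ε lam ρ * z 1 + R n w 1)| ≤ η * |z 0 - g n (z 1)| :=
    h2.trans ((mul_le_of_le_one_left (abs_nonneg _) hτ).trans h1)
  have e1 : rateX ε lam ρ * z 0 + R n z 0 - g (n + 1) (rateY ε lam ρ * z 1 + R n z 1) =
      rateX ε lam ρ * (z 0 - g n (z 1)) + ((R n z 0 - R n w 0) -
        (g (n + 1) (rateY ε lam ρ * z 1 + R n z 1) -
          g (n + 1) (rateY ε lam ρ * z 1 + R n w 1))) := by
    rw [← h3]; ring
  rw [e1]
  have h4 := abs_sub (R n z 0 - R n w 0) (g (n + 1) (rateY ε lam ρ * z 1 + R n z 1) -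
          g (n + 1) (rateY ε lam ρ * z 1 + R n w 1))
  have h5 := abs_sub_abs_le_abs_add (rateX ε lam ρ * (z 0 - g n (z 1))) ((R n z 0 - R n w 0) -
        (g (n + 1) (rateY ε lam ρ * z 1 + R n z 1) -
          g (n + 1) (rateY ε lam ρ * z 1 + R n w 1)))
  have h6 : rateX ε lam ρ * |z 0 - g n (z 1)| ≤ |rateX ε lam ρ * (z 0 - g n (z 1))| := by
    rw [abs_mul]; gcongr; exact le_abs_self _
  linarith

/-- Passing to the coordinates `T` costs a factor `slow ^ (-m)`, so the adapted coordinates decay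
like (κ / `slow`)^m and soon enter the disc of radius σ. From then on the horizontal distance to the
graph expands faster than this decay allows, so it vanishes. The time `m₀` depends on `K` and `n`
but not on `q`; this uniformity allows a whole piece to be treated at once. -/
theorem IsAdapted.eventually_mem_leaf (h : IsAdapted r ε lam ρ c σ τ η M Ω F p e T R g)
    (hrb : RateBounds ε lam ρ) (hc : 1 ≤ c) (hσ : 0 < σ)
    (hs : IsSmallPerturbation ε lam ρ τ η) (K : ℝ) (n : ℕ) :
    ∃ m₀ : ℕ, ∀ q, (∀ m, ‖F^[m] q - F^[n + m] p‖ ≤ K * (rateY ε lam ρ + lamCheck ε lam) ^ m) →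
      ∀ m ≥ m₀, F^[m] q ∈ leaf F p T g (n + m) '' Ioo (-(σ / 2)) (σ / 2) := by
  set κ := rateY ε lam ρ + lamCheck ε lam with hκ
  have hsl := hrb.slow_pos
  have hκ0 : 0 ≤ κ := (add_pos hrb.rateY_pos hrb.lamCheck_pos).le
  have hη := h.perturbation.nonneg
  set K' := c * (slow ε lam ρ ^ n)⁻¹ * K with hK'
  have hlim : Tendsto (fun m : ℕ => K' * (κ / slow ε lam ρ) ^ m) atTop (𝓝 (K' * 0)) :=
    (tendsto_pow_atTop_nhds_zero_of_lt_one (by positivity)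
      ((div_lt_one hsl).2 hrb.vertical_lt_slow)).const_mul _
  rw [mul_zero] at hlim
  obtain ⟨m₀, hm₀⟩ := eventually_atTop.1 (hlim.eventually (gt_mem_nhds (half_pos hσ)))
  refine ⟨m₀, fun q hq m hm => ?_⟩
  set z : ℕ → Plane := fun m => T (n + m) (F^[m] q - F^[n + m] p) with hz
  have hzb : ∀ m, ‖z m‖ ≤ K' * (κ / slow ε lam ρ) ^ m := by
    intro m
    calc ‖z m‖ ≤ ‖(T (n + m) : Plane →L[ℝ] Plane)‖ * ‖F^[m] q - F^[n + m] p‖ :=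
          (T (n + m) : Plane →L[ℝ] Plane).le_opNorm _
      _ ≤ c * (slow ε lam ρ ^ (n + m))⁻¹ * (K * κ ^ m) := by
          gcongr
          · exact h.diagonalizing.norm_le _
          · exact hq m
      _ = _ := by rw [hK', pow_add, div_pow]; field_simp
  have hqz : ∀ m, F^[m] q = F^[n + m] p + (T (n + m)).symm (z m) := fun m => by simp [hz]
  have hstep : ∀ m ≥ m₀, z (m + 1) = diag (rateX ε lam ρ) (rateY ε lam ρ) (z m) +
      R (n + m) (z m) := by
    intro m hm
    have h1 := h.conj (n + m) (z m) ((hzb m).trans (by linarith [hm₀ m hm]))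
    rw [← hqz m, ← Function.iterate_succ_apply' F m q] at h1
    have h2 := hqz (m + 1)
    rw [h1] at h2
    exact ((T (n + m + 1)).symm.injective (add_left_cancel h2)).symm
  set x : ℕ → ℝ := fun m => z m 0 - g (n + m) (z m 1) with hx
  have hx1 : ∀ m ≥ m₀, (rateX ε lam ρ - 2 * η) * |x m| ≤ |x (m + 1)| := by
    intro m hm
    have h1 := h.expansion (n + m) hs.slope_le (z m)
    simp only [hx]
    rw [hstep m hm, PiLp.add_apply, PiLp.add_apply, diag_apply_zero, diag_apply_one]
    exact h1
  have hx2 : ∀ m ≥ m₀, |x m| ≤ 2 * K' * (κ / slow ε lam ρ) ^ m := by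
    intro m _
    have h1 := h.lipschitz (n + m) (z m 1) 0
    rw [h.map_zero, sub_zero, sub_zero] at h1
    have h2 := abs_apply_le_norm (z m) 0
    have h3 := abs_apply_le_norm (z m) 1
    have h4 := hzb m
    have h5 : τ * |z m 1| ≤ |z m 1| := mul_le_of_le_one_left (abs_nonneg _) hs.slope_le
    have h6 := abs_sub (z m 0) (g (n + m) (z m 1))
    simp only [hx]
    linarith
  have hx0 := eq_zero_of_expansion (by positivity) hs.expanding hx1 hx2 m hm
  have hz1 : |z m 1| < σ / 2 := (abs_apply_le_norm (z m) 1).trans_lt ((hzb m).trans_lt (hm₀ m hm))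
  refine ⟨z m 1, abs_lt.1 hz1, ?_⟩
  rw [hqz m, leaf]
  congr 2
  refine plane_ext ?_ rfl
  simp only [hx] at hx0
  change g (n + m) (z m 1) = z m 0
  linarith

end Leaves

/-- At a first exit time the path would be a limit of points of φ.symm '' K, which is compact, hence
closed, and lies inside the source. The lemma locates points in a chart domain for which only the
image box is known explicitly. -/
theorem lift_path_of_isCompact {X Y : Type*} [TopologicalSpace X] [T2Space X]
    [TopologicalSpace Y] (φ : OpenPartialHomeomorph X Y) {σ : ℝ → X}
    (hσ : ContinuousOn σ (Icc 0 1)) (h0 : σ 0 ∈ φ.source) {K : Set Y} (hK : IsCompact K)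
    (hKt : K ⊆ φ.target)
    (h : ∀ t ∈ Icc (0 : ℝ) 1, (∀ u ∈ Icc 0 t, σ u ∈ φ.source) → φ (σ t) ∈ K) :
    σ 1 ∈ φ.source ∧ φ (σ 1) ∈ K := by
  have key : ∀ t ∈ Icc (0 : ℝ) 1, σ t ∈ φ.source := by
    by_contra hne
    push Not at hne
    have hcl : IsClosed (Icc (0 : ℝ) 1 ∩ σ ⁻¹' φ.sourceᶜ) :=
      hσ.preimage_isClosed_of_isClosed isClosed_Icc φ.open_source.isClosed_compl
    obtain ⟨t, ht, hts⟩ := hne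
    obtain ⟨s, ⟨hs, hsn⟩, hsl⟩ :=
      (isCompact_Icc.of_isClosed_subset hcl inter_subset_left).exists_isLeast ⟨t, ht, hts⟩
    have hs0 : 0 < s := hs.1.lt_of_ne fun h1 => hsn (h1 ▸ h0)
    have hlt : ∀ u ∈ Ico 0 s, σ u ∈ φ.source := fun u hu => by
      by_contra hu'
      exact absurd (hsl ⟨⟨hu.1, hu.2.le.trans hs.2⟩, hu'⟩) (not_le.2 hu.2)
    have hKc : IsClosed (φ.symm '' K) :=
      (hK.image_of_continuousOn (φ.continuousOn_symm.mono hKt)).isClosed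
    have hsub : σ '' Ico 0 s ⊆ φ.symm '' K := by
      rintro _ ⟨u, hu, rfl⟩
      refine ⟨φ (σ u), h u ⟨hu.1, hu.2.le.trans hs.2⟩ fun v hv =>
        hlt v ⟨hv.1, hv.2.trans_lt hu.2⟩, φ.left_inv (hlt u hu)⟩
    have hcl' : s ∈ closure (Ico 0 s) := by
      rw [closure_Ico hs0.ne]; exact right_mem_Icc.2 hs0.le
    have h1 := ((hσ s hs).mono (Ico_subset_Icc_self.trans (Icc_subset_Icc_right hs.2))
      |>.mem_closure_image hcl')
    obtain ⟨w, hw, hws⟩ := (closure_minimal hsub hKc) h1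
    exact hsn (hws ▸ φ.map_target (hKt hw))
  exact ⟨key 1 (right_mem_Icc.2 zero_le_one), h 1 (right_mem_Icc.2 zero_le_one) key⟩

theorem convex_box (l : ℝ) : Convex ℝ (box l) := by
  have h : ∀ i : Fin 2, Convex ℝ {z : Plane | |z i| < l} := fun i => by
    have e1 : {z : Plane | |z i| < l} =
        (EuclideanSpace.proj (𝕜 := ℝ) i : Plane →L[ℝ] ℝ) ⁻¹' Ioo (-l) l := by
      ext z
      change |z i| < l ↔ z i ∈ Ioo (-l) l
      rw [mem_Ioo, abs_lt]
    rw [e1]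
    exact (convex_Ioo _ _).linear_preimage (EuclideanSpace.proj (𝕜 := ℝ) i : Plane →ₗ[ℝ] ℝ)
  exact (h 0).inter (h 1)

theorem zero_mem_box {l : ℝ} (hl : 0 < l) : (0 : Plane) ∈ box l := by simpa [box] using hl

/-- The parametrization of the vertical axis. -/
def axis : ℝ →L[ℝ] Plane := (ContinuousLinearMap.id ℝ ℝ).smulRight (!₂[(0 : ℝ), 1] : Plane)

theorem axis_apply (y : ℝ) : axis y = !₂[0, y] := plane_ext (by simp [axis]) (by simp [axis])

theorem axis_apply_zero (y : ℝ) : axis y 0 = 0 := by simp [axis]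

theorem axis_apply_one (y : ℝ) : axis y 1 = y := by simp [axis]

theorem norm_axis (y : ℝ) : ‖axis y‖ = |y| := by
  refine le_antisymm ?_ ?_
  · refine (norm_le_abs_add_abs _).trans ?_
    rw [axis_apply_zero, axis_apply_one, abs_zero, zero_add]
  · conv_lhs => rw [← axis_apply_one y]
    exact abs_apply_le_norm _ 1

theorem eq_axis {z : Plane} (hz : z 0 = 0) : z = axis (z 1) :=
  plane_ext (by rw [axis_apply_zero, hz]) (by rw [axis_apply_one])

theorem axis_mem_box {l y : ℝ} (hy : |y| < l) : axis y ∈ box l := by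
  refine ⟨?_, ?_⟩
  · rw [axis_apply_zero, abs_zero]; exact (abs_nonneg y).trans_lt hy
  · rwa [axis_apply_one]

/-! ### Dynamics in an arbitrary system of regular charts. -/

section ChartSystem

variable {r : ℕ} {L ε lam ρ A B A' δ C : ℝ} {Ω : Set Plane} {F : Plane → Plane}
  {p e : Plane} {Φ : ℕ → OpenPartialHomeomorph Plane Plane} {G : ℕ → Plane → Plane}

theorem IsRegularChartSystem.norm_map_sub_le
    (hS : IsRegularChartSystem r L ε lam ρ A B A' C Ω F p e Φ G) (hr : 1 ≤ r) (n : ℕ)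
    (z w : Plane) : ‖G n z - G n w - diag (rateX ε lam ρ) (rateY ε lam ρ) (z - w)‖ ≤
      lamCheck ε lam * ‖z - w‖ := by
  have hd : Differentiable ℝ (G n) := (hS.diffeo n).1.differentiable (by norm_cast; omega)
  have h0 : fderiv ℝ (G n) 0 = diag (rateX ε lam ρ) (rateY ε lam ρ) := by
    ext1 v
    rw [hS.fderiv_zero]
    exact plane_ext (by simp [rateX]) (by simp [rateY])
  refine convex_univ.norm_image_sub_le_of_norm_fderiv_le' (fun x _ => hd x) (fun x _ => ?_)
    (mem_univ w) (mem_univ z)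
  rw [← h0]
  exact (hS.almost_linear n x).le

theorem IsRegularChartSystem.map_axis
    (hS : IsRegularChartSystem r L ε lam ρ A B A' C Ω F p e Φ G) (hr : 1 ≤ r)
    (hrb : RateBounds ε lam ρ) (n : ℕ) (y : ℝ) :
    ∃ y', G n (axis y) = axis y' ∧ |y'| ≤ (rateY ε lam ρ + lamCheck ε lam) * |y| := by
  refine ⟨G n (axis y) 1, eq_axis (by rw [axis_apply]; exact hS.vertical_axis n y), ?_⟩
  have h1 := hS.norm_map_sub_le hr n (axis y) 0
  rw [hS.map_zero, sub_zero, sub_zero, norm_axis] at h1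
  have h2 := (abs_apply_le_norm _ 1).trans h1
  rw [PiLp.sub_apply, diag_apply_one, axis_apply_one] at h2
  have h3 := abs_sub_abs_le_abs_sub (G n (axis y) 1) (rateY ε lam ρ * y)
  rw [abs_mul, abs_of_pos hrb.rateY_pos] at h3
  linarith

/-- Compare `z` with the point of the invariant axis at the same height: the two images differ by
the diagonal map up to `lamCheck`. -/
theorem IsRegularChartSystem.expansion
    (hS : IsRegularChartSystem r L ε lam ρ A B A' C Ω F p e Φ G) (hr : 1 ≤ r)
    (hrb : RateBounds ε lam ρ) (n : ℕ) (z : Plane) :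
    (rateX ε lam ρ - lamCheck ε lam) * |z 0| ≤ |G n z 0| := by
  have h1 := hS.norm_map_sub_le hr n z (axis (z 1))
  have h0 := hS.vertical_axis n (z 1)
  rw [← axis_apply] at h0
  have h2 := (abs_apply_le_norm _ 0).trans h1
  rw [PiLp.sub_apply, PiLp.sub_apply, diag_apply_zero, h0, PiLp.sub_apply, axis_apply_zero,
    sub_zero, sub_zero] at h2
  have h3 : ‖z - axis (z 1)‖ ≤ |z 0| := by
    refine (norm_le_abs_add_abs _).trans ?_
    rw [PiLp.sub_apply, PiLp.sub_apply, axis_apply_zero, axis_apply_one, sub_zero, sub_self,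
      abs_zero, add_zero]
  have h4 := abs_sub_abs_le_abs_sub (rateX ε lam ρ * z 0) (G n z 0)
  rw [abs_mul, abs_of_pos hrb.rateX_pos, abs_sub_comm] at h4
  have h5 := mul_le_mul_of_nonneg_left h3 hrb.lamCheck_pos.le
  linarith

theorem IsRegularChartSystem.norm_symm_sub_le
    (hS : IsRegularChartSystem r L ε lam ρ A B A' C Ω F p e Φ G) (hr : 1 ≤ r)
    {n : ℕ} {z : Plane} (hl : 0 < regularRadius L ε lam ρ A A' C n) (hz : z ∈ (Φ n).target) :
    ‖(Φ n).symm z - F^[n] p‖ ≤ C * (1 + coneOpening ε ρ A A') * ‖z‖ := by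
  have h0 : (Φ n).symm 0 = F^[n] p := by
    rw [← hS.map_base n, (Φ n).left_inv (hS.mem_source n)]
  have h00 : (0 : Plane) ∈ (Φ n).target := by rw [hS.target_eq]; exact zero_mem_box hl
  have h1 : ∀ x ∈ (Φ n).target, DifferentiableAt ℝ (Φ n).symm x := fun x hx =>
    ((hS.contDiffOn_symm n).contDiffAt ((Φ n).open_target.mem_nhds hx)).differentiableAt
      (by norm_cast; omega)
  have h2 : ∀ x ∈ (Φ n).target, ‖fderiv ℝ (Φ n).symm x‖ ≤ C * (1 + coneOpening ε ρ A A') :=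
    fun x hx => by
      rw [← norm_iteratedFDeriv_one']
      exact hS.norm_symm_le n x hx 1 le_rfl hr
  have hconv : Convex ℝ (Φ n).target := by rw [hS.target_eq]; exact convex_box _
  have := hconv.norm_image_sub_le_of_norm_fderiv_le h1 h2 h00 hz
  rwa [h0, sub_zero] at this

/-- Along the segment from the base point to `q`, the derivative bound keeps the chart image in a
compact ball inside the box, so the segment cannot leave the chart domain. -/
theorem IsRegularChartSystem.mem_source_of_lt
    (hS : IsRegularChartSystem r L ε lam ρ A B A' C Ω F p e Φ G) (hr : 1 ≤ r) {n : ℕ}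
    (hd : 0 ≤ C * distortion L ε lam ρ A A' n) {q : Plane}
    (hq : C * distortion L ε lam ρ A A' n * ‖q - F^[n] p‖ < regularRadius L ε lam ρ A A' C n) :
    q ∈ (Φ n).source ∧ ‖Φ n q‖ ≤ C * distortion L ε lam ρ A A' n * ‖q - F^[n] p‖ := by
  set P := F^[n] p with hP
  set D := C * distortion L ε lam ρ A A' n with hD
  set σ : ℝ → Plane := fun t => P + t • (q - P) with hσ
  have hσc : Continuous σ := by fun_prop
  have h1 : ∀ x ∈ (Φ n).source, DifferentiableAt ℝ (Φ n) x := fun x hx =>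
    ((hS.contDiffOn n).contDiffAt ((Φ n).open_source.mem_nhds hx)).differentiableAt
      (by norm_cast; omega)
  have h2 : ∀ x ∈ (Φ n).source, ‖fderiv ℝ (Φ n) x‖ ≤ D := fun x hx => by
    rw [← norm_iteratedFDeriv_one', hD, ← pow_one (distortion L ε lam ρ A A' n)]
    exact hS.norm_le n x hx 1 le_rfl hr
  have hK : Metric.closedBall (0 : Plane) (D * ‖q - P‖) ⊆ (Φ n).target := by
    intro z hz
    rw [mem_closedBall_zero_iff] at hz
    rw [hS.target_eq]
    exact ⟨((abs_apply_le_norm z 0).trans hz).trans_lt hq,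
      ((abs_apply_le_norm z 1).trans hz).trans_lt hq⟩
  have h0 : σ 0 ∈ (Φ n).source := by simpa [hσ] using hS.mem_source n
  have hσ1 : σ 1 = q := by simp [hσ]
  have := lift_path_of_isCompact (Φ n) hσc.continuousOn h0
    (isCompact_closedBall 0 (D * ‖q - P‖)) hK fun t ht hu => by
      have hsub : segment ℝ P (σ t) ⊆ (Φ n).source := by
        intro x hx
        rw [segment_eq_image'] at hx
        obtain ⟨θ, hθ, rfl⟩ := hx
        have := hu (θ * t) ⟨mul_nonneg hθ.1 ht.1, mul_le_of_le_one_left ht.1 hθ.2⟩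
        simpa [hσ, smul_smul] using this
      have h3 := (convex_segment P (σ t)).norm_image_sub_le_of_norm_fderiv_le
        (fun x hx => h1 x (hsub hx)) (fun x hx => h2 x (hsub hx)) (left_mem_segment ℝ _ _)
        (right_mem_segment ℝ _ _)
      rw [hS.map_base, sub_zero] at h3
      rw [mem_closedBall_zero_iff]
      refine h3.trans ?_
      gcongr
      simp only [hσ, add_sub_cancel_left, norm_smul, Real.norm_eq_abs, abs_of_nonneg ht.1]
      exact mul_le_of_le_one_left (norm_nonneg _) ht.2
  rw [hσ1, mem_closedBall_zero_iff] at this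
  exact this

/-- The chart formula for `F` holds only where the image lies in the next chart domain. Moving along
the axis from the base point, the image stays in a compact part of the next axis as long as the
formula holds, because vertical contraction is stronger than the shrinking of the radii; so the
formula never fails. -/
theorem IsRegularChartSystem.map_localVertical
    (hS : IsRegularChartSystem r L ε lam ρ A B A' C Ω F p e Φ G)
    (ho : IsRegularOrbit r L ε lam ρ A B A' δ Ω F p e) (hr : 1 ≤ r)
    (hrb : RateBounds ε lam ρ) (hL : 1 ≤ L) (hC : 1 ≤ C) {n : ℕ} {q : Plane}
    (hq : q ∈ localVertical (Φ n)) : F q ∈ localVertical (Φ (n + 1)) ∧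
      |Φ (n + 1) (F q) 1| ≤ (rateY ε lam ρ + lamCheck ε lam) * |Φ n q 1| := by
  obtain ⟨hA, -, hA'⟩ := ho.bounds_pos
  obtain ⟨hqs, hq0⟩ := hq
  set y := Φ n q 1 with hy
  have hqy : Φ n q = axis y := eq_axis hq0
  have hyl : |y| < regularRadius L ε lam ρ A A' C n := by
    have := (Φ n).map_source hqs
    rw [hS.target_eq] at this
    exact this.2
  set κ := rateY ε lam ρ + lamCheck ε lam with hκ
  have hκ0 : 0 ≤ κ := (add_pos hrb.rateY_pos hrb.lamCheck_pos).le
  have hκl : κ * |y| < regularRadius L ε lam ρ A A' C (n + 1) := by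
    rw [regularRadius_eq hrb C (n + 1), pow_succ, ← mul_assoc, ← regularRadius_eq hrb C n, mul_comm]
    have h1 := regularRadius_pos hrb hL hA hA' hC n
    have h2 := hrb.vertical_lt_slow
    rw [← hκ] at h2
    nlinarith [abs_nonneg y]
  have hmem : ∀ t ∈ Icc (0 : ℝ) 1, axis (t * y) ∈ (Φ n).target := fun t ht => by
    rw [hS.target_eq]
    refine axis_mem_box (lt_of_le_of_lt ?_ hyl)
    rw [abs_mul, abs_of_nonneg ht.1]
    exact mul_le_of_le_one_left (abs_nonneg _) ht.2
  set σ : ℝ → Plane := fun t => F ((Φ n).symm (axis (t * y))) with hσ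
  have hσc : ContinuousOn σ (Icc 0 1) := by
    refine ho.diffeo.contDiffOn.continuousOn.comp ((Φ n).continuousOn_symm.comp
      (by fun_prop) hmem) fun t ht => ?_
    exact hS.source_subset n ((Φ n).map_target (hmem t ht))
  have hbase : (Φ n).symm 0 = F^[n] p := by
    rw [← hS.map_base n, (Φ n).left_inv (hS.mem_source n)]
  have h0 : σ 0 ∈ (Φ (n + 1)).source := by
    simp only [hσ, zero_mul, _root_.map_zero, hbase]
    rw [← Function.iterate_succ_apply' F n p]
    exact hS.mem_source (n + 1)
  have hσ1 : σ 1 = F q := by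
    simp only [hσ, one_mul]
    rw [← hqy, (Φ n).left_inv hqs]
  have hKc : IsCompact (axis '' Icc (-(κ * |y|)) (κ * |y|)) :=
    isCompact_Icc.image axis.continuous
  have hKt : axis '' Icc (-(κ * |y|)) (κ * |y|) ⊆ (Φ (n + 1)).target := by
    rintro _ ⟨u, hu, rfl⟩
    rw [hS.target_eq]
    exact axis_mem_box ((abs_le.2 hu).trans_lt hκl)
  have := lift_path_of_isCompact (Φ (n + 1)) hσc h0 hKc hKt fun t ht hu => by
    have h1 := hS.conj n ((Φ n).symm (axis (t * y))) ((Φ n).map_target (hmem t ht))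
      (hu t (right_mem_Icc.2 ht.1))
    rw [(Φ n).right_inv (hmem t ht)] at h1
    obtain ⟨y', hy', hy'b⟩ := hS.map_axis hr hrb n (t * y)
    refine ⟨y', abs_le.1 (hy'b.trans ?_), (h1.trans hy').symm⟩
    rw [abs_mul, abs_of_nonneg ht.1]
    exact mul_le_mul_of_nonneg_left (mul_le_of_le_one_left (abs_nonneg _) ht.2) hκ0
  rw [hσ1] at this
  obtain ⟨h1, u, hu, hu'⟩ := this
  refine ⟨⟨h1, by rw [← hu', axis_apply_zero]⟩, ?_⟩
  rw [← hu', axis_apply_one]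
  exact abs_le.2 hu

theorem IsRegularChartSystem.iterate_localVertical
    (hS : IsRegularChartSystem r L ε lam ρ A B A' C Ω F p e Φ G)
    (ho : IsRegularOrbit r L ε lam ρ A B A' δ Ω F p e) (hr : 1 ≤ r)
    (hrb : RateBounds ε lam ρ) (hL : 1 ≤ L) (hC : 1 ≤ C) {n : ℕ} {q : Plane}
    (hq : q ∈ localVertical (Φ n)) (m : ℕ) : F^[m] q ∈ localVertical (Φ (n + m)) ∧
      |Φ (n + m) (F^[m] q) 1| ≤ (rateY ε lam ρ + lamCheck ε lam) ^ m * |Φ n q 1| := by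
  have hκ0 : 0 ≤ rateY ε lam ρ + lamCheck ε lam := (add_pos hrb.rateY_pos hrb.lamCheck_pos).le
  induction m with
  | zero => simpa using hq
  | succ m ih =>
    have h1 := hS.map_localVertical ho hr hrb hL hC ih.1
    rw [← Function.iterate_succ_apply' F m q] at h1
    refine ⟨h1.1, h1.2.trans ?_⟩
    rw [pow_succ', mul_assoc]
    exact mul_le_mul_of_nonneg_left ih.2 hκ0

theorem IsRegularChartSystem.norm_iterate_localVertical_sub_le
    (hS : IsRegularChartSystem r L ε lam ρ A B A' C Ω F p e Φ G)
    (ho : IsRegularOrbit r L ε lam ρ A B A' δ Ω F p e) (hr : 1 ≤ r)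
    (hrb : RateBounds ε lam ρ) (hL : 1 ≤ L) (hC : 1 ≤ C) {n : ℕ} {q : Plane}
    (hq : q ∈ localVertical (Φ n)) (m : ℕ) : ‖F^[m] q - F^[n + m] p‖ ≤
      C * (1 + coneOpening ε ρ A A') * regularRadius L ε lam ρ A A' C n *
        (rateY ε lam ρ + lamCheck ε lam) ^ m := by
  obtain ⟨hA, -, hA'⟩ := ho.bounds_pos
  have hω := coneOpening_nonneg hrb hA hA'
  have hκ0 : 0 ≤ rateY ε lam ρ + lamCheck ε lam := (add_pos hrb.rateY_pos hrb.lamCheck_pos).le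
  obtain ⟨⟨h1, h2⟩, h3⟩ := hS.iterate_localVertical ho hr hrb hL hC hq m
  have h4 := hS.norm_symm_sub_le hr (regularRadius_pos hrb hL hA hA' hC (n + m))
    ((Φ (n + m)).map_source h1)
  rw [(Φ (n + m)).left_inv h1, eq_axis h2, norm_axis] at h4
  have h5 : |Φ n q 1| ≤ regularRadius L ε lam ρ A A' C n := by
    have := (Φ n).map_source hq.1
    rw [hS.target_eq] at this
    exact this.2.le
  calc _ ≤ _ := h4
    _ ≤ C * (1 + coneOpening ε ρ A A') * ((rateY ε lam ρ + lamCheck ε lam) ^ m *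
        regularRadius L ε lam ρ A A' C n) := by
      gcongr
      exact h3.trans (by gcongr)
    _ = _ := by ring

/-- A rate β slightly above λ^{1-ε} bounds the orbit distance. In the charts it becomes β / `slow`,
which leads into the boxes and is too small for a nonzero horizontal coordinate. -/
theorem IsRegularChartSystem.strongStable_subset
    (hS : IsRegularChartSystem r L ε lam ρ A B A' C Ω F p e Φ G)
    (ho : IsRegularOrbit r L ε lam ρ A B A' δ Ω F p e) (hr : 1 ≤ r)
    (hrb : RateBounds ε lam ρ) (hL : 1 ≤ L) (hC : 1 ≤ C) :
    strongStable ε lam Ω F p ⊆ ⋃ n, stablePiece Ω F Φ n := by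
  intro q hq
  obtain ⟨hA, -, hA'⟩ := ho.bounds_pos
  have hsl := hrb.slow_pos
  have hd0 := distortion_zero_pos hrb hL hA hA'
  have hl0 := regularRadius_pos hrb hL hA hA' hC 0
  have hC0 : 0 < C := by linarith
  have hlam0 : 0 < lam ^ (1 - ε) := Real.rpow_pos_of_pos hrb.lam_mem.1 _
  -- One factor `slow` is lost to the distortion of the charts. A second is needed to enter the
  -- boxes of radius proportional to `slow ^ m`, while the other bound makes horizontal expansion
  -- prevail.
  obtain ⟨β, hβ, hβ'⟩ := exists_between (lt_min hrb.lam_lt_slow_sq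
    ((div_lt_iff₀ hsl).1 hrb.lam_div_slow_lt))
  have hβ0 : 0 < β := hlam0.trans hβ
  have hβ1 : β / slow ε lam ρ ^ 2 < 1 := (div_lt_one (by positivity)).2
    (hβ'.trans_le (min_le_left _ _))
  have hβ2 : β / slow ε lam ρ < rateX ε lam ρ - lamCheck ε lam :=
    (div_lt_iff₀ hsl).2 (hβ'.trans_le (min_le_right _ _))
  have hlim : Tendsto (fun m : ℕ => C * distortion L ε lam ρ A A' 0 *
      (β / slow ε lam ρ ^ 2) ^ m) atTop (𝓝 (C * distortion L ε lam ρ A A' 0 * 0)) :=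
    (tendsto_pow_atTop_nhds_zero_of_lt_one (by positivity) hβ1).const_mul _
  rw [mul_zero] at hlim
  obtain ⟨N, hN⟩ := eventually_atTop.1 ((eventually_le_of_mem_strongStable hrb.lam_mem.1 hq hβ).and
    (hlim.eventually (gt_mem_nhds hl0)))
  have hbd : ∀ m ≥ N, C * distortion L ε lam ρ A A' m * ‖F^[m] q - F^[m] p‖ ≤
      C * distortion L ε lam ρ A A' 0 * (β / slow ε lam ρ) ^ m := by
    intro m hm
    have hdm := distortion_pos hrb hL hA hA' m
    calc _ ≤ C * distortion L ε lam ρ A A' m * β ^ m := by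
          gcongr
          exact (hN m hm).1
      _ = _ := by rw [distortion_eq hrb m, div_pow]; field_simp
  have hsrc : ∀ m ≥ N, F^[m] q ∈ (Φ m).source ∧
      ‖Φ m (F^[m] q)‖ ≤ C * distortion L ε lam ρ A A' 0 * (β / slow ε lam ρ) ^ m := by
    intro m hm
    have hdm := distortion_pos hrb hL hA hA' m
    have h1 := hS.mem_source_of_lt hr (n := m) (q := F^[m] q) (by positivity) (by
      refine (hbd m hm).trans_lt ?_
      rw [regularRadius_eq hrb]
      have h2 := (hN m hm).2
      calc _ = C * distortion L ε lam ρ A A' 0 * (β / slow ε lam ρ ^ 2) ^ m *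
            slow ε lam ρ ^ m := by
            rw [div_pow, div_pow]; field_simp; ring
        _ < _ := by gcongr)
    exact ⟨h1.1, h1.2.trans (hbd m hm)⟩
  have hx := eq_zero_of_expansion (x := fun m => Φ m (F^[m] q) 0) (N := N) (by positivity) hβ2
    (fun m hm => by
      have h1 := hS.conj m _ (hsrc m hm).1 (by
        rw [← Function.iterate_succ_apply' F m q]; exact (hsrc (m + 1) (by omega)).1)
      rw [← Function.iterate_succ_apply' F m q] at h1
      simp only [h1]
      exact hS.expansion hr hrb m _)
    (fun m hm => (abs_apply_le_norm _ 0).trans (hsrc m hm).2) N le_rfl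
  exact mem_iUnion.2 ⟨N, hq.1, (hsrc N le_rfl).1, hx⟩

end ChartSystem

/-! ### Comparison of arbitrary charts with the adapted leaves. -/

section Comparison

variable {r : ℕ} {L ε lam ρ A B A' δ c σ τ η M C : ℝ} {Ω : Set Plane} {F : Plane → Plane}
  {p e : Plane} {T : ℕ → Plane ≃L[ℝ] Plane} {R : ℕ → Plane → Plane} {g : ℕ → ℝ → ℝ}
  {Φ : ℕ → OpenPartialHomeomorph Plane Plane} {G : ℕ → Plane → Plane}

theorem IsRegularChartSystem.eventually_mem_leaf
    (hS : IsRegularChartSystem r L ε lam ρ A B A' C Ω F p e Φ G)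
    (ho : IsRegularOrbit r L ε lam ρ A B A' δ Ω F p e)
    (h : IsAdapted r ε lam ρ c σ τ η M Ω F p e T R g) (hr : 1 ≤ r)
    (hrb : RateBounds ε lam ρ) (hL : 1 ≤ L) (hC : 1 ≤ C) (hc : 1 ≤ c) (hσ : 0 < σ)
    (hs : IsSmallPerturbation ε lam ρ τ η) (n : ℕ) :
    ∃ m₀ : ℕ, ∀ q ∈ localVertical (Φ n), ∀ m ≥ m₀,
      F^[m] q ∈ leaf F p T g (n + m) '' Ioo (-(σ / 2)) (σ / 2) := by
  obtain ⟨m₀, hm₀⟩ := h.eventually_mem_leaf hrb hc hσ hs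
    (C * (1 + coneOpening ε ρ A A') * regularRadius L ε lam ρ A A' C n) n
  exact ⟨m₀, fun q hq => hm₀ q (hS.norm_iterate_localVertical_sub_le ho hr hrb hL hC hq)⟩

/-- The inclusions strong stable set ⊆ chart pieces ⊆ leaf pieces ⊆ strong stable set close a cycle.
Going through the leaves is essential, since in the charts alone only the rate `rateY + lamCheck` is
available. -/
theorem IsRegularChartSystem.strongStable_eq
    (hS : IsRegularChartSystem r L ε lam ρ A B A' C Ω F p e Φ G)
    (ho : IsRegularOrbit r L ε lam ρ A B A' δ Ω F p e)
    (h : IsAdapted r ε lam ρ c σ τ η M Ω F p e T R g) (hr : 1 ≤ r)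
    (hrb : RateBounds ε lam ρ) (hL : 1 ≤ L) (hC : 1 ≤ C) (hc : 1 ≤ c) (hσ : 0 < σ)
    (hs : IsSmallPerturbation ε lam ρ τ η) :
    strongStable ε lam Ω F p = ⋃ n, stablePiece Ω F Φ n ∧
      strongStable ε lam Ω F p = ⋃ n, leafPiece Ω F p T g (σ / 2) n := by
  have h1 := hS.strongStable_subset ho hr hrb hL hC
  have h2 : ⋃ n, stablePiece Ω F Φ n ⊆ ⋃ n, leafPiece Ω F p T g (σ / 2) n := by
    refine iUnion_subset fun n q hq => ?_
    obtain ⟨m₀, hm₀⟩ := hS.eventually_mem_leaf ho h hr hrb hL hC hc hσ hs n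
    refine mem_iUnion.2 ⟨n + m₀, hq.1, ?_⟩
    have := hm₀ _ hq.2 m₀ le_rfl
    rwa [← Function.iterate_add_apply, add_comm m₀ n] at this
  have h3 : ⋃ n, leafPiece Ω F p T g (σ / 2) n ⊆ strongStable ε lam Ω F p :=
    iUnion_subset fun n => h.leafPiece_subset_strongStable hr hrb hL ho hc hs n
  exact ⟨h1.antisymm (h2.trans h3), (h1.trans h2).antisymm h3⟩

end Comparison

/-- Invariance of domain on the line: an injective continuous function on an interval is strictly
monotone, and the intermediate value theorem fills a neighbourhood. -/
theorem isOpen_image_of_injOn {f : ℝ → ℝ} {U : Set ℝ} (hU : IsOpen U) (hc : ContinuousOn f U)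
    (hi : InjOn f U) : IsOpen (f '' U) := by
  rw [isOpen_iff_mem_nhds]
  rintro _ ⟨x, hx, rfl⟩
  obtain ⟨d, hd, hdU⟩ := Metric.isOpen_iff.1 hU x hx
  set a := x - d / 2
  set b := x + d / 2
  have hsub : Icc a b ⊆ U := fun y hy => hdU (by
    simp only [a, b, mem_Icc] at hy
    rw [Metric.mem_ball, Real.dist_eq, abs_lt]
    constructor <;> linarith [hy.1, hy.2])
  have hax : a < x := by simp only [a]; linarith
  have hxb : x < b := by simp only [b]; linarith
  have hab : a ≤ b := (hax.trans hxb).le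
  have hx' : x ∈ Icc a b := ⟨hax.le, hxb.le⟩
  rcases (hc.mono hsub).strictMonoOn_of_injOn_Icc' hab (hi.mono hsub) with hm | hm
  · refine mem_of_superset (Icc_mem_nhds (hm (left_mem_Icc.2 hab) hx' hax)
      (hm hx' (right_mem_Icc.2 hab) hxb)) ?_
    exact (intermediate_value_Icc hab (hc.mono hsub)).trans (image_mono hsub)
  · refine mem_of_superset (Icc_mem_nhds (hm hx' (right_mem_Icc.2 hab) hxb)
      (hm (left_mem_Icc.2 hab) hx' hax)) ?_
    exact (intermediate_value_Icc' hab (hc.mono hsub)).trans (image_mono hsub)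

/-! ### Preimages of the leaves under iterates. -/

section Pullback

variable {r : ℕ} {L ε lam ρ A B A' δ c σ τ η M C s : ℝ} {Ω : Set Plane} {F : Plane → Plane}
  {p e : Plane} {T : ℕ → Plane ≃L[ℝ] Plane} {R : ℕ → Plane → Plane} {g : ℕ → ℝ → ℝ}

theorem IsDissipativeDiffeo.exists_iterate_openPartialHomeomorph
    (hF : IsDissipativeDiffeo r A B A' Ω F) (n : ℕ) :
    ∃ φ : OpenPartialHomeomorph Plane Plane, φ.source = Ω ∧ φ.target = F^[n] '' Ω ∧
      (φ : Plane → Plane) = F^[n] ∧ ContDiffOn ℝ (r + 1 : ℕ) φ.symm φ.target := by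
  obtain ⟨φ, h1, h2, h3⟩ := exists_openPartialHomeomorph hF.isOpen
    ((hF.contDiffOn_iterate n).of_le (by norm_cast; omega)) (hF.injOn_iterate n)
    (fun q hq => hF.exists_equiv n hq)
  refine ⟨φ, h1, h2, h3, fun z hz => ?_⟩
  have hz' : φ.symm z ∈ Ω := h1 ▸ φ.map_target hz
  obtain ⟨S, hS⟩ := hF.exists_equiv n hz'
  refine (φ.contDiffAt_symm hz (f₀' := S) ?_ ?_).contDiffWithinAt
  · rw [hS, h3]
    exact (hF.differentiableAt_iterate n hz').hasFDerivAt
  · rw [h3]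
    exact (hF.contDiffOn_iterate n).contDiffAt (hF.isOpen.mem_nhds hz')

theorem IsAdapted.contDiff_leaf (h : IsAdapted r ε lam ρ c σ τ η M Ω F p e T R g) (n : ℕ) :
    ContDiff ℝ (r + 1 : ℕ) (leaf F p T g n) := by
  have : leaf F p T g n = fun y => F^[n] p + (T n).symm (toPlane (g n y, y)) := by
    ext1 y; rw [toPlane_apply]; rfl
  rw [this]
  exact contDiff_const.add ((T n).symm.contDiff.comp (toPlane.contDiff.comp
    ((h.contDiff n).prodMk contDiff_id)))

theorem IsAdapted.hasDerivAt_leaf (h : IsAdapted r ε lam ρ c σ τ η M Ω F p e T R g) (n : ℕ)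
    (y : ℝ) : HasDerivAt (leaf F p T g n) ((T n).symm !₂[deriv (g n) y, 1]) y := by
  have : leaf F p T g n = fun y => F^[n] p + (T n).symm (toPlane (g n y, y)) := by
    ext1 y; rw [toPlane_apply]; rfl
  rw [this, ← toPlane_apply]
  have h1 := (h.differentiable n y).hasDerivAt.prodMk (hasDerivAt_id y)
  exact (((T n).symm : Plane →L[ℝ] Plane).hasFDerivAt.comp_hasDerivAt y
    ((toPlane : (ℝ × ℝ) →L[ℝ] Plane).hasFDerivAt.comp_hasDerivAt y h1)).const_add _

/-- The parameters of the `n`-th leaf at which it meets the image of `F^n`. -/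
def leafDomain (Ω : Set Plane) (F : Plane → Plane) (p : Plane) (T : ℕ → Plane ≃L[ℝ] Plane)
    (g : ℕ → ℝ → ℝ) (s : ℝ) (n : ℕ) : Set ℝ :=
  {y | y ∈ Ioo (-s) s ∧ leaf F p T g n y ∈ F^[n] '' Ω}

/-- `β` parametrizes the preimage of the `n`-th leaf under `F^n`. -/
structure IsLeafPullback (r : ℕ) (Ω : Set Plane) (F : Plane → Plane) (p : Plane)
    (T : ℕ → Plane ≃L[ℝ] Plane) (g : ℕ → ℝ → ℝ) (s : ℝ) (n : ℕ) (β : ℝ → Plane) : Prop where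
  isOpen : IsOpen (leafDomain Ω F p T g s n)
  contDiffOn : ContDiffOn ℝ (r + 1 : ℕ) β (leafDomain Ω F p T g s n)
  mem : ∀ y ∈ leafDomain Ω F p T g s n, β y ∈ Ω
  iterate_eq : ∀ y ∈ leafDomain Ω F p T g s n, F^[n] (β y) = leaf F p T g n y

theorem IsAdapted.exists_isLeafPullback (h : IsAdapted r ε lam ρ c σ τ η M Ω F p e T R g)
    (hF : IsDissipativeDiffeo r A B A' Ω F) (s : ℝ) (n : ℕ) :
    ∃ β : ℝ → Plane, IsLeafPullback r Ω F p T g s n β := by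
  obtain ⟨φ, h1, h2, h3, h4⟩ := hF.exists_iterate_openPartialHomeomorph n
  have hl := h.contDiff_leaf n
  refine ⟨φ.symm ∘ leaf F p T g n, ?_, ?_, fun y hy => ?_, fun y hy => ?_⟩
  · have h5 : leafDomain Ω F p T g s n = Ioo (-s) s ∩ leaf F p T g n ⁻¹' φ.target := by
      rw [h2]; rfl
    rw [h5]
    exact isOpen_Ioo.inter (φ.open_target.preimage hl.continuous)
  · exact h4.comp hl.contDiffOn fun y hy => h2 ▸ hy.2
  · exact h1 ▸ φ.map_target (h2 ▸ hy.2)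
  · rw [← h3]
    exact φ.right_inv (h2 ▸ hy.2)

variable {β : ℝ → Plane} {n : ℕ}

theorem IsLeafPullback.image_eq (hβ : IsLeafPullback r Ω F p T g s n β)
    (hF : IsDissipativeDiffeo r A B A' Ω F) {J : Set ℝ} (hJ : J ⊆ leafDomain Ω F p T g s n) :
    β '' J = {q | q ∈ Ω ∧ F^[n] q ∈ leaf F p T g n '' J} := by
  ext q
  constructor
  · rintro ⟨y, hy, rfl⟩
    exact ⟨hβ.mem y (hJ hy), y, hy, (hβ.iterate_eq y (hJ hy)).symm⟩
  · rintro ⟨hq, y, hy, hyq⟩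
    refine ⟨y, hy, hF.injOn_iterate n (hβ.mem y (hJ hy)) hq ?_⟩
    rw [hβ.iterate_eq y (hJ hy), hyq]

theorem IsLeafPullback.leafCoord_eq (hβ : IsLeafPullback r Ω F p T g s n β) {y : ℝ}
    (hy : y ∈ leafDomain Ω F p T g s n) : leafCoord F p T n (F^[n] (β y)) = y := by
  rw [hβ.iterate_eq y hy, leafCoord_leaf]

theorem IsLeafPullback.hasDerivAt (hβ : IsLeafPullback r Ω F p T g s n β) {y : ℝ}
    (hy : y ∈ leafDomain Ω F p T g s n) : HasDerivAt β (deriv β y) y :=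
  ((hβ.contDiffOn.contDiffAt (hβ.isOpen.mem_nhds hy)).differentiableAt (by simp)).hasDerivAt

theorem IsLeafPullback.fderiv_iterate_deriv (hβ : IsLeafPullback r Ω F p T g s n β)
    (h : IsAdapted r ε lam ρ c σ τ η M Ω F p e T R g) (hF : IsDissipativeDiffeo r A B A' Ω F)
    {y : ℝ} (hy : y ∈ leafDomain Ω F p T g s n) :
    fderiv ℝ F^[n] (β y) (deriv β y) = (T n).symm !₂[deriv (g n) y, 1] := by
  have h1 := (hF.differentiableAt_iterate n (hβ.mem y hy)).hasFDerivAt.comp_hasDerivAt y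
    (hβ.hasDerivAt hy)
  have h2 : F^[n] ∘ β =ᶠ[𝓝 y] leaf F p T g n := by
    filter_upwards [hβ.isOpen.mem_nhds hy] with z hz using hβ.iterate_eq z hz
  exact (h1.congr_of_eventuallyEq h2.symm).unique (h.hasDerivAt_leaf n y)

theorem IsLeafPullback.deriv_ne_zero (hβ : IsLeafPullback r Ω F p T g s n β)
    (h : IsAdapted r ε lam ρ c σ τ η M Ω F p e T R g) (hF : IsDissipativeDiffeo r A B A' Ω F)
    {y : ℝ} (hy : y ∈ leafDomain Ω F p T g s n) : deriv β y ≠ 0 := by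
  intro h0
  have h1 := hβ.fderiv_iterate_deriv h hF hy
  rw [h0, _root_.map_zero] at h1
  have h2 := (T n).symm.injective (((T n).symm.map_zero).trans h1)
  have h3 := congrArg (fun z : Plane => z 1) h2
  simp at h3

/-- Only the parameter 0 passes through `p`. There the leaf is vertical in the coordinates `T n`,
like the image of `e`, and the derivative of `F^n` is injective. -/
theorem IsLeafPullback.deriv_mem_span (hβ : IsLeafPullback r Ω F p T g s n β)
    (h : IsAdapted r ε lam ρ c σ τ η M Ω F p e T R g) (hF : IsDissipativeDiffeo r A B A' Ω F)
    (hrb : RateBounds ε lam ρ)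
    {y : ℝ} (hy : y ∈ leafDomain Ω F p T g s n) (hyp : β y = p) :
    deriv β y ∈ Submodule.span ℝ {e} := by
  have hy0 : y = 0 := by
    have := hβ.leafCoord_eq hy
    rw [hyp, leafCoord, sub_self, _root_.map_zero] at this
    exact this.symm
  subst hy0
  have h1 := hβ.fderiv_iterate_deriv h hF hy
  rw [hyp, h.deriv_zero n] at h1
  have h2 := h.diagonalizing.vertical n
  have hκ : rateY ε lam ρ ^ n ≠ 0 := (pow_pos hrb.rateY_pos n).ne'
  have h3 : fderiv ℝ F^[n] p (rateY ε lam ρ ^ n • deriv β 0 - e) = 0 := by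
    rw [map_sub, map_smul, h1, ← map_smul, ← h2, ContinuousLinearEquiv.symm_apply_apply, sub_self]
  have hp : p ∈ Ω := hyp ▸ hβ.mem 0 hy
  have h4 : rateY ε lam ρ ^ n • deriv β 0 - e = 0 := by
    by_contra h5
    exact hF.fderiv_iterate_ne_zero n hp h5 h3
  rw [Submodule.mem_span_singleton]
  refine ⟨(rateY ε lam ρ ^ n)⁻¹, ?_⟩
  rw [← sub_eq_zero.1 h4, smul_smul, inv_mul_cancel₀ hκ, one_smul]

/-- Both arcs are pushed into the same leaf `N`, where the vertical coordinate is injective. The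
image of the second arc is then an open subset of the line, and the set in question is its preimage
under a continuous function. -/
theorem isOpen_trace (hF : IsDissipativeDiffeo r A B A' Ω F) {N n k : ℕ} (hN : k + n = N)
    {γ α : ℝ → Plane} {I U : Set ℝ} (hI : IsOpen I) (hγ : ContinuousOn γ I) (hγΩ : MapsTo γ I Ω)
    (hγN : ∀ t ∈ I, F^[N] (γ t) ∈ leaf F p T g N '' Ioo (-s) s)
    (hU : IsOpen U) (hα : ContinuousOn α U) (hαi : InjOn α U) (hαΩ : MapsTo α U Ω)
    (hαN : ∀ y ∈ U, F^[k] (α y) ∈ leaf F p T g N '' Ioo (-s) s) :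
    IsOpen {t | t ∈ I ∧ F^[n] (γ t) ∈ α '' U} := by
  subst hN
  have hFc : ∀ m, ContinuousOn F^[m] Ω := fun m => (hF.contDiffOn_iterate m).continuousOn
  have hW : IsOpen ((fun y => leafCoord F p T (k + n) (F^[k] (α y))) '' U) := by
    refine isOpen_image_of_injOn hU ((continuous_leafCoord _).comp_continuousOn
      ((hFc k).comp hα hαΩ)) fun y hy y' hy' hyy => ?_
    have h1 := congrArg (leaf F p T g (k + n)) hyy
    rw [leaf_leafCoord (hαN y hy), leaf_leafCoord (hαN y' hy')] at h1
    exact hαi hy hy' (hF.injOn_iterate k (hαΩ hy) (hαΩ hy') h1)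
  have hc : ContinuousOn (fun t => leafCoord F p T (k + n) (F^[k + n] (γ t))) I :=
    (continuous_leafCoord _).comp_continuousOn ((hFc (k + n)).comp hγ hγΩ)
  convert hc.isOpen_inter_preimage hI hW using 1
  ext t
  simp only [mem_ofPred_eq, mem_inter_iff, mem_preimage, and_congr_right_iff]
  intro ht
  constructor
  · rintro ⟨y, hy, hyt⟩
    exact ⟨y, hy, by rw [Function.iterate_add_apply, ← hyt]⟩
  · rintro ⟨y, hy, hyt⟩
    have h1 : leaf F p T g (k + n) (leafCoord F p T (k + n) (F^[k] (α y))) =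
        leaf F p T g (k + n) (leafCoord F p T (k + n) (F^[k + n] (γ t))) := congrArg _ hyt
    rw [leaf_leafCoord (hαN y hy), leaf_leafCoord (hγN t ht), Function.iterate_add_apply] at h1
    exact ⟨y, hy, hF.injOn_iterate k (hαΩ hy) (hF.iterate_mem n (hγΩ ht)) h1⟩

end Pullback

theorem IsRegularChartSystem.localVertical_eq {r : ℕ} {L ε lam ρ A B A' C : ℝ} {Ω : Set Plane}
    {F : Plane → Plane} {p e : Plane} {Φ : ℕ → OpenPartialHomeomorph Plane Plane}
    {G : ℕ → Plane → Plane} (hS : IsRegularChartSystem r L ε lam ρ A B A' C Ω F p e Φ G) (n : ℕ) :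
    localVertical (Φ n) = (fun y => (Φ n).symm (axis y)) ''
      Ioo (-(regularRadius L ε lam ρ A A' C n)) (regularRadius L ε lam ρ A A' C n) := by
  ext q
  constructor
  · rintro ⟨hq, hq0⟩
    have h1 := (Φ n).map_source hq
    rw [hS.target_eq] at h1
    exact ⟨Φ n q 1, abs_lt.1 h1.2, by simp only; rw [← eq_axis hq0, (Φ n).left_inv hq]⟩
  · rintro ⟨y, hy, rfl⟩
    have h1 : axis y ∈ (Φ n).target := by
      rw [hS.target_eq]; exact axis_mem_box (abs_lt.2 hy)
    exact ⟨(Φ n).map_target h1, by rw [(Φ n).right_inv h1, axis_apply_zero]⟩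

/-! ### The atlas of the strong stable manifold. -/

section Atlas

/-- The affine parametrization of `(a, b)` over `(-1, 1)`. -/
def affineArc (a b t : ℝ) : ℝ := (a + b) / 2 + (b - a) / 2 * t

theorem affineArc_mem_iff {a b t : ℝ} (hab : a < b) :
    affineArc a b t ∈ Ioo a b ↔ t ∈ Ioo (-1 : ℝ) 1 := by
  rw [affineArc, mem_Ioo, mem_Ioo]
  constructor
  · rintro ⟨h1, h2⟩
    constructor <;> nlinarith
  · rintro ⟨h1, h2⟩
    constructor <;> nlinarith

theorem image_affineArc {a b : ℝ} (hab : a < b) : affineArc a b '' Ioo (-1) 1 = Ioo a b := by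
  ext y
  constructor
  · rintro ⟨t, ht, rfl⟩
    exact (affineArc_mem_iff hab).2 ht
  · intro hy
    have hne : b - a ≠ 0 := by linarith
    have e1 : affineArc a b ((y - (a + b) / 2) / ((b - a) / 2)) = y := by
      rw [affineArc]; field_simp; ring
    exact ⟨_, (affineArc_mem_iff hab).1 (by rw [e1]; exact hy), e1⟩

theorem contDiff_affineArc (a b : ℝ) {n : WithTop ℕ∞} : ContDiff ℝ n (affineArc a b) :=
  contDiff_const.add (contDiff_const.mul contDiff_id)

theorem hasDerivAt_affineArc (a b t : ℝ) : HasDerivAt (affineArc a b) ((b - a) / 2) t := by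
  have := ((hasDerivAt_id t).const_mul ((b - a) / 2)).const_add ((a + b) / 2)
  rw [mul_one] at this
  exact this

theorem affineArc_isEmbedding {a b : ℝ} (hab : a < b) : IsEmbedding (affineArc a b) := by
  have hne : b - a ≠ 0 := by linarith
  refine IsEmbedding.of_leftInverse (f := fun y => (y - (a + b) / 2) / ((b - a) / 2)) (fun t => ?_)
    (by fun_prop) (contDiff_affineArc a b (n := 0)).continuous
  simp only [affineArc]
  field_simp
  ring

variable {r : ℕ} {L ε lam ρ A B A' δ c σ τ η M C : ℝ} {Ω : Set Plane} {F : Plane → Plane}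
  {p e : Plane} {T : ℕ → Plane ≃L[ℝ] Plane} {R : ℕ → Plane → Plane} {g : ℕ → ℝ → ℝ}
  {Φ : ℕ → OpenPartialHomeomorph Plane Plane} {G : ℕ → Plane → Plane}

/-- Applying `F^n` and taking the vertical coordinate recovers the parameter continuously. -/
theorem IsLeafPullback.isEmbedding {s : ℝ} {n : ℕ} {β : ℝ → Plane}
    (hβ : IsLeafPullback r Ω F p T g s n β) (hF : IsDissipativeDiffeo r A B A' Ω F) {a b : ℝ}
    (hab : a < b) (hJ : Ioo a b ⊆ leafDomain Ω F p T g s n) :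
    IsEmbedding fun t : Ioo (-1 : ℝ) 1 => β (affineArc a b t) := by
  have hm : ∀ t : Ioo (-1 : ℝ) 1, affineArc a b t ∈ leafDomain Ω F p T g s n := fun t =>
    hJ ((affineArc_mem_iff hab).2 t.2)
  let f : Ioo (-1 : ℝ) 1 → Ω := fun t => ⟨β (affineArc a b t), hβ.mem _ (hm t)⟩
  have hfc : Continuous f := by
    refine Continuous.subtype_mk ?_ _
    exact hβ.contDiffOn.continuousOn.comp_continuous
      ((contDiff_affineArc a b (n := 0)).continuous.comp continuous_subtype_val) hm
  let k : Ω → ℝ := fun q => leafCoord F p T n (F^[n] q)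
  have hkc : Continuous k :=
    (continuous_leafCoord n).comp
      ((hF.contDiffOn_iterate n).continuousOn.comp_continuous continuous_subtype_val fun q => q.2)
  have hkf : k ∘ f = affineArc a b ∘ Subtype.val := by
    ext1 t
    exact hβ.leafCoord_eq (hm t)
  have : IsEmbedding f := IsEmbedding.of_comp hfc hkc
    (hkf ▸ (affineArc_isEmbedding hab).comp IsEmbedding.subtypeVal)
  exact IsEmbedding.subtypeVal.comp this

/-- The arcs are the preimages of leaf segments under iterates of `F`. Both openness assertions, for
overlaps and for the chart pieces, are instances of `isOpen_trace`. -/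
theorem IsRegularChartSystem.exists_isCurveAtlas
    (hS : IsRegularChartSystem r L ε lam ρ A B A' C Ω F p e Φ G)
    (ho : IsRegularOrbit r L ε lam ρ A B A' δ Ω F p e)
    (h : IsAdapted r ε lam ρ c σ τ η M Ω F p e T R g) (hr : 1 ≤ r)
    (hrb : RateBounds ε lam ρ) (hL : 1 ≤ L) (hC : 1 ≤ C) (hc : 1 ≤ c) (hσ : 0 < σ)
    (hs : IsSmallPerturbation ε lam ρ τ η) :
    ∃ γ : ℕ → ℝ → Plane, IsCurveAtlas (r + 1) (strongStable ε lam Ω F p) γ ∧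
      (∀ n i, IsOpen {t : ℝ | t ∈ Ioo (-1) 1 ∧ γ i t ∈ stablePiece Ω F Φ n}) ∧
      ∀ i, ∀ t ∈ Ioo (-1 : ℝ) 1, γ i t = p → deriv (γ i) t ∈ Submodule.span ℝ {e} := by
  have hF := ho.diffeo
  choose β hβ using h.exists_isLeafPullback hF (σ / 2)
  -- A leaf may meet the image of `F^n` in many intervals; rational subintervals give a countable
  -- family of arcs that covers them all.
  let I := {x : ℕ × ℚ × ℚ // (x.2.1 : ℝ) < x.2.2 ∧
    Ioo (x.2.1 : ℝ) x.2.2 ⊆ leafDomain Ω F p T g (σ / 2) x.1}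
  have hex : ∀ n, ∀ y ∈ leafDomain Ω F p T g (σ / 2) n, ∃ i : I, i.1.1 = n ∧
      y ∈ Ioo (i.1.2.1 : ℝ) i.1.2.2 := by
    intro n y hy
    obtain ⟨d, hd, hdU⟩ := Metric.isOpen_iff.1 (hβ n).isOpen y hy
    obtain ⟨a, ha, hay⟩ := exists_rat_btwn (show y - d < y by linarith)
    obtain ⟨b, hyb, hb⟩ := exists_rat_btwn (show y < y + d by linarith)
    refine ⟨⟨(n, a, b), hay.trans hyb, fun u hu => hdU ?_⟩, rfl, hay, hyb⟩
    rw [Metric.mem_ball, Real.dist_eq, abs_lt]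
    constructor <;> linarith [hu.1, hu.2]
  have h0 : (0 : ℝ) ∈ leafDomain Ω F p T g (σ / 2) 0 := by
    refine ⟨⟨by linarith, by linarith⟩, p, ho.mem, ?_⟩
    rw [leaf_zero h.map_zero]
  have : Nonempty I := ⟨(hex 0 0 h0).choose⟩
  obtain ⟨f, hf⟩ := exists_surjective_nat I
  let lv : ℕ → ℕ := fun i => (f i).1.1
  let a : ℕ → ℝ := fun i => ((f i).1.2.1 : ℝ)
  let b : ℕ → ℝ := fun i => ((f i).1.2.2 : ℝ)
  have hab : ∀ i, a i < b i := fun i => (f i).2.1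
  have hJ : ∀ i, Ioo (a i) (b i) ⊆ leafDomain Ω F p T g (σ / 2) (lv i) := fun i => (f i).2.2
  let γ : ℕ → ℝ → Plane := fun i => β (lv i) ∘ affineArc (a i) (b i)
  have hm : ∀ i, ∀ t ∈ Ioo (-1 : ℝ) 1, affineArc (a i) (b i) t ∈
      leafDomain Ω F p T g (σ / 2) (lv i) := fun i t ht => hJ i ((affineArc_mem_iff (hab i)).2 ht)
  have hγI : ∀ i, γ i '' Ioo (-1) 1 =
      {q | q ∈ Ω ∧ F^[lv i] q ∈ leaf F p T g (lv i) '' Ioo (a i) (b i)} := fun i => by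
    simp only [γ]
    rw [image_comp, image_affineArc (hab i), (hβ (lv i)).image_eq hF (hJ i)]
  have hγc : ∀ i, ContDiffOn ℝ (r + 1 : ℕ) (γ i) (Ioo (-1) 1) := fun i =>
    (hβ (lv i)).contDiffOn.comp (contDiff_affineArc _ _).contDiffOn (hm i)
  have hγΩ : ∀ i, MapsTo (γ i) (Ioo (-1) 1) Ω := fun i t ht => (hβ (lv i)).mem _ (hm i t ht)
  have hγd : ∀ i, ∀ t ∈ Ioo (-1 : ℝ) 1, deriv (γ i) t =
      ((b i - a i) / 2) • deriv (β (lv i)) (affineArc (a i) (b i) t) := fun i t ht =>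
    (((hβ (lv i)).hasDerivAt (hm i t ht)).scomp t (hasDerivAt_affineArc (a i) (b i) t)).deriv
  have hleaf : ∀ i, ∀ t ∈ Ioo (-1 : ℝ) 1, ∀ k, F^[lv i + k] (γ i t) ∈
      leaf F p T g (lv i + k) '' Ioo (-(σ / 2)) (σ / 2) := fun i t ht k => by
    refine (h.leafPiece_subset_add hrb hs (lv i) k ⟨hγΩ i ht, ?_⟩).2
    have h1 := (hβ (lv i)).iterate_eq _ (hm i t ht)
    exact ⟨_, (hm i t ht).1, h1.symm⟩
  have hne : ∀ i, (b i - a i) / 2 ≠ 0 := fun i => by linarith [hab i]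
  refine ⟨γ, ⟨hγc, fun i t ht => ?_, fun i => (hβ (lv i)).isEmbedding hF (hab i) (hJ i), ?_,
    fun i j => ?_⟩, fun n i => ?_, fun i t ht htp => ?_⟩
  · rw [hγd i t ht]
    exact smul_ne_zero (hne i) ((hβ (lv i)).deriv_ne_zero h hF (hm i t ht))
  · rw [(hS.strongStable_eq ho h hr hrb hL hC hc hσ hs).2]
    refine Subset.antisymm (iUnion_subset fun i => ?_) (iUnion_subset fun n => ?_)
    · rw [hγI]
      refine fun q hq => mem_iUnion.2 ⟨lv i, hq.1, ?_⟩
      exact image_mono (fun y hy => (hJ i hy).1) hq.2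
    · rintro q ⟨hq, y, hy, hyq⟩
      obtain ⟨i, hi, hyi⟩ := hex n y ⟨hy, q, hq, hyq.symm⟩
      obtain ⟨j, rfl⟩ := hf i
      subst hi
      refine mem_iUnion.2 ⟨j, ?_⟩
      rw [hγI]
      exact ⟨hq, y, hyi, hyq⟩
  -- The arcs `i` and `j` are compared in the leaf with index `lv i + lv j`, which both reach.
  · have h1 := isOpen_trace (p := p) (T := T) (g := g) (s := σ / 2) hF
      (rfl : lv i + lv j = lv i + lv j) isOpen_Ioo (hγc i).continuousOn (hγΩ i)
      (fun t ht => hleaf i t ht (lv j)) (isOpen_Ioo (a := a j) (b := b j))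
      (h.contDiff_leaf (lv j)).continuous.continuousOn (leaf_injective (lv j)).injOn
      (fun y hy => h.leaf_mem hs.slope_le _ (abs_lt.2 (hJ j hy).1).le)
      (fun y hy => by
        rw [add_comm (lv i)]
        exact h.iterate_leaf_mem hrb hs _ _ ⟨y, (hJ j hy).1, rfl⟩)
    convert h1 using 1
    ext t
    simp only [mem_ofPred_eq, hγI, and_congr_right_iff]
    exact fun ht => ⟨fun hh => hh.2, fun hh => ⟨hγΩ i ht, hh⟩⟩
  · obtain ⟨m₀, hm₀⟩ := hS.eventually_mem_leaf ho h hr hrb hL hC hc hσ hs n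
    have hlv := hS.localVertical_eq n
    set l := regularRadius L ε lam ρ A A' C n with hl
    have htar : ∀ y ∈ Ioo (-l) l, axis y ∈ (Φ n).target := fun y hy => by
      rw [hS.target_eq]; exact axis_mem_box (abs_lt.2 hy)
    -- The vertical axis of chart `n` lies in leaves after `m₀` further iterates, so the common leaf
    -- has index `lv i + (n + m₀)`.
    have h1 := isOpen_trace (p := p) (T := T) (g := g) (s := σ / 2) hF
      (show (m₀ + lv i) + n = lv i + (n + m₀) by omega) isOpen_Ioo (hγc i).continuousOn (hγΩ i)
      (fun t ht => hleaf i t ht (n + m₀)) (isOpen_Ioo (a := -l) (b := l))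
      (α := fun y => (Φ n).symm (axis y))
      ((Φ n).continuousOn_symm.comp axis.continuous.continuousOn htar)
      (fun y hy y' hy' hyy => by
        have h2 := congrArg (fun z : Plane => z 1)
          ((Φ n).symm.injOn (htar y hy) (htar y' hy') hyy)
        simpa [axis_apply_one] using h2)
      (fun y hy => hS.source_subset n ((Φ n).map_target (htar y hy)))
      (fun y hy => by
        rw [show lv i + (n + m₀) = n + (m₀ + lv i) by omega]
        exact hm₀ _ (hlv ▸ mem_image_of_mem _ hy) _ (by omega))
    convert h1 using 1
    ext t
    simp only [mem_ofPred_eq, and_congr_right_iff, stablePiece, hlv]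
    exact fun ht => ⟨fun hh => hh.2, fun hh => ⟨hγΩ i ht, hh⟩⟩
  · rw [hγd i t ht]
    exact Submodule.smul_mem _ _ ((hβ (lv i)).deriv_mem_span h hF hrb (hm i t ht) htp)

end Atlas

/-! ### Arc-length parametrizations with derivative bounds. -/

section ArcLength

theorem eq_Ioo_of_isConnected {S : Set ℝ} (hS : IsConnected S) (ho : IsOpen S) (hb : BddBelow S)
    (ha : BddAbove S) : S = Ioo (sInf S) (sSup S) := by
  refine Subset.antisymm (fun x hx => ⟨?_, ?_⟩) (hS.Ioo_csInf_csSup_subset hb ha)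
  · obtain ⟨d, hd, hdS⟩ := Metric.isOpen_iff.1 ho x hx
    have : x - d / 2 ∈ S := hdS (by rw [Metric.mem_ball, Real.dist_eq, abs_lt]; constructor <;> linarith)
    linarith [csInf_le hb this]
  · obtain ⟨d, hd, hdS⟩ := Metric.isOpen_iff.1 ho x hx
    have : x + d / 2 ∈ S := hdS (by rw [Metric.mem_ball, Real.dist_eq, abs_lt]; constructor <;> linarith)
    linarith [le_csSup ha this]

/-- Take the inverse of y ↦ ∫₀^y f. The upper bound `M` on f only serves to make its interval of
definition bounded. -/
theorem exists_inverse_primitive {l M : ℝ} (hl : 0 < l) {f : ℝ → ℝ}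
    (hf : ContinuousOn f (Ioo (-l) l)) (hpos : ∀ y ∈ Ioo (-l) l, 0 < f y)
    (hM : ∀ y ∈ Ioo (-l) l, f y ≤ M) :
    ∃ (a b : ℝ) (u : ℝ → ℝ), a < 0 ∧ 0 < b ∧ u 0 = 0 ∧ InjOn u (Ioo a b) ∧
      u '' Ioo a b = Ioo (-l) l ∧ ∀ x ∈ Ioo a b, HasDerivAt u (f (u x))⁻¹ x := by
  set I := Ioo (-l) l with hI
  have h0 : (0 : ℝ) ∈ I := ⟨by linarith, hl⟩
  set s : ℝ → ℝ := fun y => ∫ t in (0 : ℝ)..y, f t with hs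
  have hsub : ∀ y ∈ I, uIcc 0 y ⊆ I := fun y hy => (ordConnected_Ioo).uIcc_subset h0 hy
  have hder : ∀ y ∈ I, HasDerivAt s (f y) y := fun y hy =>
    intervalIntegral.integral_hasDerivAt_right ((hf.mono (hsub y hy)).intervalIntegrable)
      (hf.stronglyMeasurableAtFilter isOpen_Ioo y hy) (hf.continuousAt (isOpen_Ioo.mem_nhds hy))
  have hsc : ContinuousOn s I := fun y hy => (hder y hy).continuousAt.continuousWithinAt
  have hmono : StrictMonoOn s I := by
    refine strictMonoOn_of_deriv_pos (convex_Ioo _ _) hsc fun y hy => ?_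
    rw [interior_Ioo] at hy
    rw [(hder y hy).deriv]
    exact hpos y hy
  have hs0 : s 0 = 0 := by simp [hs]
  have hsC : ContDiffOn ℝ 1 s I := by
    rw [show (1 : WithTop ℕ∞) = 0 + 1 from rfl, contDiffOn_succ_iff_deriv_of_isOpen isOpen_Ioo]
    refine ⟨fun y hy => (hder y hy).differentiableAt.differentiableWithinAt, by simp, ?_⟩
    rw [contDiffOn_zero]
    exact hf.congr fun y hy => (hder y hy).deriv
  obtain ⟨φ, h1, h2, h3⟩ := exists_openPartialHomeomorph isOpen_Ioo hsC hmono.injOn fun y hy =>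
    ⟨_, ((hder y hy).hasFDerivAt_equiv (hpos y hy).ne').fderiv.symm⟩
  have hbd : ∀ y ∈ I, |s y| ≤ M * l := by
    intro y hy
    have hy' : |y| < l := abs_lt.2 hy
    have h4 := intervalIntegral.norm_integral_le_of_norm_le_const (a := 0) (b := y) (C := M)
      (f := f) fun t ht => by
        have htI := hsub y hy (uIoc_subset_uIcc ht)
        rw [Real.norm_eq_abs, abs_of_pos (hpos t htI)]
        exact hM t htI
    rw [sub_zero, Real.norm_eq_abs] at h4
    have hM0 : 0 ≤ M := (hpos 0 h0).le.trans (hM 0 h0)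
    exact h4.trans (by gcongr)
  have hS := eq_Ioo_of_isConnected (S := s '' I) ((isConnected_Ioo (by linarith)).image s hsc)
    (h2 ▸ φ.open_target) ⟨-(M * l), by rintro _ ⟨y, hy, rfl⟩; exact (abs_le.1 (hbd y hy)).1⟩
    ⟨M * l, by rintro _ ⟨y, hy, rfl⟩; exact (abs_le.1 (hbd y hy)).2⟩
  set a := sInf (s '' I)
  set b := sSup (s '' I)
  have htar : φ.target = Ioo a b := h2.trans hS
  have h0' : (0 : ℝ) ∈ Ioo a b := hS ▸ ⟨0, h0, hs0⟩
  refine ⟨a, b, φ.symm, h0'.1, h0'.2, ?_, ?_, ?_, fun x hx => ?_⟩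
  · have h4 := φ.left_inv (x := 0) (by rw [h1]; exact h0)
    rwa [h3, hs0] at h4
  · rw [← htar]; exact φ.symm.injOn
  · rw [← htar, φ.symm_image_target_eq_source, h1]
  · rw [← htar] at hx
    have hx' : φ.symm x ∈ I := by
      rw [hI, ← h1]; exact φ.map_target hx
    refine φ.hasDerivAt_symm hx (hpos _ hx').ne' ?_
    rw [h3]
    exact hder _ hx'

theorem exists_jetBound_of_isCompact {E G : Type*} [NormedAddCommGroup E] [NormedSpace ℝ E]
    [NormedAddCommGroup G] [NormedSpace ℝ G] {f : E → G} {U K : Set E} {n : ℕ} (hU : IsOpen U)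
    (hf : ContDiffOn ℝ n f U) (hK : IsCompact K) (hKU : K ⊆ U) :
    ∃ M, 0 ≤ M ∧ JetBound n M f K := by
  have h1 : ∀ k : ℕ, ∃ M, 0 ≤ M ∧ (k ≤ n → ∀ x ∈ K, ‖iteratedFDeriv ℝ k f x‖ ≤ M) := by
    intro k
    by_cases hk : k ≤ n
    · have hc : ContinuousOn (iteratedFDeriv ℝ k f) K := by
        have := (hf.continuousOn_iteratedFDerivWithin (m := k) (by exact_mod_cast hk)
          hU.uniqueDiffOn).mono hKU
        exact this.congr fun x hx => (iteratedFDerivWithin_of_isOpen k hU (hKU hx)).symm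
      obtain ⟨M, hM⟩ := hK.exists_bound_of_continuousOn hc
      exact ⟨max M 0, le_max_right _ _, fun _ x hx => (hM x hx).trans (le_max_left _ _)⟩
    · exact ⟨0, le_rfl, fun h => absurd h hk⟩
  choose M hM0 hM using h1
  refine ⟨∑ k ∈ Finset.range (n + 1), M k, Finset.sum_nonneg fun k _ => hM0 k, fun k hk x hx => ?_⟩
  exact (hM k hk x hx).trans (Finset.single_le_sum (fun j _ => hM0 j)
    (Finset.mem_range.2 (by omega)))

theorem contDiffOn_inv_sqrt (n : ℕ) : ContDiffOn ℝ n (fun t : ℝ => (√t)⁻¹) (Ioi 0) := by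
  intro t ht
  have ht' : (0 : ℝ) < t := ht
  exact ((Real.contDiffAt_sqrt ht'.ne').inv (Real.sqrt_pos.2 ht').ne').contDiffWithinAt

/-- The inverse speed is t ↦ t^{-1/2} applied to ⟨c', c'⟩, whose values stay in a compact
subinterval of (0, ∞). -/
theorem exists_jetBound_inv_norm_deriv (n : ℕ) {m : ℝ} (hm : 0 < m) (M : ℝ) :
    ∃ K, 0 ≤ K ∧ ∀ (I : Set ℝ) (c : ℝ → Plane), IsOpen I → ContDiffOn ℝ (n + 1 : ℕ) c I →
      DerivBound (n + 1) M c I → (∀ y ∈ I, m ≤ ‖deriv c y‖) →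
      ContDiffOn ℝ n (fun y => ‖deriv c y‖⁻¹) I ∧ JetBound n K (fun y => ‖deriv c y‖⁻¹) I := by
  have hm2 : 0 < m ^ 2 / 2 := by positivity
  -- The interval is slightly larger than [m², M²], so that the values lie in an open set.
  obtain ⟨K₁, hK₁, hφ⟩ := exists_jetBound_of_isCompact isOpen_Ioi (contDiffOn_inv_sqrt n)
    (isCompact_Icc (a := m ^ 2 / 2) (b := M ^ 2 + 1)) fun t ht => hm2.trans_le ht.1
  set N := ‖(innerSL ℝ : Plane →L[ℝ] Plane →L[ℝ] ℝ)‖ * (2 ^ n * M * M) with hN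
  refine ⟨n.factorial * K₁ * max 1 N ^ n, by positivity, fun I c hI hc hcM hcm => ?_⟩
  have hdc : ContDiffOn ℝ n (deriv c) I :=
    ((contDiffOn_succ_iff_deriv_of_isOpen hI).1 (by exact_mod_cast hc)).2.2
  have hdM : JetBound n M (deriv c) I := fun k hk y hy => by
    rw [norm_iteratedFDeriv_eq_norm_iteratedDeriv, ← iteratedDeriv_succ',
      ← norm_iteratedFDeriv_eq_norm_iteratedDeriv]
    exact hcM (k + 1) (by omega) (by omega) y hy
  have hle : ∀ y ∈ I, ‖deriv c y‖ ≤ M := fun y hy => by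
    simpa using hdM 0 (Nat.zero_le _) y hy
  rcases I.eq_empty_or_nonempty with rfl | ⟨y₀, hy₀⟩
  · exact ⟨contDiffOn_empty, fun k _ x hx => absurd hx (notMem_empty x)⟩
  have hM0 : 0 ≤ M := (norm_nonneg _).trans (hle y₀ hy₀)
  have hNJ := JetBound.bilinear (innerSL ℝ : Plane →L[ℝ] Plane →L[ℝ] ℝ) hI hdc hdc hdM hdM hM0
  have hNc : ContDiffOn ℝ n (fun y => (innerSL ℝ : Plane →L[ℝ] Plane →L[ℝ] ℝ) (deriv c y)
      (deriv c y)) I := hdc.inner ℝ hdc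
  have hval : ∀ y, (innerSL ℝ : Plane →L[ℝ] Plane →L[ℝ] ℝ) (deriv c y) (deriv c y) =
      ‖deriv c y‖ ^ 2 := fun y => by
    rw [innerSL_apply_apply, real_inner_self_eq_norm_sq]
  have hmaps : MapsTo (fun y => (innerSL ℝ : Plane →L[ℝ] Plane →L[ℝ] ℝ) (deriv c y)
      (deriv c y)) I (Ioo (m ^ 2 / 2) (M ^ 2 + 1)) := fun y hy => by
    have h1 := pow_le_pow_left₀ hm.le (hcm y hy) 2
    have h2 := pow_le_pow_left₀ (norm_nonneg _) (hle y hy) 2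
    simp only [hval]
    constructor <;> linarith
  have hφc : ContDiffOn ℝ n (fun t : ℝ => (√t)⁻¹) (Ioo (m ^ 2 / 2) (M ^ 2 + 1)) :=
    (contDiffOn_inv_sqrt n).mono fun t ht => hm2.trans ht.1
  have hJ := JetBound.comp hI isOpen_Ioo hφc hNc hmaps
    (hφ.mono le_rfl le_rfl Ioo_subset_Icc_self) hNJ.derivBound hK₁
  have heq : (fun t : ℝ => (√t)⁻¹) ∘ (fun y => (innerSL ℝ : Plane →L[ℝ] Plane →L[ℝ] ℝ) (deriv c y)
      (deriv c y)) = fun y => ‖deriv c y‖⁻¹ := by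
    ext1 y
    simp only [Function.comp_apply, hval, Real.sqrt_sq (norm_nonneg _)]
  rw [heq] at hJ
  exact ⟨heq ▸ hφc.comp hNc hmaps, hJ⟩

/-- The reparametrization satisfies u' = (1/‖c'‖) ∘ u, so its derivatives are bounded by
bootstrapping, uniformly in the curve and in the length of the interval. -/
theorem exists_arcLength_bound (n : ℕ) {m : ℝ} (hm : 0 < m) {M : ℝ} (hM : 0 ≤ M) :
    ∃ K, ∀ (l : ℝ) (c : ℝ → Plane), 0 < l → ContDiffOn ℝ (n + 1 : ℕ) c (Ioo (-l) l) →
      DerivBound (n + 1) M c (Ioo (-l) l) → (∀ y ∈ Ioo (-l) l, m ≤ ‖deriv c y‖) →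
      ∃ (a b : ℝ) (u : ℝ → ℝ), a < 0 ∧ 0 < b ∧ u 0 = 0 ∧ InjOn u (Ioo a b) ∧
        u '' Ioo a b = Ioo (-l) l ∧ ContDiffOn ℝ (n + 1 : ℕ) (c ∘ u) (Ioo a b) ∧
        (∀ x ∈ Ioo a b, ‖deriv (c ∘ u) x‖ = 1) ∧ DerivBound (n + 1) K (c ∘ u) (Ioo a b) := by
  obtain ⟨K, hK, hV⟩ := exists_jetBound_inv_norm_deriv n hm M
  refine ⟨(n + 1).factorial * M * max 1 (flowBound K n) ^ (n + 1), fun l c hl hc hcM hcm => ?_⟩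
  obtain ⟨hVc, hVK⟩ := hV _ c isOpen_Ioo hc hcM hcm
  have hpos : ∀ y ∈ Ioo (-l) l, 0 < ‖deriv c y‖ := fun y hy => hm.trans_le (hcm y hy)
  have hcont : ContinuousOn (fun y => ‖deriv c y‖) (Ioo (-l) l) :=
    (hc.continuousOn_deriv_of_isOpen isOpen_Ioo (by norm_cast; omega)).norm
  obtain ⟨a, b, u, ha, hb, hu0, hui, huI, hud⟩ := exists_inverse_primitive hl hcont hpos (M := M)
    fun y hy => by
      have := hcM 1 le_rfl (by omega) y hy
      rwa [norm_iteratedFDeriv_eq_norm_iteratedDeriv, iteratedDeriv_one] at this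
  have hmaps : MapsTo u (Ioo a b) (Ioo (-l) l) := fun x hx => huI ▸ mem_image_of_mem u hx
  have huc := contDiffOn_of_hasDerivAt_comp isOpen_Ioo hmaps hud hVc
  have huB := derivBound_of_hasDerivAt_comp hK isOpen_Ioo isOpen_Ioo hmaps hud hVc hVK
  refine ⟨a, b, u, ha, hb, hu0, hui, huI, hc.comp huc hmaps, fun x hx => ?_,
    DerivBound.comp isOpen_Ioo isOpen_Ioo hc huc hmaps hcM huB hM⟩
  have hcd : HasDerivAt c (deriv c (u x)) (u x) :=
    ((hc.contDiffAt (isOpen_Ioo.mem_nhds (hmaps hx))).differentiableAt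
      (by simp)).hasDerivAt
  rw [(hcd.scomp x (hud x hx)).deriv, norm_smul, norm_inv, norm_norm,
    inv_mul_cancel₀ (hpos _ (hmaps hx)).ne']

/-- Unit speed gives (h')² = ‖β'(h)‖^{-2}. Hence `h` solves an autonomous equation as regular as β'
and bootstraps to the regularity of β: a C¹ unit-speed curve is as smooth as the regular curve
through which it factors. -/
theorem contDiffOn_unit_speed {n : ℕ} {γ β : ℝ → Plane} {h : ℝ → ℝ} {a b : ℝ} {J : Set ℝ}
    (hJ : IsOpen J) (hβ : ContDiffOn ℝ (n + 1 : ℕ) β J) (hβ0 : ∀ y ∈ J, deriv β y ≠ 0)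
    (hh : ContDiffOn ℝ 1 h (Ioo a b)) (hhJ : MapsTo h (Ioo a b) J)
    (hγ : ∀ x ∈ Ioo a b, γ x = β (h x)) (hγ1 : ∀ x ∈ Ioo a b, ‖deriv γ x‖ = 1) :
    ContDiffOn ℝ (n + 1 : ℕ) γ (Ioo a b) ∧
      ∀ x ∈ Ioo a b, deriv γ x = deriv h x • deriv β (h x) := by
  have hβd : ∀ y ∈ J, HasDerivAt β (deriv β y) y := fun y hy =>
    ((hβ.contDiffAt (hJ.mem_nhds hy)).differentiableAt (by simp)).hasDerivAt
  have hhd : ∀ x ∈ Ioo a b, HasDerivAt h (deriv h x) x := fun x hx =>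
    ((hh.contDiffAt (isOpen_Ioo.mem_nhds hx)).differentiableAt (by simp)).hasDerivAt
  have hγd : ∀ x ∈ Ioo a b, deriv γ x = deriv h x • deriv β (h x) := fun x hx => by
    have h1 : γ =ᶠ[𝓝 x] β ∘ h := by
      filter_upwards [isOpen_Ioo.mem_nhds hx] with z hz using hγ z hz
    rw [h1.deriv_eq]
    exact ((hβd _ (hhJ hx)).scomp x (hhd x hx)).deriv
  have hβ' : ContDiffOn ℝ n (deriv β) J :=
    ((contDiffOn_succ_iff_deriv_of_isOpen hJ).1 (by exact_mod_cast hβ)).2.2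
  have hV : ContDiffOn ℝ n (fun y => ‖deriv β y‖⁻¹) J :=
    (hβ'.norm ℝ hβ0).inv fun y hy => (norm_pos_iff.2 (hβ0 y hy)).ne'
  have hsq : EqOn (deriv h ^ 2) ((fun x => ‖deriv β (h x)‖⁻¹) ^ 2) (Ioo a b) := fun x hx => by
    have h1 := hγ1 x hx
    rw [hγd x hx, norm_smul, Real.norm_eq_abs] at h1
    simp only [Pi.pow_apply]
    rw [← eq_inv_of_mul_eq_one_left h1, sq_abs]
  have hc1 : ContinuousOn (deriv h) (Ioo a b) :=
    hh.continuousOn_deriv_of_isOpen isOpen_Ioo le_rfl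
  have hc2 : ContinuousOn (fun x => ‖deriv β (h x)‖⁻¹) (Ioo a b) :=
    hV.continuousOn.comp hh.continuousOn hhJ
  have hhC : ContDiffOn ℝ (n + 1 : ℕ) h (Ioo a b) := by
    -- The sign of h' is constant because the interval is connected and h' never vanishes.
    rcases isPreconnected_Ioo.eq_or_eq_neg_of_sq_eq hc1 hc2 hsq
      (fun {x} hx => inv_ne_zero (norm_pos_iff.2 (hβ0 _ (hhJ hx))).ne') with hs | hs
    · refine contDiffOn_of_hasDerivAt_comp isOpen_Ioo hhJ (fun x hx => ?_) hV
      have := hhd x hx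
      rwa [hs hx] at this
    · refine contDiffOn_of_hasDerivAt_comp isOpen_Ioo hhJ (fun x hx => ?_) hV.neg
      have := hhd x hx
      rwa [hs hx] at this
  exact ⟨(hβ.comp hhC hhJ).congr hγ, hγd⟩

end ArcLength

/-! ### Regularity of the local vertical manifold. -/

section LocalVertical

variable {r : ℕ} {L ε lam ρ A B A' δ c σ τ η M C : ℝ} {Ω : Set Plane} {F : Plane → Plane}
  {p e : Plane} {T : ℕ → Plane ≃L[ℝ] Plane} {R : ℕ → Plane → Plane} {g : ℕ → ℝ → ℝ}
  {Φ : ℕ → OpenPartialHomeomorph Plane Plane} {G : ℕ → Plane → Plane}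

theorem IsRegularChartSystem.derivBound_axis
    (hS : IsRegularChartSystem r L ε lam ρ A B A' C Ω F p e Φ G)
    (hCω : 0 ≤ C * (1 + coneOpening ε ρ A A')) (n : ℕ) :
    DerivBound r (r.factorial * (C * (1 + coneOpening ε ρ A A')) * max 1 ‖axis‖ ^ r)
      ((Φ n).symm ∘ axis)
      (Ioo (-(regularRadius L ε lam ρ A A' C n)) (regularRadius L ε lam ρ A A' C n)) :=
  DerivBound.comp isOpen_Ioo (Φ n).open_target (hS.contDiffOn_symm n) axis.contDiff.contDiffOn
    (fun y hy => by rw [hS.target_eq]; exact axis_mem_box (abs_lt.2 hy))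
    (fun k h1 hk z hz => hS.norm_symm_le n z hz k h1 hk) (DerivBound.clm r axis _) hCω

/-- Composing with the chart gives back the axis, which has unit speed, so the derivative bound on
the chart is a lower bound on the speed. -/
theorem IsRegularChartSystem.one_le_norm_deriv_axis
    (hS : IsRegularChartSystem r L ε lam ρ A B A' C Ω F p e Φ G) (hr : 1 ≤ r) {n : ℕ} {y : ℝ}
    (hy : y ∈ Ioo (-(regularRadius L ε lam ρ A A' C n)) (regularRadius L ε lam ρ A A' C n)) :
    1 ≤ C * distortion L ε lam ρ A A' n * ‖deriv ((Φ n).symm ∘ axis) y‖ := by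
  have htar : ∀ y ∈ Ioo (-(regularRadius L ε lam ρ A A' C n)) (regularRadius L ε lam ρ A A' C n),
      axis y ∈ (Φ n).target := fun y hy => by
    rw [hS.target_eq]; exact axis_mem_box (abs_lt.2 hy)
  have hsrc := (Φ n).map_target (htar y hy)
  have h1 : HasDerivAt ((Φ n).symm ∘ axis) (deriv ((Φ n).symm ∘ axis) y) y :=
    ((((hS.contDiffOn_symm n).contDiffAt ((Φ n).open_target.mem_nhds (htar y hy))).differentiableAt
      (by norm_cast; omega)).comp y axis.differentiableAt).hasDerivAt
  have h2 : HasFDerivAt (Φ n) (fderiv ℝ (Φ n) ((Φ n).symm (axis y))) ((Φ n).symm (axis y)) :=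
    (((hS.contDiffOn n).contDiffAt ((Φ n).open_source.mem_nhds hsrc)).differentiableAt
      (by norm_cast; omega)).hasFDerivAt
  have h3 : Φ n ∘ ((Φ n).symm ∘ axis) =ᶠ[𝓝 y] axis := by
    filter_upwards [isOpen_Ioo.mem_nhds hy] with z hz using (Φ n).right_inv (htar z hz)
  have h4 := ((h2.comp_hasDerivAt y h1).congr_of_eventuallyEq h3.symm).unique axis.hasDerivAt
  have h5 := (fderiv ℝ (Φ n) ((Φ n).symm (axis y))).le_opNorm (deriv ((Φ n).symm ∘ axis) y)
  rw [h4, norm_axis, abs_one] at h5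
  refine h5.trans ?_
  gcongr
  rw [← norm_iteratedFDeriv_one', ← pow_one (distortion L ε lam ρ A A' n)]
  exact hS.norm_le n _ hsrc 1 le_rfl hr

/-- One iterate `F^N` carries the whole local piece into a leaf, so the curve factors through a
C^{r+1} pullback of that leaf with a C¹ change of parameter. This yields the derivative of order r +
1 and the tangent direction, without a bound. -/
theorem IsRegularChartSystem.contDiffOn_arcLength
    (hS : IsRegularChartSystem r L ε lam ρ A B A' C Ω F p e Φ G)
    (ho : IsRegularOrbit r L ε lam ρ A B A' δ Ω F p e)
    (h : IsAdapted r ε lam ρ c σ τ η M Ω F p e T R g) (hr : 1 ≤ r)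
    (hrb : RateBounds ε lam ρ) (hL : 1 ≤ L) (hC : 1 ≤ C) (hc : 1 ≤ c) (hσ : 0 < σ)
    (hs : IsSmallPerturbation ε lam ρ τ η) {γ : ℝ → Plane} {a b : ℝ}
    (hγ : ContDiffOn ℝ 1 γ (Ioo a b)) (hγS : MapsTo γ (Ioo a b) (localVertical (Φ 0)))
    (hγ1 : ∀ x ∈ Ioo a b, ‖deriv γ x‖ = 1) :
    ContDiffOn ℝ (r + 1 : ℕ) γ (Ioo a b) ∧
      ∀ x ∈ Ioo a b, γ x = p → deriv γ x ∈ Submodule.span ℝ {e} := by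
  have hF := ho.diffeo
  obtain ⟨N, hN⟩ := hS.eventually_mem_leaf ho h hr hrb hL hC hc hσ hs 0
  have hN' : ∀ x ∈ Ioo a b, F^[N] (γ x) ∈ leaf F p T g N '' Ioo (-(σ / 2)) (σ / 2) :=
    fun x hx => by
      have := hN _ (hγS hx) N le_rfl
      rwa [zero_add] at this
  obtain ⟨β, hβ⟩ := h.exists_isLeafPullback hF (σ / 2) N
  have hγΩ : MapsTo γ (Ioo a b) Ω := fun x hx => hS.source_subset 0 (hγS hx).1
  have hdom : MapsTo (fun x => leafCoord F p T N (F^[N] (γ x))) (Ioo a b)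
      (leafDomain Ω F p T g (σ / 2) N) := fun x hx =>
    ⟨leafCoord_mem (hN' x hx), γ x, hγΩ hx, (leaf_leafCoord (hN' x hx)).symm⟩
  have hγβ : ∀ x ∈ Ioo a b, γ x = β (leafCoord F p T N (F^[N] (γ x))) := fun x hx => by
    refine hF.injOn_iterate N (hγΩ hx) (hβ.mem _ (hdom hx)) ?_
    rw [hβ.iterate_eq _ (hdom hx), leaf_leafCoord (hN' x hx)]
  have hcoord : ContDiff ℝ 1 (leafCoord F p T N) :=
    (EuclideanSpace.proj (𝕜 := ℝ) (1 : Fin 2) : Plane →L[ℝ] ℝ).contDiff.comp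
      ((T N).contDiff.comp (contDiff_id.sub contDiff_const))
  have hh : ContDiffOn ℝ 1 (fun x => leafCoord F p T N (F^[N] (γ x))) (Ioo a b) :=
    hcoord.comp_contDiffOn (((hF.contDiffOn_iterate N).of_le (by norm_cast; omega)).comp hγ hγΩ)
  obtain ⟨h1, h2⟩ := contDiffOn_unit_speed hβ.isOpen hβ.contDiffOn
    (fun y hy => hβ.deriv_ne_zero h hF hy) hh hdom hγβ hγ1
  refine ⟨h1, fun x hx hxp => ?_⟩
  rw [h2 x hx]
  refine Submodule.smul_mem _ _ (hβ.deriv_mem_span h hF hrb (hdom hx) ?_)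
  rw [← hγβ x hx, hxp]

/-- The bound `K` comes from the chart estimates alone and is fixed before the orbit, the charts and
the adapted coordinates; the latter contribute only class and tangency. -/
theorem exists_hasBoundedArcLength (hr : 1 ≤ r) (hrb : RateBounds ε lam ρ) (hL : 1 ≤ L)
    (hA : 0 < A) (hA' : 0 < A') (hC : 1 ≤ C) (B δ : ℝ) :
    ∃ K : ℝ, ∀ {Ω : Set Plane} {F : Plane → Plane} {p e : Plane}
      {Φ : ℕ → OpenPartialHomeomorph Plane Plane} {G : ℕ → Plane → Plane} {c σ τ η M : ℝ}
      {T : ℕ → Plane ≃L[ℝ] Plane} {R : ℕ → Plane → Plane} {g : ℕ → ℝ → ℝ},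
      IsRegularOrbit r L ε lam ρ A B A' δ Ω F p e →
      IsRegularChartSystem r L ε lam ρ A B A' C Ω F p e Φ G →
      IsAdapted r ε lam ρ c σ τ η M Ω F p e T R g → 1 ≤ c → 0 < σ →
      IsSmallPerturbation ε lam ρ τ η →
      HasBoundedArcLength r K (localVertical (Φ 0)) p e := by
  obtain ⟨n, rfl⟩ := Nat.exists_eq_add_of_le' hr
  have hω := coneOpening_nonneg hrb hA hA'
  have hd0 := distortion_pos hrb hL hA hA' 0
  have hC0 : 0 < C := by linarith
  have hCω : 0 ≤ C * (1 + coneOpening ε ρ A A') := by positivity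
  have hm : 0 < (C * distortion L ε lam ρ A A' 0)⁻¹ := by positivity
  obtain ⟨K, hK⟩ := exists_arcLength_bound n hm
    (M := (n + 1).factorial * (C * (1 + coneOpening ε ρ A A')) * max 1 ‖axis‖ ^ (n + 1))
    (by positivity)
  refine ⟨K, fun {Ω F p e Φ G c σ τ η M T R g} ho hS h hc hσ hs => ?_⟩
  set l := regularRadius L ε lam ρ A A' C 0 with hl
  have hlpos : 0 < l := regularRadius_pos hrb hL hA hA' hC 0
  have htar : MapsTo axis (Ioo (-l) l) (Φ 0).target := fun y hy => by
    rw [hS.target_eq]; exact axis_mem_box (abs_lt.2 hy)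
  obtain ⟨a, b, u, ha, hb, hu0, hui, huI, hγc, hγ1, hγK⟩ := hK l ((Φ 0).symm ∘ axis) hlpos
    ((hS.contDiffOn_symm 0).comp axis.contDiff.contDiffOn htar) (hS.derivBound_axis hCω 0)
    (fun y hy => by
      rw [inv_le_iff_one_le_mul₀ (by positivity), mul_comm]
      exact hS.one_le_norm_deriv_axis hr hy)
  have hmaps : MapsTo u (Ioo a b) (Ioo (-l) l) := fun x hx => huI ▸ mem_image_of_mem u hx
  have himage : ((Φ 0).symm ∘ axis) ∘ u '' Ioo a b = localVertical (Φ 0) := by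
    rw [image_comp, huI, hS.localVertical_eq]
    rfl
  have hγ0 : (((Φ 0).symm ∘ axis) ∘ u) 0 = p := by
    simp only [Function.comp_apply, hu0, _root_.map_zero]
    rw [← hS.map_base 0, (Φ 0).left_inv (hS.mem_source 0)]
    rfl
  obtain ⟨h1, h2⟩ := hS.contDiffOn_arcLength ho h hr hrb hL hC hc hσ hs
    (hγc.of_le (by simp)) (fun x hx => himage ▸ mem_image_of_mem _ hx) hγ1
  refine ⟨a, b, ((Φ 0).symm ∘ axis) ∘ u, ha, hb, hγ0, fun x hx x' hx' hxx => hui hx hx' ?_, himage,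
    h1, hγ1, h2 0 ⟨ha, hb⟩ hγ0, fun t ht k hk1 hk => ?_⟩
  · have h3 := congrArg (fun z : Plane => z 1)
      ((Φ 0).symm.injOn (htar (hmaps hx)) (htar (hmaps hx')) hxx)
    simpa [axis_apply_one] using h3
  · rw [← norm_iteratedFDeriv_eq_norm_iteratedDeriv]
    exact hγK k hk1 hk t ht

end LocalVertical

end QPesin

end

/-! ### The canonical strong stable manifold. -/

theorem theoremA (r : ℕ) (hr : 1 ≤ r) (L ε lam ρ A B A' δ : ℝ)
    (hL : 1 ≤ L) (hε : ε ∈ Set.Ioo (0 : ℝ) 1) (hlam : lam ∈ Set.Ioo (0 : ℝ) 1)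
    (hρ : ρ ∈ Set.Ioo (0 : ℝ) 1) (hδ : 0 < δ)
    (hreg₁ : ρ ^ (((r : ℝ) + 1) - ε * (r + 3)) / lam ^ ((1 + ε) * r) < 1)
    (hreg₂ : lam ^ ((1 - ε) * ((r : ℝ) + 1)) / ρ ^ ((r : ℝ) + ε * (2 - r)) < 1)
    (hst₁ : lam ^ (1 - ε) < ρ ^ (8 * ε) * lam ^ (4 * ε))
    (hst₂ : lam ^ (1 - ε) < lam ^ (1 + ε) / ρ ^ (1 - ε)) :
    (∃ C : ℝ, 1 ≤ C ∧
      ∀ (Ω : Set QPesin.Plane) (F : QPesin.Plane → QPesin.Plane) (p e : QPesin.Plane),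
        QPesin.IsRegularOrbit r L ε lam ρ A B A' δ Ω F p e →
        ∃ (Φ : ℕ → OpenPartialHomeomorph QPesin.Plane QPesin.Plane)
          (G : ℕ → QPesin.Plane → QPesin.Plane),
          QPesin.IsRegularChartSystem r L ε lam ρ A B A' C Ω F p e Φ G) ∧
    (∀ C : ℝ, 1 ≤ C → ∃ K : ℝ,
      ∀ (Ω : Set QPesin.Plane) (F : QPesin.Plane → QPesin.Plane) (p e : QPesin.Plane),
        QPesin.IsRegularOrbit r L ε lam ρ A B A' δ Ω F p e →
        ∀ (Φ : ℕ → OpenPartialHomeomorph QPesin.Plane QPesin.Plane)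
          (G : ℕ → QPesin.Plane → QPesin.Plane),
          QPesin.IsRegularChartSystem r L ε lam ρ A B A' C Ω F p e Φ G →
          QPesin.strongStable ε lam Ω F p = ⋃ n, QPesin.stablePiece Ω F Φ n ∧
          (∃ γ : ℕ → ℝ → QPesin.Plane,
            QPesin.IsCurveAtlas (r + 1) (QPesin.strongStable ε lam Ω F p) γ ∧
            (∀ n i, IsOpen {t : ℝ | t ∈ Set.Ioo (-1) 1 ∧ γ i t ∈ QPesin.stablePiece Ω F Φ n}) ∧
            ∀ i, ∀ t ∈ Set.Ioo (-1 : ℝ) 1, γ i t = p → deriv (γ i) t ∈ Submodule.span ℝ {e}) ∧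
          QPesin.HasBoundedArcLength r K (QPesin.localVertical (Φ 0)) p e) := by
  have hrb := QPesin.rateBounds hr hε hlam hρ hreg₁ hst₁
  refine ⟨QPesin.exists_isRegularChartSystem hr hrb hL hδ A B A', fun C hC => ?_⟩
  by_cases hpos : 0 < A ∧ 0 < B ∧ 0 < A'
  swap
  · exact ⟨0, fun Ω F p e ho => absurd ho.bounds_pos hpos⟩
  obtain ⟨hA, hB, hA'⟩ := hpos
  obtain ⟨K, hK⟩ := QPesin.exists_hasBoundedArcLength hr hrb hL hA hA' hC B δ
  -- The adapted coordinates are auxiliary here: slopes up to 1 are allowed, and none of their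
  -- constants enters `K`.
  obtain ⟨η, hη, hs⟩ := QPesin.exists_isSmallPerturbation hrb
  obtain ⟨c, σ, M, hc, hσ, -, had⟩ :=
    QPesin.exists_isAdapted hr hrb hL hδ hA hB hA' one_pos hη
  refine ⟨K, fun Ω F p e ho Φ G hS => ?_⟩
  obtain ⟨T, R, g, h⟩ := had Ω F p e ho
  exact ⟨(hS.strongStable_eq ho h hr hrb hL hC hc hσ hs).1,
    hS.exists_isCurveAtlas ho h hr hrb hL hC hc hσ hs, hK ho hS h hc hσ hs⟩
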